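/- Consider the class of free-boundary problems for the unknowns $u,v,S_1,S_2$, functions of $(t,\mathbf x)$ with $t\in\mathfrak T=(t_*,\infty)$ and $\mathbf x=(x_1,x_2,x_3)$: $$u_t=\nabla\cdot(d_1(u)\nabla u),\qquad v_t=\nabla\cdot(d_2(v)\nabla v),$$ $$S_1=0:\quad d_1(u_v)\,\partial u/\partial\mathbf n_1=H_v\mathbf V_1\cdot\mathbf n_1-\mathbf Q(t)\cdot\mathbf n_1,\quad u=u_v,$$ $$S_2=0:\quad d_2(v_m)\,\partial v/\partial\mathbf n_2=d_1(u_m)\,\partial u/\partial\mathbf n_2+H_m\mathbf V_2\cdot\mathbf n_2,\quad u=u_m,\ v=v_m,$$ $$|\mathbf x|=\infty:\quad v=v_\infty ,$$ where $\mathbf n_k$ is the unit normal and $\mathbf V_k$ the velocity of the surface $S_k=0$. Here $d_1,d_2$ are smooth positive functions on open intervals containing $u_v,u_m$ and $v_m,v_\infty$ respectively, $d_1\neq d_2$ as functions, $u_v\ne u_m$, $v_m\neq v_\infty$, $H_v,H_m>0$, $t_*\in\mathbb R$, and $\mathbf Q$ is smooth and nowhere zero on $\mathfrak T$. The surfaces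 obey $\partial_tS_k\ne0$, $\nabla S_k\neq0$, $\mathbf Q\cdot\mathbf n_1\ne0$. Such a problem is called invariant under a local Lie group of point transformations $t^*=T(t,\mathbf x,\varepsilon)$, $\mathbf x^*=\mathbf X(t,\mathbf x,\varepsilon)$, $(u^*,v^*)=U(t,\mathbf x,u,v,\varepsilon)$, $S_k^*=S_k$, if the prolonged group leaves invariant the manifold of the two governing equations, the manifold of the conditions on each of the surfaces $S_1=0$, $S_2=0$, and the manifold $\{|\mathbf x|=\infty,\ v=v_\infty\}$ (the transformations close to the identity are defined near it, and $|\mathbf x^*|\to\infty$, $v^*\to v_\infty$ as $|\mathbf x|\to\infty$, $v\to v_\infty$). Its maximal group of invariance (MGI) is an invariance group whose Lie algebra contains the generators of every invariance group. Two problems of the class are equivalent if they are related by $$\tilde t=\alpha t+\gamma_0,\ \ \tilde{\mathbf x}=\beta R\mathbf x+\Gamma,\ \ \tilde u=\delta_1u+\gamma_4,\ \ \tilde v=\delta_2v+\gamma_5,\ \ \tilde S_k=S_k,$$ with $R\in SO(3)$, $\alpha\beta\delta_1\delta_2\ne0$, the data being transformed by $\tilde d_k=\frac{\beta^2}{\alpha}d_k$,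 $\tilde d_1(\tilde u_v)=\frac{\beta}{\delta_1}d_1(u_v)$, $\tilde d_1(\tilde u_m)=\frac{\beta}{\delta_1}d_1(u_m)$, $\tilde d_2(\tilde v_m)=\frac{\beta}{\delta_2}d_2(v_m)$, $\tilde H_v=\frac{\alpha}{\beta}H_v$, $\tilde H_m=\frac{\alpha}{\beta}H_m$, $\tilde{\mathbf Q}(\tilde t)=R\,\mathbf Q(t)$, and the constants $u_v,u_m,v_m,v_\infty$ and the intervals being mapped accordingly. Put $\theta_1(\tau)=x_1\cos\tau+x_2\sin\tau$, $\theta_2(\tau)=-x_1\sin\tau+x_2\cos\tau$, $\Theta_1(\tau)=q_1\cos\tau+q_2\sin\tau$, $\Theta_2(\tau)=-q_1\sin\tau+q_2\cos\tau$, and consider the one-parameter groups (variables not mentioned are unchanged) $T_0:t^*=t+\varepsilon$; $T_a: x_a^*=x_a+\varepsilon$ $(a=1,2,3)$; $T_4:t^*=e^{2\varepsilon}t,\ \mathbf x^*=e^\varepsilon\mathbf x$; $T_5:x_1^*=\theta_1(\varepsilon),\ x_2^*=\theta_2(\varepsilon)$; $T_6: t^*=t+\varepsilon,\ x_1^*=\theta_1(\lambda\varepsilon),\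 x_2^*=\theta_2(\lambda\varepsilon)$; $T_7: t^*=e^{2\varepsilon}t,\ x_1^*=e^\varepsilon\theta_1(\lambda\varepsilon),\ x_2^*=e^\varepsilon\theta_2(\lambda\varepsilon),\ x_3^*=e^\varepsilon x_3$. **Theorem.** (i) Every problem of the class is invariant under the three-parameter group (case 1) generated by $T_1,T_2,T_3$. (ii) The MGI of every problem of the class depends only on $\mathbf Q$ (on $\mathfrak T$), not on $d_1,d_2$. (iii) In each of the following cases the problem is invariant under the group listed: * case 2: $\mathbf Q=(0,0,q(t))$; group generated by $T_1,T_2,T_3,T_5$; * case 3: $\mathbf Q=(\Theta_1(\lambda t),\Theta_2(\lambda t),q_3)$; $T_1,T_2,T_3,T_6$; * case 4: $t_*\ge0$, $\mathbf Q=t^{-1/2}\big(\Theta_1(\tfrac12\lambda\log t),\Theta_2(\tfrac12\lambda\log t),q_3\big)$; $T_1,T_2,T_3,T_7$; * case 5: $\mathbf Q=(0,0,q)$, $q$ constant; $T_0,T_1,T_2,T_3,T_5$; * case 6: $t_*\ge0$, $\mathbf Q=(0,0,q/\sqrt t)$, $q$ constant; $T_1,T_2,T_3,T_4,T_5$. This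 group is the MGI provided that, in case 2, $q(t)$ is neither constant nor of the form $c/\sqrt{t-s}$ with $s\le t_*$ on $\mathfrak T$, and, in cases 3 and 4, $\lambda\neq0$ and $q_1^2+q_2^2\neq0$; cases 5 and 6 need no proviso. (iv) A problem of the class has an MGI of dimension greater than three if and only if it is equivalent to a problem of one of the cases 2–6 (under these provisos); the dimension is then four in cases 2–4 and five in cases 5, 6. Otherwise its MGI is the group generated by $T_1,T_2,T_3$. The five cases are mutually inequivalent. -/

import Mathlib

open scoped ContDiff Topology

noncomputable section

namespace StefanBVP

/-! ### The space of variables `(t, x, u, v)` -/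

/-- Physical space `ℝ³` with its Euclidean structure. -/
abbrev E3 : Type := EuclideanSpace ℝ (Fin 3)

/-- Independent variables `(t, x)`. -/
abbrev Base : Type := ℝ × E3

/-- Dependent variables `(u, v)`. -/
abbrev Fibre : Type := ℝ × ℝ

/-- All variables `((t, x), (u, v))`. -/
abbrev Point : Type := Base × Fibre

/-! ### Differential operators acting on functions of `(t, x)` -/

/-- Time derivative `∂f/∂t`. -/
def dt (f : Base → ℝ) (b : Base) : ℝ := fderiv ℝ f b (1, 0)

/-- Space derivative `∂f/∂x_a`. -/
def dx (a : Fin 3) (f : Base → ℝ) (b : Base) : ℝ :=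
  fderiv ℝ f b (0, EuclideanSpace.single a 1)

/-- Spatial gradient `∇f`. -/
def grad (f : Base → ℝ) (b : Base) : E3 := WithLp.toLp 2 (fun a => dx a f b)

/-- `∇ · (d(u) ∇u)`. -/
def divFlux (d : ℝ → ℝ) (u : Base → ℝ) (b : Base) : ℝ :=
  ∑ a : Fin 3, dx a (fun q => d (u q) * dx a u q) b

/-- Unit normal `n = ∇S / |∇S|` to the moving surface `S(t, x) = 0`.  The interface conditions
below are linear homogeneous in `n`, so the choice of orientation is immaterial. -/
def normal (S : Base → ℝ) (b : Base) : E3 := ‖grad S b‖⁻¹ • grad S b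

/-- Normal derivative `∂f/∂n` on the surface `S = 0`. -/
def normalDeriv (S f : Base → ℝ) (b : Base) : ℝ := inner ℝ (grad f b) (normal S b)

/-- Normal velocity `V · n` of the moving surface `S(t, x) = 0`, where `V` is any velocity of the
surface, i.e. `∂S/∂t + V · ∇S = 0`. -/
def normalVelocity (S : Base → ℝ) (b : Base) : ℝ := -dt S b / ‖grad S b‖

/-! ### The class of boundary value problems -/

/-- The data of a two-phase Stefan problem with free boundaries `S₁ = 0`, `S₂ = 0`,
on the time interval `(tStar, ∞)`:

* `u_t = ∇ · (d₁(u) ∇u)`, `v_t = ∇ · (d₂(v) ∇v)`;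
* `S₁ = 0`: `d₁(u_v) ∂u/∂n₁ = H_v V₁ · n₁ - Q(t) · n₁`, `u = u_v`;
* `S₂ = 0`: `d₂(v_m) ∂v/∂n₂ = d₁(u_m) ∂u/∂n₂ + H_m V₂ · n₂`, `u = u_m`, `v = v_m`;
* `|x| = ∞`: `v = v_inf`.

The diffusivities are positive smooth functions on open intervals `I₁`, `I₂`, and they are
different functions. -/
structure BVP where
  tStar : ℝ
  I₁ : Set ℝ
  I₂ : Set ℝ
  d₁ : ℝ → ℝ
  d₂ : ℝ → ℝ
  u_v : ℝ
  u_m : ℝ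
  v_m : ℝ
  v_inf : ℝ
  H_v : ℝ
  H_m : ℝ
  Q : ℝ → E3
  isOpen_I₁ : IsOpen I₁
  isOpen_I₂ : IsOpen I₂
  ordConnected_I₁ : I₁.OrdConnected
  ordConnected_I₂ : I₂.OrdConnected
  smooth_d₁ : ContDiffOn ℝ ∞ d₁ I₁
  smooth_d₂ : ContDiffOn ℝ ∞ d₂ I₂
  d₁_pos : ∀ s ∈ I₁, 0 < d₁ s
  d₂_pos : ∀ s ∈ I₂, 0 < d₂ s
  d_ne : I₁ = I₂ → ∃ s ∈ I₁, d₁ s ≠ d₂ s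
  u_v_mem : u_v ∈ I₁
  u_m_mem : u_m ∈ I₁
  v_m_mem : v_m ∈ I₂
  v_inf_mem : v_inf ∈ I₂
  u_v_ne_u_m : u_v ≠ u_m
  v_m_ne_v_inf : v_m ≠ v_inf
  H_v_pos : 0 < H_v
  H_m_pos : 0 < H_m
  smooth_Q : ContDiffOn ℝ ∞ Q (Set.Ioi tStar)
  Q_ne_zero : ∀ t, tStar < t → Q t ≠ 0

namespace BVP

variable (B : BVP)

/-- The part of the space of variables `(t, x, u, v)` on which the problem is posed. -/
def domain : Set Point :=
  {p | B.tStar < p.1.1 ∧ p.2.1 ∈ B.I₁ ∧ p.2.2 ∈ B.I₂}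

/-- The 2-jet at `b` of `w = (u, v)` lies on the manifold of the governing equations. -/
def OnEquations (w : Base → Fibre) (b : Base) : Prop :=
  dt (fun q => (w q).1) b = divFlux B.d₁ (fun q => (w q).1) b ∧
  dt (fun q => (w q).2) b = divFlux B.d₂ (fun q => (w q).2) b

/-- The 1-jet at `b` of `(w, S₁)` lies on the manifold of the conditions on `S₁ = 0`
(including the standing non-degeneracy restrictions on the free surface). -/
def OnSurface₁ (w : Base → Fibre) (S : Base → ℝ) (b : Base) : Prop :=
  S b = 0 ∧ dt S b ≠ 0 ∧ grad S b ≠ 0 ∧ inner ℝ (B.Q b.1) (normal S b) ≠ 0 ∧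
  B.d₁ B.u_v * normalDeriv S (fun q => (w q).1) b
    = B.H_v * normalVelocity S b - inner ℝ (B.Q b.1) (normal S b) ∧
  (w b).1 = B.u_v

/-- The 1-jet at `b` of `(w, S₂)` lies on the manifold of the conditions on `S₂ = 0`
(including the standing non-degeneracy restrictions on the free surface). -/
def OnSurface₂ (w : Base → Fibre) (S : Base → ℝ) (b : Base) : Prop :=
  S b = 0 ∧ dt S b ≠ 0 ∧ grad S b ≠ 0 ∧
  B.d₂ B.v_m * normalDeriv S (fun q => (w q).2) b
    = B.d₁ B.u_m * normalDeriv S (fun q => (w q).1) b + B.H_m * normalVelocity S b ∧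
  (w b).1 = B.u_m ∧ (w b).2 = B.v_m

end BVP

/-! ### Local Lie groups of point transformations -/

/-- A point transformation `t* = T(t, x)`, `x* = X(t, x)`, `(u*, v*) = U(t, x, u, v)`. -/
structure PointTransformation where
  base : Base → Base
  fibre : Base → Fibre → Fibre

namespace PointTransformation

/-- The transformation as a map of the space of all variables. -/
def toFun (g : PointTransformation) (p : Point) : Point := (g.base p.1, g.fibre p.1 p.2)

/-- Composition: first `h`, then `g`. -/
def comp (g h : PointTransformation) : PointTransformation where
  base b := g.base (h.base b)
  fibre b w := g.fibre (h.base b) (h.fibre b w)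

/-- A transformation of `(t, x)` only, with `u* = u`, `v* = v`. -/
def ofBase (f : Base → Base) : PointTransformation where
  base := f
  fibre _ w := w

end PointTransformation

/-- An `N`-parameter family of point transformations, with parameters `ε ∈ ℝᴺ`. -/
abbrev Family (N : ℕ) : Type := (Fin N → ℝ) → PointTransformation

/-- The generator `X_i` of a family: its coordinates `∂(t*, x*, u*, v*)/∂ε_i` at `ε = 0`. -/
def Family.generator {N : ℕ} (G : Family N) (i : Fin N) (p : Point) : Point :=
  deriv (fun s : ℝ => (G (Pi.single i s)).toFun p) 0

/-- An `N`-parameter local Lie group, in coordinates around the unit element `0 ∈ ℝᴺ`. -/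
structure LocalLieGroup (N : ℕ) where
  carrier : Set (Fin N → ℝ)
  mulDom : Set ((Fin N → ℝ) × (Fin N → ℝ))
  mul : (Fin N → ℝ) → (Fin N → ℝ) → (Fin N → ℝ)
  inv : (Fin N → ℝ) → (Fin N → ℝ)
  isOpen_carrier : IsOpen carrier
  isOpen_mulDom : IsOpen mulDom
  mulDom_subset : mulDom ⊆ carrier ×ˢ carrier
  zero_mem : 0 ∈ carrier
  mul_mem : ∀ a b, (a, b) ∈ mulDom → mul a b ∈ carrier
  inv_mem : ∀ a ∈ carrier, inv a ∈ carrier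
  smooth_mul : ContDiffOn ℝ ∞ (fun q : (Fin N → ℝ) × (Fin N → ℝ) => mul q.1 q.2) mulDom
  smooth_inv : ContDiffOn ℝ ∞ inv carrier
  zero_mul : ∀ a ∈ carrier, (0, a) ∈ mulDom ∧ mul 0 a = a
  mul_zero : ∀ a ∈ carrier, (a, 0) ∈ mulDom ∧ mul a 0 = a
  inv_mul : ∀ a ∈ carrier, (inv a, a) ∈ mulDom ∧ mul (inv a) a = 0
  mul_inv : ∀ a ∈ carrier, (a, inv a) ∈ mulDom ∧ mul a (inv a) = 0
  assoc : ∀ a b c, (a, b) ∈ mulDom → (b, c) ∈ mulDom → (mul a b, c) ∈ mulDom →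
    (a, mul b c) ∈ mulDom → mul (mul a b) c = mul a (mul b c)

/-- The family `G`, considered for `(ε, p) ∈ W`, is a smooth local action of the local Lie group
`L` on the open set `D`, with linearly independent generators (no parameter is redundant). -/
structure IsLocalAction {N : ℕ} (L : LocalLieGroup N) (D : Set Point)
    (W : Set ((Fin N → ℝ) × Point)) (G : Family N) : Prop where
  isOpen : IsOpen W
  subset : W ⊆ L.carrier ×ˢ D
  zero_mem : ∀ p ∈ D, ((0 : Fin N → ℝ), p) ∈ W
  smooth : ContDiffOn ℝ ∞ (fun q : (Fin N → ℝ) × Point => (G q.1).toFun q.2) W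
  mapsTo : ∀ ε p, (ε, p) ∈ W → (G ε).toFun p ∈ D
  zero : ∀ p ∈ D, (G 0).toFun p = p
  inv_mem : ∀ ε p, (ε, p) ∈ W → (L.inv ε, (G ε).toFun p) ∈ W
  mul : ∀ ε δ p, (ε, δ) ∈ L.mulDom → (δ, p) ∈ W → (ε, (G δ).toFun p) ∈ W →
    (L.mul ε δ, p) ∈ W → (G (L.mul ε δ)).toFun p = (G ε).toFun ((G δ).toFun p)
  independent : LinearIndependent ℝ (fun i => fun p : D => G.generator i p)

/-- `G` with domain of definition `W` is an `N`-parameter local Lie group of point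
transformations of `D`. -/
def IsLocalTransformationGroup {N : ℕ} (D : Set Point)
    (W : Set ((Fin N → ℝ) × Point)) (G : Family N) : Prop :=
  ∃ L : LocalLieGroup N, IsLocalAction L D W G

/-- For globally defined transformations: the pairs `(ε, p)` for which both `p` and its image
lie in `D`. -/
def Family.naturalDomain {N : ℕ} (G : Family N) (D : Set Point) : Set ((Fin N → ℝ) × Point) :=
  {q | q.2 ∈ D ∧ (G q.1).toFun q.2 ∈ D}

/-! ### Prolongation and invariance -/

/-- Near `g(b)` the function `w'` is the image of `w` (near `b`) under `g`: the transformation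
maps the graph of `w` to the graph of `w'`.  The `k`th prolongation of `g` sends the `k`-jet of
`w` at `b` to the `k`-jet of `w'` at `g(b)`. -/
def IsImage (g : PointTransformation) (b : Base) (w w' : Base → Fibre) : Prop :=
  ContDiffAt ℝ ∞ w b ∧ ContDiffAt ℝ ∞ w' (g.base b) ∧
    ∀ᶠ q in 𝓝 b, w' (g.base q) = g.fibre q (w q)

/-- The same for the additional variable `S`, transformed by `S* = S`. -/
def IsImageSurface (g : PointTransformation) (b : Base) (S S' : Base → ℝ) : Prop :=
  ContDiffAt ℝ ∞ S b ∧ ContDiffAt ℝ ∞ S' (g.base b) ∧ ∀ᶠ q in 𝓝 b, S' (g.base q) = S q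

/-- Invariance of the boundary value problem with respect to the group `G` (extended by the
identity to `S₁`, `S₂`): the manifolds of the governing system, of the conditions on each of the
two free surfaces and of the condition at infinity are invariant under the prolonged group.  The
manifold `{|x| = ∞, v = v_inf}` consists of ideal points; its invariance means that the
transformations close to the identity are defined near it, and that `|x*| → ∞` and `v* → v_inf`
as `|x| → ∞` and `v → v_inf`. -/
structure BVP.InvariantUnder (B : BVP) {N : ℕ} (W : Set ((Fin N → ℝ) × Point))
    (G : Family N) : Prop where
  equations : ∀ ε b w w', (ε, (b, w b)) ∈ W → IsImage (G ε) b w w' →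
    B.OnEquations w b → B.OnEquations w' ((G ε).base b)
  surface₁ : ∀ ε b w w' S S', (ε, (b, w b)) ∈ W → IsImage (G ε) b w w' →
    IsImageSurface (G ε) b S S' → B.OnSurface₁ w S b → B.OnSurface₁ w' S' ((G ε).base b)
  surface₂ : ∀ ε b w w' S S', (ε, (b, w b)) ∈ W → IsImage (G ε) b w w' →
    IsImageSurface (G ε) b S S' → B.OnSurface₂ w S b → B.OnSurface₂ w' S' ((G ε).base b)
  infinity_mem : ∀ t u, B.tStar < t → u ∈ B.I₁ →
    ∀ᶠ q in 𝓝 (0 : Fin N → ℝ) ×ˢ (Bornology.cobounded E3 ×ˢ 𝓝 B.v_inf),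
      (q.1, (((t, q.2.1), (u, q.2.2)) : Point)) ∈ W
  infinity : ∀ t u, B.tStar < t → u ∈ B.I₁ → ∀ᶠ ε in 𝓝 (0 : Fin N → ℝ),
    Filter.Tendsto (fun x : E3 => ((G ε).base (t, x)).2)
      (Bornology.cobounded E3) (Bornology.cobounded E3) ∧
    Filter.Tendsto (fun q : E3 × ℝ => ((G ε).fibre (t, q.1) (u, q.2)).2)
      (Bornology.cobounded E3 ×ˢ 𝓝 B.v_inf) (𝓝 B.v_inf)

/-- `B` admits the (globally given) group `G` as a group of invariance. -/
def BVP.Admits (B : BVP) {N : ℕ} (G : Family N) : Prop :=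
  IsLocalTransformationGroup B.domain (G.naturalDomain B.domain) G ∧
    B.InvariantUnder (G.naturalDomain B.domain) G

/-- `G` is the maximal group of invariance (MGI) of `B`: it is a group of invariance, and the
generators of every local Lie group of invariance of `B`, with any number of parameters, belong to
the Lie algebra spanned by the generators of `G`. -/
def BVP.IsMGI (B : BVP) {N : ℕ} (G : Family N) : Prop :=
  B.Admits G ∧
    ∀ (N' : ℕ) (W' : Set ((Fin N' → ℝ) × Point)) (G' : Family N'),
      IsLocalTransformationGroup B.domain W' G' → B.InvariantUnder W' G' →
      ∀ i : Fin N', ∃ c : Fin N → ℝ, ∀ p ∈ B.domain,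
        G'.generator i p = ∑ j : Fin N, c j • G.generator j p

/-! ### The equivalence group of the class -/

/-- `B'` is obtained from `B` by a transformation of the equivalence group:
`t' = α t + γ₀`, `x' = β R x + Γ` with a rotation `R`, `u' = δ₁ u + γ₄`, `v' = δ₂ v + γ₅`,
`S₁' = S₁`, `S₂' = S₂`.  (The vector `Γ` does not affect the data.)  The factors `β² / α` for the
diffusivities and `β / δ₁`, `β / δ₂` for their boundary values are both imposed, since both problems
belong to the class. -/
def BVP.Equivalent (B B' : BVP) : Prop :=
  ∃ (α β δ₁ δ₂ γ₀ γ₄ γ₅ : ℝ) (R : Matrix (Fin 3) (Fin 3) ℝ),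
    R ∈ Matrix.specialOrthogonalGroup (Fin 3) ℝ ∧
    α * β * δ₁ * δ₂ ≠ 0 ∧
    (fun t => α * t + γ₀) '' Set.Ioi B.tStar = Set.Ioi B'.tStar ∧
    (fun u => δ₁ * u + γ₄) '' B.I₁ = B'.I₁ ∧
    (fun v => δ₂ * v + γ₅) '' B.I₂ = B'.I₂ ∧
    (∀ u ∈ B.I₁, B'.d₁ (δ₁ * u + γ₄) = β ^ 2 / α * B.d₁ u) ∧
    (∀ v ∈ B.I₂, B'.d₂ (δ₂ * v + γ₅) = β ^ 2 / α * B.d₂ v) ∧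
    B'.d₁ B'.u_v = β / δ₁ * B.d₁ B.u_v ∧
    B'.d₁ B'.u_m = β / δ₁ * B.d₁ B.u_m ∧
    B'.d₂ B'.v_m = β / δ₂ * B.d₂ B.v_m ∧
    B'.H_v = α / β * B.H_v ∧
    B'.H_m = α / β * B.H_m ∧
    B'.u_v = δ₁ * B.u_v + γ₄ ∧
    B'.u_m = δ₁ * B.u_m + γ₄ ∧
    B'.v_m = δ₂ * B.v_m + γ₅ ∧
    B'.v_inf = δ₂ * B.v_inf + γ₅ ∧
    ∀ t, B.tStar < t → B'.Q (α * t + γ₀) = WithLp.toLp 2 (R.mulVec (B.Q t).ofLp)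

/-! ### The explicit groups -/

/-- `(x₁, x₂, x₃) ↦ (θ₁(τ), θ₂(τ), x₃)` with `θ₁(τ) = x₁ cos τ + x₂ sin τ` and
`θ₂(τ) = -x₁ sin τ + x₂ cos τ`. -/
def rot (τ : ℝ) (x : E3) : E3 :=
  !₂[x 0 * Real.cos τ + x 1 * Real.sin τ, -(x 0) * Real.sin τ + x 1 * Real.cos τ, x 2]

/-- Time translations. -/
def T0 (ε : ℝ) : PointTransformation := .ofBase fun b => (b.1 + ε, b.2)

/-- Translations along `x₁`. -/
def T1 (ε : ℝ) : PointTransformation := .ofBase fun b => (b.1, b.2 + !₂[ε, 0, 0])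

/-- Translations along `x₂`. -/
def T2 (ε : ℝ) : PointTransformation := .ofBase fun b => (b.1, b.2 + !₂[0, ε, 0])

/-- Translations along `x₃`. -/
def T3 (ε : ℝ) : PointTransformation := .ofBase fun b => (b.1, b.2 + !₂[0, 0, ε])

/-- Parabolic scalings. -/
def T4 (ε : ℝ) : PointTransformation :=
  .ofBase fun b => (Real.exp (2 * ε) * b.1, Real.exp ε • b.2)

/-- Rotations about the `x₃` axis. -/
def T5 (ε : ℝ) : PointTransformation := .ofBase fun b => (b.1, rot ε b.2)

/-- Time translations combined with rotations about the `x₃` axis. -/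
def T6 (l ε : ℝ) : PointTransformation := .ofBase fun b => (b.1 + ε, rot (l * ε) b.2)

/-- Parabolic scalings combined with rotations about the `x₃` axis. -/
def T7 (l ε : ℝ) : PointTransformation :=
  .ofBase fun b => (Real.exp (2 * ε) * b.1, Real.exp ε • rot (l * ε) b.2)

/-- The three-parameter trivial group generated by `T1`, `T2`, `T3`. -/
def trivialGroup : Family 3 := fun ε => (T1 (ε 0)).comp ((T2 (ε 1)).comp (T3 (ε 2)))

/-- The group generated by `T1`, `T2`, `T3`, `T5`. -/
def group2 : Family 4 := fun ε =>
  (T1 (ε 0)).comp ((T2 (ε 1)).comp ((T3 (ε 2)).comp (T5 (ε 3))))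

/-- The group generated by `T1`, `T2`, `T3`, `T6`. -/
def group3 (l : ℝ) : Family 4 := fun ε =>
  (T1 (ε 0)).comp ((T2 (ε 1)).comp ((T3 (ε 2)).comp (T6 l (ε 3))))

/-- The group generated by `T1`, `T2`, `T3`, `T7`. -/
def group4 (l : ℝ) : Family 4 := fun ε =>
  (T1 (ε 0)).comp ((T2 (ε 1)).comp ((T3 (ε 2)).comp (T7 l (ε 3))))

/-- The group generated by `T0`, `T1`, `T2`, `T3`, `T5`. -/
def group5 : Family 5 := fun ε =>
  (T0 (ε 0)).comp ((T1 (ε 1)).comp ((T2 (ε 2)).comp ((T3 (ε 3)).comp (T5 (ε 4)))))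

/-- The group generated by `T1`, `T2`, `T3`, `T4`, `T5`. -/
def group6 : Family 5 := fun ε =>
  (T1 (ε 0)).comp ((T2 (ε 1)).comp ((T3 (ε 2)).comp ((T4 (ε 3)).comp (T5 (ε 4)))))

/-! ### The table of fluxes with extended invariance -/

/-- The rows 2 to 6 of the table, with their parameters. -/
inductive Row : Type where
  | two (q : ℝ → ℝ)
  | three (l q₁ q₂ q₃ : ℝ)
  | four (l q₁ q₂ q₃ : ℝ)
  | five (q : ℝ)
  | six (q : ℝ)

namespace Row

/-- The number of a row. -/
def number : Row → ℕ
  | two _ => 2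
  | three _ _ _ _ => 3
  | four _ _ _ _ => 4
  | five _ => 5
  | six _ => 6

/-- `Θ₁(τ) = q₁ cos τ + q₂ sin τ`. -/
def Theta₁ (q₁ q₂ τ : ℝ) : ℝ := q₁ * Real.cos τ + q₂ * Real.sin τ

/-- `Θ₂(τ) = -q₁ sin τ + q₂ cos τ`. -/
def Theta₂ (q₁ q₂ τ : ℝ) : ℝ := -q₁ * Real.sin τ + q₂ * Real.cos τ

/-- The flux `Q(t)` of a row. -/
def flux : Row → ℝ → E3
  | two q => fun t => !₂[0, 0, q t]
  | three l q₁ q₂ q₃ => fun t => !₂[Theta₁ q₁ q₂ (l * t), Theta₂ q₁ q₂ (l * t), q₃]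
  | four l q₁ q₂ q₃ => fun t =>
      !₂[1 / Real.sqrt t * Theta₁ q₁ q₂ (1 / 2 * l * Real.log t),
        1 / Real.sqrt t * Theta₂ q₁ q₂ (1 / 2 * l * Real.log t), q₃ / Real.sqrt t]
  | five q => fun _ => !₂[0, 0, q]
  | six q => fun t => !₂[0, 0, q / Real.sqrt t]

/-- The number of parameters of the group of a row. -/
def dim : Row → ℕ
  | two _ => 4
  | three _ _ _ _ => 4
  | four _ _ _ _ => 4
  | five _ => 5
  | six _ => 5

/-- The group of a row. -/
def group : (r : Row) → Family r.dim
  | two _ => group2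
  | three l _ _ _ => group3 l
  | four l _ _ _ => group4 l
  | five _ => group5
  | six _ => group6

/-- `B` has the flux of the row `r` on its time interval; the formulas of rows 4 and 6 make sense
for positive times only. -/
def Fits (r : Row) (B : BVP) : Prop :=
  Set.EqOn B.Q r.flux (Set.Ioi B.tStar) ∧
    match r with
    | four _ _ _ _ => 0 ≤ B.tStar
    | six _ => 0 ≤ B.tStar
    | _ => True

/-- The parameters of the row `r` are not such that the flux reduces to that of a row with a
larger group: in row 2 the function `q` is neither constant nor of the form `c / √(t - s)` on
`(tStar, ∞)`; in rows 3 and 4 the flux really rotates. -/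
def Generic (r : Row) (tStar : ℝ) : Prop :=
  match r with
  | two q => (¬ ∃ c : ℝ, ∀ t, tStar < t → q t = c) ∧
      ¬ ∃ c s : ℝ, s ≤ tStar ∧ ∀ t, tStar < t → q t = c / Real.sqrt (t - s)
  | three l q₁ q₂ _ => l ≠ 0 ∧ q₁ ^ 2 + q₂ ^ 2 ≠ 0
  | four l q₁ q₂ _ => l ≠ 0 ∧ q₁ ^ 2 + q₂ ^ 2 ≠ 0
  | five _ => True
  | six _ => True

end Row

/-- The flux of `B` has, up to equivalence, the form of the row `r`. -/
def BVP.ReducesTo (B : BVP) (r : Row) : Prop :=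
  ∃ B' : BVP, B.Equivalent B' ∧ r.Fits B' ∧ r.Generic B'.tStar

end StefanBVP

end

namespace StefanBVP

/-! ### Gradients, interface conditions and the chain rule -/

/-! Everything reduces to a linear ordinary differential equation for `Q`. Along a parameter axis an
invariance group gives a curve of transformations through the identity; write U, V for the
transformed unknowns. The condition on the first surface is a quadratic relation between the
covectors du and dS. If it is preserved for all admissible covectors, then U = u_v wherever u = u_v,
and the Jacobian of the transformation of (t, x) is block diagonal, with time factor m and a
conformal space part M whose squared factor is m times ∂U/∂u; moreover M Q(t) = m Q(t*)
(`conformal_of_interface`, `InvCurve.jac_block`). Because Q depends on t alone and does not vanish,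
the conformal factor is constant, so M is constant as well (`space_derivative_const`, a Koszul-type
argument).

Comparing coefficients in the diffusion equations on u = u_v gives ∂U/∂u = 1 there, so the squared
conformal factor is m. With this normalisation the equations force d₁(U) = d₁(u), d₂(V) = d₂(v), and
from these and the remaining coefficients all second derivatives of U, V in (u, v) vanish
(`hess_eq_zero`). Hence the u-velocity is affine on the fibre; it vanishes near u = u_v, v = v_m and
therefore everywhere. The second surface links V - v to U - u, so the v-velocity vanishes too. The
outcome (`InvCurve.exists_velocity`, `generator_form`) is that a generator has time part κ₀ + 2κ₁t,
space part κ₁x + Ax + y₀ with A skew, no part in (u, v), and satisfies (κ₀ + 2κ₁t) Q' = AQ - κ₁Q.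

Conversely, a group of similarities under which Q is equivariant multiplies every term of the
problem by the same factor (`SimilarityData.admits`). The MGI is thus spanned by the translations
and the solutions (κ₀, κ₁, A) of the equation for Q, which do not involve the diffusivities.

To classify these, the axis of A is rotated to the third axis and the zero of κ₀ + 2κ₁t, if κ₁ ≠ 0,
is shifted to t = 0. A symmetry that fixes time confines Q to a line (rows 2, 5, 6). Otherwise the
equation integrates to a rotating flux (κ₁ = 0, row 3) or a logarithmic spiral (κ₁ ≠ 0, row 4); see
`exists_normalForm`. Three properties survive equivalence: existence of a purely rotational
symmetry, of a scaling one and of a time-translating one. They take different values on the five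
rows, which gives inequivalence. -/

theorem sum_smul_single (y : E3) : ∑ a : Fin 3, y a • EuclideanSpace.single a (1 : ℝ) = y := by
  ext i
  simp [Fin.sum_univ_three]
  fin_cases i <;> simp

theorem inner_grad (f : Base → ℝ) (b : Base) (y : E3) :
    inner ℝ (grad f b) y = fderiv ℝ f b (0, y) := by
  have h : ((0 : ℝ), y) = ∑ a : Fin 3, y a • ((0 : ℝ), EuclideanSpace.single a (1 : ℝ)) := by
    ext1
    · simp [Prod.fst_sum]
    · simp only [Prod.snd_sum, Prod.smul_snd]; exact (sum_smul_single y).symm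
  rw [h, map_sum]
  simp only [map_smul, PiLp.inner_apply, grad, dx]
  simp

theorem grad_eq_of_forall {f : Base → ℝ} {b : Base} {z : E3}
    (h : ∀ y, fderiv ℝ f b (0, y) = inner ℝ z y) : grad f b = z :=
  ext_inner_right ℝ fun y => by rw [inner_grad, h]

theorem fderiv_apply_eq (f : Base → ℝ) (b q : Base) :
    fderiv ℝ f b q = q.1 * dt f b + inner ℝ (grad f b) q.2 := by
  have : q = q.1 • ((1 : ℝ), (0 : E3)) + (0, q.2) := by ext1 <;> simp
  conv_lhs => rw [this]
  rw [map_add, map_smul, inner_grad]; rfl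

theorem inner_normal (S : Base → ℝ) (b : Base) (z : E3) :
    inner ℝ z (normal S b) = ‖grad S b‖⁻¹ * inner ℝ z (grad S b) := by
  rw [normal, inner_smul_right]

namespace BVP

variable (B : BVP)

/-- The condition is homogeneous in the normal, so multiplying by `‖grad S b‖` turns it into a
polynomial relation between first derivatives, better suited to changes of variables. Non-vanishing
of the gradient is implied by `inner ℝ (B.Q b.1) (grad S b) ≠ 0` and need not be listed. -/
theorem onSurface₁_iff (w : Base → Fibre) (S : Base → ℝ) (b : Base) :
    B.OnSurface₁ w S b ↔ S b = 0 ∧ dt S b ≠ 0 ∧ inner ℝ (B.Q b.1) (grad S b) ≠ 0 ∧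
      B.d₁ B.u_v * inner ℝ (grad (fun q => (w q).1) b) (grad S b)
        = -B.H_v * dt S b - inner ℝ (B.Q b.1) (grad S b) ∧ (w b).1 = B.u_v := by
  unfold OnSurface₁
  have key : grad S b ≠ 0 → ((B.d₁ B.u_v * normalDeriv S (fun q => (w q).1) b
      = B.H_v * normalVelocity S b - inner ℝ (B.Q b.1) (normal S b)) ↔
      B.d₁ B.u_v * inner ℝ (grad (fun q => (w q).1) b) (grad S b)
        = -B.H_v * dt S b - inner ℝ (B.Q b.1) (grad S b)) := by
    intro h
    have hn : ‖grad S b‖ ≠ 0 := norm_ne_zero_iff.2 h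
    rw [normalDeriv, normalVelocity, inner_normal, inner_normal]
    field_simp
  constructor
  · rintro ⟨h1, h2, h3, h4, h5, h6⟩
    rw [inner_normal] at h4
    exact ⟨h1, h2, right_ne_zero_of_mul h4, (key h3).1 h5, h6⟩
  · rintro ⟨h1, h2, h4, h5, h6⟩
    have h3 : grad S b ≠ 0 := by
      rintro h; rw [h, inner_zero_right] at h4; exact h4 rfl
    refine ⟨h1, h2, h3, ?_, (key h3).2 h5, h6⟩
    rw [inner_normal]
    exact mul_ne_zero (inv_ne_zero (norm_ne_zero_iff.2 h3)) h4

theorem onSurface₂_iff (w : Base → Fibre) (S : Base → ℝ) (b : Base) :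
    B.OnSurface₂ w S b ↔ S b = 0 ∧ dt S b ≠ 0 ∧ grad S b ≠ 0 ∧
      B.d₂ B.v_m * inner ℝ (grad (fun q => (w q).2) b) (grad S b)
        = B.d₁ B.u_m * inner ℝ (grad (fun q => (w q).1) b) (grad S b) - B.H_m * dt S b ∧
      (w b).1 = B.u_m ∧ (w b).2 = B.v_m := by
  unfold OnSurface₂
  have key : grad S b ≠ 0 → ((B.d₂ B.v_m * normalDeriv S (fun q => (w q).2) b
      = B.d₁ B.u_m * normalDeriv S (fun q => (w q).1) b + B.H_m * normalVelocity S b) ↔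
      B.d₂ B.v_m * inner ℝ (grad (fun q => (w q).2) b) (grad S b)
        = B.d₁ B.u_m * inner ℝ (grad (fun q => (w q).1) b) (grad S b) - B.H_m * dt S b) := by
    intro h
    have hn : ‖grad S b‖ ≠ 0 := norm_ne_zero_iff.2 h
    rw [normalDeriv, normalDeriv, normalVelocity, inner_normal, inner_normal]
    field_simp
    rw [sub_eq_add_neg]
  constructor
  · rintro ⟨h1, h2, h3, h5, h6⟩
    exact ⟨h1, h2, h3, (key h3).1 h5, h6⟩
  · rintro ⟨h1, h2, h3, h5, h6⟩
    exact ⟨h1, h2, h3, (key h3).2 h5, h6⟩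

end BVP

theorem fderiv_eq_comp {f f' : Base → ℝ} {φ : Base → Base} {b : Base}
    (hf' : DifferentiableAt ℝ f' (φ b)) (hφ : DifferentiableAt ℝ φ b)
    (h : ∀ᶠ q in 𝓝 b, f' (φ q) = f q) :
    fderiv ℝ f b = (fderiv ℝ f' (φ b)).comp (fderiv ℝ φ b) := by
  rw [← fderiv_comp b hf' hφ]
  exact (Filter.EventuallyEq.fderiv_eq h).symm

/-- A conformal linear map of `ℝ³` with factor `μ` multiplies traces by `μ`. -/
theorem sum_inner_conformal {M : E3 →L[ℝ] E3} {μ : ℝ} (hμ : 0 < μ)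
    (hM : ∀ x y, inner ℝ (M x) (M y) = μ * inner ℝ x y) (L : E3 →L[ℝ] E3) :
    ∑ a : Fin 3, inner ℝ (L (M (EuclideanSpace.single a 1))) (M (EuclideanSpace.single a 1))
      = μ * ∑ a : Fin 3, inner ℝ (L (EuclideanSpace.single a 1))
          (EuclideanSpace.single a (1 : ℝ)) := by
  have hs : Real.sqrt μ ≠ 0 := (Real.sqrt_pos.2 hμ).ne'
  have hs2 : Real.sqrt μ * Real.sqrt μ = μ := Real.mul_self_sqrt hμ.le
  -- The trace does not depend on the orthonormal basis, and division by `√μ` makes `M` carry the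
  -- standard basis to another one.
  let v : Fin 3 → E3 := fun a => (Real.sqrt μ)⁻¹ • M (EuclideanSpace.single a 1)
  have hv : Orthonormal ℝ v := by
    rw [orthonormal_iff_ite]
    intro i j
    simp only [v, inner_smul_left, inner_smul_right, hM]
    rw [EuclideanSpace.inner_single_left]
    simp only [map_one, one_mul, PiLp.single_apply, map_inv₀, conj_trivial]
    split_ifs
    · field_simp; nlinarith
    · simp
  let ob : OrthonormalBasis (Fin 3) ℝ E3 := OrthonormalBasis.mk hv (by
    have hb := basisOfLinearIndependentOfCardEqFinrank hv.linearIndependent (by simp)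
    have := hv.linearIndependent.span_eq_top_of_card_eq_finrank' (by simp)
    rw [this])
  have h1 := LinearMap.trace_eq_sum_inner (L : E3 →ₗ[ℝ] E3) ob
  have h2 := LinearMap.trace_eq_sum_inner (L : E3 →ₗ[ℝ] E3) (EuclideanSpace.basisFun (Fin 3) ℝ)
  rw [h1] at h2
  simp only [ob, OrthonormalBasis.coe_mk, v, map_smul, ContinuousLinearMap.coe_coe,
    inner_smul_left, inner_smul_right, EuclideanSpace.basisFun_apply, conj_trivial] at h2
  have h3 : ∑ a : Fin 3, inner ℝ (EuclideanSpace.single a (1 : ℝ)) (L (EuclideanSpace.single a 1))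
      = ∑ a : Fin 3, inner ℝ (L (EuclideanSpace.single a 1)) (EuclideanSpace.single a (1 : ℝ)) :=
    Finset.sum_congr rfl fun a _ => real_inner_comm _ _
  rw [← h3, ← h2, Finset.mul_sum]
  refine Finset.sum_congr rfl fun a _ => ?_
  rw [real_inner_comm]
  field_simp
  rw [pow_two, hs2]

/-! ### Conformal changes of variables in the diffusion operator. -/

theorem contDiffAt_dx {f : Base → ℝ} {b : Base} (hf : ContDiffAt ℝ ∞ f b) (a : Fin 3) :
    ContDiffAt ℝ ∞ (dx a f) b :=
  (hf.fderiv_right (m := ∞) (by simp)).clm_apply contDiffAt_const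

theorem contDiffAt_grad {f : Base → ℝ} {b : Base} (hf : ContDiffAt ℝ ∞ f b) :
    ContDiffAt ℝ ∞ (grad f) b := by
  rw [contDiffAt_piLp]
  exact fun a => contDiffAt_dx hf a

/-- The flux `d(f) ∇f`. -/
noncomputable def fluxField (d : ℝ → ℝ) (f : Base → ℝ) (q : Base) : E3 := d (f q) • grad f q

theorem contDiffAt_fluxField {d : ℝ → ℝ} {f : Base → ℝ} {b : Base} (hf : ContDiffAt ℝ ∞ f b)
    (hd : ContDiffAt ℝ ∞ d (f b)) : ContDiffAt ℝ ∞ (fluxField d f) b :=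
  (hd.comp b hf).smul (contDiffAt_grad hf)

theorem dx_inner {F : Base → E3} {b : Base} (hF : DifferentiableAt ℝ F b) (a : Fin 3) (z : E3) :
    dx a (fun q => inner ℝ (F q) z) b
      = inner ℝ (fderiv ℝ F b (0, EuclideanSpace.single a 1)) z := by
  unfold dx
  have := (hF.hasFDerivAt.inner ℝ (hasFDerivAt_const z b)).fderiv
  rw [this]
  simp

theorem dx_congr {f g : Base → ℝ} {b : Base} (h : ∀ᶠ q in 𝓝 b, f q = g q) (a : Fin 3) :
    dx a f b = dx a g b := by
  unfold dx
  rw [Filter.EventuallyEq.fderiv_eq h]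

/-- The divergence as a trace of the derivative of the flux field: the form to which
`sum_inner_conformal` applies. -/
theorem divFlux_eq_sum {d : ℝ → ℝ} {f : Base → ℝ} {b : Base} (hf : ContDiffAt ℝ ∞ f b)
    (hd : ContDiffAt ℝ ∞ d (f b)) :
    divFlux d f b = ∑ a : Fin 3, inner ℝ (fderiv ℝ (fluxField d f) b
      (0, EuclideanSpace.single a 1)) (EuclideanSpace.single a (1 : ℝ)) := by
  unfold divFlux
  refine Finset.sum_congr rfl fun a _ => ?_
  rw [← dx_inner ((contDiffAt_fluxField hf hd).differentiableAt (by simp))]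
  congr 1
  funext q
  simp [fluxField, grad, EuclideanSpace.inner_single_right]

theorem dx_eq_inner {f f' : Base → ℝ} {φ : Base → Base} {q : Base} {M : E3 →L[ℝ] E3}
    (hf' : DifferentiableAt ℝ f' (φ q)) (hφ : DifferentiableAt ℝ φ q)
    (hM : ∀ y, fderiv ℝ φ q (0, y) = (0, M y))
    (h : ∀ᶠ p in 𝓝 q, f' (φ p) = f p) (a : Fin 3) :
    dx a f q = inner ℝ (grad f' (φ q)) (M (EuclideanSpace.single a 1)) := by
  unfold dx
  rw [fderiv_eq_comp hf' hφ h, ContinuousLinearMap.comp_apply, hM, inner_grad]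

/-- Transformation of the nonlinear diffusion operator under a map whose space derivative is a
fixed conformal linear map. -/
theorem divFlux_comp {d : ℝ → ℝ} {f f' : Base → ℝ} {φ : Base → Base} {b : Base}
    {M : E3 →L[ℝ] E3} {μ : ℝ} (hμ : 0 < μ)
    (hM : ∀ x y, inner ℝ (M x) (M y) = μ * inner ℝ x y)
    (hf' : ContDiffAt ℝ ∞ f' (φ b)) (hd : ContDiffAt ℝ ∞ d (f' (φ b)))
    (hφ : ∀ᶠ q in 𝓝 b, DifferentiableAt ℝ φ q ∧ ∀ y, fderiv ℝ φ q (0, y) = (0, M y))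
    (h : ∀ᶠ q in 𝓝 b, f' (φ q) = f q) :
    divFlux d f b = μ * divFlux d f' (φ b) := by
  have hφb := hφ.self_of_nhds
  have hF : DifferentiableAt ℝ (fluxField d f') (φ b) :=
    (contDiffAt_fluxField hf' hd).differentiableAt (by simp)
  rw [divFlux_eq_sum hf' hd]
  have := sum_inner_conformal hμ hM ((fderiv ℝ (fluxField d f') (φ b)).comp
    (ContinuousLinearMap.inr ℝ ℝ E3))
  simp only [ContinuousLinearMap.comp_apply, ContinuousLinearMap.inr_apply] at this
  rw [← this]
  unfold divFlux
  refine Finset.sum_congr rfl fun a _ => ?_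
  have hf'n : ∀ᶠ q in 𝓝 b, DifferentiableAt ℝ f' (φ q) :=
    hφb.1.continuousAt.eventually
      (((hf'.of_le (m := 1) (by simp)).eventually (by simp)).mono fun z hz => hz.differentiableAt (by simp))
  -- Since `M` is the same at all nearby points, the second differentiation hits only the
  -- transported flux field and no derivative of `M` appears.
  have hev : ∀ᶠ q in 𝓝 b, d (f q) * dx a f q
      = inner ℝ (fluxField d f' (φ q)) (M (EuclideanSpace.single a 1)) := by
    filter_upwards [hφ, hf'n, h.eventually_nhds] with q h1 h2 h3
    rw [dx_eq_inner h2 h1.1 h1.2 h3, fluxField, inner_smul_left, ← h3.self_of_nhds]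
    simp
  rw [dx_congr hev]
  rw [dx_inner (F := fun q => fluxField d f' (φ q)) (hF.comp b hφb.1)]
  have : fderiv ℝ (fun q => fluxField d f' (φ q)) b = _ := fderiv_comp (g := fluxField d f') b hF hφb.1
  rw [this, ContinuousLinearMap.comp_apply, hφb.2]

theorem conformal_surjective {M : E3 →L[ℝ] E3} {μ : ℝ} (hμ : 0 < μ)
    (hM : ∀ x y, inner ℝ (M x) (M y) = μ * inner ℝ x y) : Function.Surjective M := by
  have hinj : Function.Injective (M : E3 →ₗ[ℝ] E3) := by
    rw [injective_iff_map_eq_zero]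
    intro x hx
    have h := hM x x
    rw [show M x = 0 from hx, inner_zero_left] at h
    exact inner_self_eq_zero.1 ((mul_eq_zero.1 h.symm).resolve_left hμ.ne')
  exact LinearMap.injective_iff_surjective.1 hinj

/-- The adjoint equals `μ M⁻¹`, which is conformal with the same factor. It is the adjoint that acts
on gradients. -/
theorem inner_adjoint_conformal {M : E3 →L[ℝ] E3} {μ : ℝ} (hμ : 0 < μ)
    (hM : ∀ x y, inner ℝ (M x) (M y) = μ * inner ℝ x y) (x y : E3) :
    inner ℝ (M.adjoint x) (M.adjoint y) = μ * inner ℝ x y := by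
  have hs := conformal_surjective hμ hM
  obtain ⟨x, rfl⟩ := hs x
  obtain ⟨y, rfl⟩ := hs y
  have h : ∀ z, M.adjoint (M z) = μ • z := fun z => ext_inner_right ℝ fun v => by
    rw [ContinuousLinearMap.adjoint_inner_left, hM, inner_smul_left]; rfl
  rw [h, h, hM, inner_smul_left, inner_smul_right]
  rfl

theorem dt_comp {f f' : Base → ℝ} {φ : Base → Base} {b : Base} {τ : ℝ}
    (hf' : DifferentiableAt ℝ f' (φ b)) (hφ : DifferentiableAt ℝ φ b)
    (hτ : fderiv ℝ φ b (1, 0) = (τ, 0)) (h : ∀ᶠ q in 𝓝 b, f' (φ q) = f q) :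
    dt f b = τ * dt f' (φ b) := by
  rw [dt, fderiv_eq_comp hf' hφ h, ContinuousLinearMap.comp_apply, hτ, fderiv_apply_eq]
  simp

theorem grad_comp {f f' : Base → ℝ} {φ : Base → Base} {b : Base} {M : E3 →L[ℝ] E3}
    (hf' : DifferentiableAt ℝ f' (φ b)) (hφ : DifferentiableAt ℝ φ b)
    (hM : ∀ y, fderiv ℝ φ b (0, y) = (0, M y)) (h : ∀ᶠ q in 𝓝 b, f' (φ q) = f q) :
    grad f b = M.adjoint (grad f' (φ b)) := by
  refine grad_eq_of_forall fun y => ?_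
  rw [fderiv_eq_comp hf' hφ h, ContinuousLinearMap.comp_apply, hM,
    ContinuousLinearMap.adjoint_inner_left, inner_grad]

/-! ### Rotations about the third axis -/

/-- The infinitesimal rotation about the third axis. -/
noncomputable def rotGen : E3 →L[ℝ] E3 :=
  LinearMap.toContinuousLinearMap
    { toFun := fun x => !₂[x 1, -x 0, 0]
      map_add' := fun x y => by ext i; fin_cases i <;> simp; ring
      map_smul' := fun r x => by ext i; fin_cases i <;> simp }

theorem rotGen_apply (x : E3) : rotGen x = !₂[x 1, -x 0, 0] := rfl

theorem inner_E3 (x y : E3) : inner ℝ x y = x 0 * y 0 + x 1 * y 1 + x 2 * y 2 := by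
  simp only [PiLp.inner_apply, Fin.sum_univ_three, RCLike.inner_apply, conj_trivial]
  ring

theorem rot_add (τ : ℝ) (x y : E3) : rot τ (x + y) = rot τ x + rot τ y := by
  ext i; fin_cases i <;> simp [rot] <;> ring

theorem rot_smul (τ r : ℝ) (x : E3) : rot τ (r • x) = r • rot τ x := by
  ext i; fin_cases i <;> simp [rot] <;> ring

theorem rot_zero (x : E3) : rot 0 x = x := by
  ext i; fin_cases i <;> simp [rot]

theorem rot_rot (σ τ : ℝ) (x : E3) : rot σ (rot τ x) = rot (σ + τ) x := by
  ext i; fin_cases i <;> simp [rot, Real.cos_add, Real.sin_add] <;> ring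

theorem inner_rot (τ : ℝ) (x y : E3) : inner ℝ (rot τ x) (rot τ y) = inner ℝ x y := by
  simp only [inner_E3, rot]
  simp
  linear_combination (x 0 * y 0 + x 1 * y 1) * Real.sin_sq_add_cos_sq τ

/-- `rot τ` as a linear map. -/
noncomputable def rotL (τ : ℝ) : E3 →L[ℝ] E3 :=
  LinearMap.toContinuousLinearMap
    { toFun := rot τ, map_add' := rot_add τ, map_smul' := rot_smul τ }

theorem contDiff_rot : ContDiff ℝ ∞ (fun q : ℝ × E3 => rot q.1 q.2) := by
  rw [contDiff_piLp]
  intro i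
  have h : ∀ j : Fin 3, ContDiff ℝ ∞ (fun q : ℝ × E3 => q.2 j) := fun j =>
    (contDiff_piLp_apply (p := 2) (i := j)).comp contDiff_snd
  have hc : ContDiff ℝ ∞ (fun q : ℝ × E3 => Real.cos q.1) := Real.contDiff_cos.comp contDiff_fst
  have hs : ContDiff ℝ ∞ (fun q : ℝ × E3 => Real.sin q.1) := Real.contDiff_sin.comp contDiff_fst
  fin_cases i
  · exact ((h 0).mul hc).add ((h 1).mul hs)
  · exact ((h 0).neg.mul hs).add ((h 1).mul hc)
  · exact h 2

theorem hasDerivAt_rot (τ : ℝ) (x : E3) :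
    HasDerivAt (fun σ => rot σ x) (rotGen (rot τ x)) τ := by
  rw [hasDerivAt_iff_hasFDerivAt, ← hasFDerivWithinAt_univ, hasFDerivWithinAt_euclidean]
  intro i
  rw [hasFDerivWithinAt_univ]
  suffices h : HasDerivAt (fun σ => rot σ x i) (rotGen (rot τ x) i) τ from
    h.hasFDerivAt.congr_fderiv (by ext; simp)
  have hc := Real.hasDerivAt_cos τ
  have hs := Real.hasDerivAt_sin τ
  fin_cases i
  · refine ((hc.const_mul (x 0)).add (hs.const_mul (x 1))).congr_deriv ?_
    simp [rot, rotGen_apply]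
  · refine ((hs.const_mul (-x 0)).add (hc.const_mul (x 1))).congr_deriv ?_
    simp [rot, rotGen_apply]; ring
  · simpa [rot, rotGen_apply] using hasDerivAt_const τ (x 2)

theorem BVP.isOpen_domain (B : BVP) : IsOpen B.domain :=
  (isOpen_lt continuous_const (continuous_fst.comp continuous_fst)).inter
    ((B.isOpen_I₁.preimage (continuous_fst.comp continuous_snd)).inter
      (B.isOpen_I₂.preimage (continuous_snd.comp continuous_snd)))

/-! ### Groups of similarities -/

/-- Linear data of a group of similarities of `(t, x)`: the parameter `ε` acts by
`t* = e^{2k(ε)} (t - t₀) + t₀ + c(ε)` and `x* = e^{k(ε)} P rot(θ(ε)) P⁻¹ x + y(ε)`. -/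
structure SimilarityData (N : ℕ) where
  c : (Fin N → ℝ) →L[ℝ] ℝ
  k : (Fin N → ℝ) →L[ℝ] ℝ
  θ : (Fin N → ℝ) →L[ℝ] ℝ
  y : (Fin N → ℝ) →L[ℝ] E3
  ι : E3 →L[ℝ] (Fin N → ℝ)
  P : E3 ≃ₗᵢ[ℝ] E3
  t0 : ℝ
  y_ι : ∀ z, y (ι z) = z
  c_ι : ∀ z, c (ι z) = 0
  k_ι : ∀ z, k (ι z) = 0
  θ_ι : ∀ z, θ (ι z) = 0
  comm : ∀ a b, k a = 0 ∨ c b = 0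
  inj : ∀ a, c a = 0 → k a = 0 → θ a = 0 → y a = 0 → a = 0

namespace SimilarityData

variable {N : ℕ} (A : SimilarityData N)

/-- The orthogonal part of the space transformation. -/
noncomputable def orth (ε : Fin N → ℝ) (x : E3) : E3 := A.P (rot (A.θ ε) (A.P.symm x))

/-- The linear part of the space transformation. -/
noncomputable def lin (ε : Fin N → ℝ) : E3 →L[ℝ] E3 :=
  Real.exp (A.k ε) • ((A.P.toContinuousLinearEquiv : E3 →L[ℝ] E3).comp ((rotL (A.θ ε)).comp
    (A.P.symm.toContinuousLinearEquiv : E3 →L[ℝ] E3)))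

theorem lin_apply (ε : Fin N → ℝ) (x : E3) : A.lin ε x = Real.exp (A.k ε) • A.orth ε x := rfl

/-- The transformation of time. -/
noncomputable def time (ε : Fin N → ℝ) (t : ℝ) : ℝ :=
  Real.exp (2 * A.k ε) * (t - A.t0) + A.t0 + A.c ε

/-- The group. -/
noncomputable def family : Family N := fun ε =>
  .ofBase fun b => (A.time ε b.1, A.lin ε b.2 + A.y ε)

theorem family_base (ε : Fin N → ℝ) (b : Base) :
    (A.family ε).base b = (A.time ε b.1, A.lin ε b.2 + A.y ε) := rfl

theorem family_toFun (ε : Fin N → ℝ) (p : Point) :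
    (A.family ε).toFun p = ((A.time ε p.1.1, A.lin ε p.1.2 + A.y ε), p.2) := rfl

theorem lin_congr {a b : Fin N → ℝ} (hk : A.k a = A.k b) (hθ : A.θ a = A.θ b) :
    A.lin a = A.lin b := by
  unfold lin; rw [hk, hθ]

theorem lin_lin (a b : Fin N → ℝ) (x : E3) : A.lin a (A.lin b x) = A.lin (a + b) x := by
  simp only [lin_apply, orth, map_smul, map_add, A.P.symm_apply_apply, rot_rot,
    smul_smul, Real.exp_add, mul_comm]

theorem lin_zero (x : E3) : A.lin 0 x = x := by
  simp [lin_apply, orth, rot_zero]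

theorem inner_orth (ε : Fin N → ℝ) (x y : E3) :
    inner ℝ (A.orth ε x) (A.orth ε y) = inner ℝ x y := by
  simp [orth, inner_rot]

theorem inner_lin (ε : Fin N → ℝ) (x y : E3) :
    inner ℝ (A.lin ε x) (A.lin ε y) = Real.exp (2 * A.k ε) * inner ℝ x y := by
  rw [lin_apply, lin_apply, inner_smul_left, inner_smul_right, inner_orth, conj_trivial,
    ← mul_assoc, ← Real.exp_add, two_mul]

theorem contDiff_orth : ContDiff ℝ ∞ (fun q : (Fin N → ℝ) × E3 => A.orth q.1 q.2) :=
  A.P.contDiff.comp (contDiff_rot.comp ((A.θ.contDiff.comp contDiff_fst).prodMk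
    (A.P.symm.contDiff.comp contDiff_snd)))

theorem contDiff_lin : ContDiff ℝ ∞ (fun q : (Fin N → ℝ) × E3 => A.lin q.1 q.2) :=
  (Real.contDiff_exp.comp (A.k.contDiff.comp contDiff_fst)).smul A.contDiff_orth

theorem contDiff_time : ContDiff ℝ ∞ (fun q : (Fin N → ℝ) × ℝ => A.time q.1 q.2) := by
  unfold time
  have hk : ContDiff ℝ ∞ (fun q : (Fin N → ℝ) × ℝ => A.k q.1) := A.k.contDiff.comp contDiff_fst
  have hc : ContDiff ℝ ∞ (fun q : (Fin N → ℝ) × ℝ => A.c q.1) := A.c.contDiff.comp contDiff_fst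
  fun_prop

theorem contDiff_family :
    ContDiff ℝ ∞ (fun q : (Fin N → ℝ) × Point => (A.family q.1).toFun q.2) := by
  simp only [family_toFun]
  have h1 : ContDiff ℝ ∞ (fun q : (Fin N → ℝ) × Point => A.time q.1 q.2.1.1) :=
    A.contDiff_time.comp (contDiff_fst.prodMk (by fun_prop))
  have h2 : ContDiff ℝ ∞ (fun q : (Fin N → ℝ) × Point => A.lin q.1 q.2.1.2) :=
    A.contDiff_lin.comp (contDiff_fst.prodMk (by fun_prop))
  have h3 : ContDiff ℝ ∞ (fun q : (Fin N → ℝ) × Point => A.y q.1) :=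
    A.y.contDiff.comp contDiff_fst
  exact (h1.prodMk (h2.add h3)).prodMk (by fun_prop)

/-- The group multiplication of the parameters. -/
noncomputable def mul (a b : Fin N → ℝ) : Fin N → ℝ := a + b + A.ι (A.lin a (A.y b) - A.y b)

/-- The group inversion of the parameters. -/
noncomputable def inv (a : Fin N → ℝ) : Fin N → ℝ := -a + A.ι (A.y a - A.lin (-a) (A.y a))

theorem k_mul (a b : Fin N → ℝ) : A.k (A.mul a b) = A.k (a + b) := by
  rw [mul, map_add, A.k_ι, add_zero]

theorem c_mul (a b : Fin N → ℝ) : A.c (A.mul a b) = A.c (a + b) := by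
  rw [mul, map_add, A.c_ι, add_zero]

theorem θ_mul (a b : Fin N → ℝ) : A.θ (A.mul a b) = A.θ (a + b) := by
  rw [mul, map_add, A.θ_ι, add_zero]

/-- The correction by `ι` in `mul` is made for this semidirect law; it leaves `c`, `k`, `θ`
additive. -/
theorem y_mul (a b : Fin N → ℝ) : A.y (A.mul a b) = A.y a + A.lin a (A.y b) := by
  rw [mul, map_add, A.y_ι, map_add]; abel

theorem lin_mul (a b : Fin N → ℝ) : A.lin (A.mul a b) = A.lin (a + b) :=
  A.lin_congr (A.k_mul a b) (A.θ_mul a b)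

theorem y_inv (a : Fin N → ℝ) : A.y (A.inv a) = -A.lin (-a) (A.y a) := by
  rw [inv, map_add, A.y_ι, map_neg]; abel

theorem lin_inv (a : Fin N → ℝ) : A.lin (A.inv a) = A.lin (-a) :=
  A.lin_congr (by rw [inv, map_add, A.k_ι, add_zero]) (by rw [inv, map_add, A.θ_ι, add_zero])

theorem param_zero_mul (a : Fin N → ℝ) : A.mul 0 a = a := by simp [mul, lin_zero]

theorem param_mul_zero (a : Fin N → ℝ) : A.mul a 0 = a := by simp [mul]

theorem param_inv_mul (a : Fin N → ℝ) : A.mul (A.inv a) a = 0 := by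
  rw [mul, lin_inv, inv, ← sub_neg_eq_add _ (A.ι (A.lin (-a) (A.y a) - A.y a)), ← map_neg]
  simp

theorem param_mul_inv (a : Fin N → ℝ) : A.mul a (A.inv a) = 0 := by
  rw [mul, y_inv, map_neg, lin_lin, inv]
  simp only [add_neg_cancel, lin_zero]
  rw [add_assoc, add_assoc, ← map_add]
  simp

theorem param_mul_assoc (a b c : Fin N → ℝ) : A.mul (A.mul a b) c = A.mul a (A.mul b c) := by
  have h1 : A.mul (A.mul a b) c
      = A.mul a b + c + A.ι (A.lin (A.mul a b) (A.y c) - A.y c) := rfl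
  have h2 : A.mul a (A.mul b c)
      = a + A.mul b c + A.ι (A.lin a (A.y (A.mul b c)) - A.y (A.mul b c)) := rfl
  rw [h1, h2, lin_mul, y_mul, map_add, lin_lin]
  simp only [mul, map_sub, map_add]
  abel

theorem contDiff_mul :
    ContDiff ℝ ∞ (fun q : (Fin N → ℝ) × (Fin N → ℝ) => A.mul q.1 q.2) := by
  unfold mul
  have hy : ContDiff ℝ ∞ (fun q : (Fin N → ℝ) × (Fin N → ℝ) => A.y q.2) :=
    A.y.contDiff.comp contDiff_snd
  exact (contDiff_fst.add contDiff_snd).add (A.ι.contDiff.comp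
    ((A.contDiff_lin.comp (contDiff_fst.prodMk hy)).sub hy))

theorem contDiff_inv : ContDiff ℝ ∞ A.inv := by
  unfold inv
  exact contDiff_neg.add (A.ι.contDiff.comp (A.y.contDiff.sub
    (A.contDiff_lin.comp (contDiff_neg.prodMk A.y.contDiff))))

/-- The Lie group of the parameters. -/
noncomputable def lieGroup : LocalLieGroup N where
  carrier := Set.univ
  mulDom := Set.univ
  mul := A.mul
  inv := A.inv
  isOpen_carrier := isOpen_univ
  isOpen_mulDom := isOpen_univ
  mulDom_subset := fun _ _ => ⟨trivial, trivial⟩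
  zero_mem := trivial
  mul_mem := fun _ _ _ => trivial
  inv_mem := fun _ _ => trivial
  smooth_mul := A.contDiff_mul.contDiffOn
  smooth_inv := A.contDiff_inv.contDiffOn
  zero_mul := fun a _ => ⟨trivial, A.param_zero_mul a⟩
  mul_zero := fun a _ => ⟨trivial, A.param_mul_zero a⟩
  inv_mul := fun a _ => ⟨trivial, A.param_inv_mul a⟩
  mul_inv := fun a _ => ⟨trivial, A.param_mul_inv a⟩
  assoc := fun a b c _ _ _ _ => A.param_mul_assoc a b c

theorem family_mul (a b : Fin N → ℝ) (p : Point) :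
    (A.family (A.mul a b)).toFun p = (A.family a).toFun ((A.family b).toFun p) := by
  simp only [family_toFun, lin_mul, y_mul, map_add, lin_lin, time, k_mul, c_mul]
  refine Prod.ext (Prod.ext ?_ ?_) rfl
  · simp only
    -- Composition multiplies `c b` by `e^{2k(a)}`; the alternative guarantees that this factor is 1
    -- or that `c b` vanishes.
    rcases A.comm a b with h | h
    · simp [h]; ring
    · rw [h, mul_add, Real.exp_add]; ring
  · simp only; abel

theorem family_zero (p : Point) : (A.family 0).toFun p = p := by
  simp [family_toFun, time, lin_zero]

/-- The space part of the infinitesimal rotation. -/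
noncomputable def gen : E3 →L[ℝ] E3 :=
  (A.P.toContinuousLinearEquiv : E3 →L[ℝ] E3).comp (rotGen.comp
    (A.P.symm.toContinuousLinearEquiv : E3 →L[ℝ] E3))

theorem gen_apply (x : E3) : A.gen x = A.P (rotGen (A.P.symm x)) := rfl

/-- The infinitesimal action. -/
noncomputable def inf (p : Point) : (Fin N → ℝ) →L[ℝ] Point :=
  (((2 * (p.1.1 - A.t0)) • A.k + A.c).prod
    (A.k.smulRight p.1.2 + A.θ.smulRight (A.gen p.1.2) + A.y)).prod 0

theorem inf_apply (p : Point) (a : Fin N → ℝ) : A.inf p a =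
    ((2 * (p.1.1 - A.t0) * A.k a + A.c a, A.k a • p.1.2 + A.θ a • A.gen p.1.2 + A.y a), 0) := rfl

theorem hasDerivAt_family (p : Point) (a : Fin N → ℝ) :
    HasDerivAt (fun s : ℝ => (A.family (s • a)).toFun p) (A.inf p a) 0 := by
  simp only [family_toFun, inf_apply, lin_apply, orth, time, map_smul, smul_eq_mul]
  have hk : HasDerivAt (fun s : ℝ => s * A.k a) (A.k a) 0 := by
    simpa using (hasDerivAt_id (0 : ℝ)).mul_const (A.k a)
  have hc : HasDerivAt (fun s : ℝ => s * A.c a) (A.c a) 0 := by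
    simpa using (hasDerivAt_id (0 : ℝ)).mul_const (A.c a)
  have hθ : HasDerivAt (fun s : ℝ => s * A.θ a) (A.θ a) 0 := by
    simpa using (hasDerivAt_id (0 : ℝ)).mul_const (A.θ a)
  have hy : HasDerivAt (fun s : ℝ => s • A.y a) (A.y a) 0 := by
    simpa using (hasDerivAt_id (0 : ℝ)).smul_const (A.y a)
  have hr : HasDerivAt (fun s : ℝ => A.P (rot (s * A.θ a) (A.P.symm p.1.2)))
      (A.θ a • A.gen p.1.2) 0 := by
    have h1 := (hasDerivAt_rot (0 * A.θ a) (A.P.symm p.1.2)).scomp (0 : ℝ) hθ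
    have h2 := (A.P.toContinuousLinearEquiv : E3 →L[ℝ] E3).hasFDerivAt.comp_hasDerivAt (0 : ℝ) h1
    simp only [zero_mul, rot_zero, map_smul] at h2
    exact h2
  refine ((HasDerivAt.prodMk ?_ ?_).prodMk (hasDerivAt_const _ _))
  · have := ((((hk.const_mul 2).exp).mul_const (p.1.1 - A.t0)).add_const A.t0).add hc
    refine this.congr_deriv ?_
    simp; ring
  · have := ((hk.exp).smul hr).add hy
    refine this.congr_deriv ?_
    simp [rot_zero]; abel

theorem generator_eq (i : Fin N) (p : Point) :
    A.family.generator i p = A.inf p (Pi.single i 1) := by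
  unfold Family.generator
  rw [← (A.hasDerivAt_family p (Pi.single i 1)).deriv]
  congr 1
  funext s
  rw [← Pi.single_smul]; simp

theorem sum_generator (g : Fin N → ℝ) (p : Point) :
    ∑ i, g i • A.family.generator i p = A.inf p g := by
  simp only [generator_eq]
  conv_rhs => rw [show g = ∑ i, g i • (Pi.single i 1 : Fin N → ℝ) from by
    ext j; simp [Finset.sum_apply, Pi.single_apply]]
  simp [map_sum, map_smul]

theorem gen_ne_zero : ∃ x, A.gen x ≠ 0 := by
  refine ⟨A.P (!₂[1, 0, 0]), fun h => ?_⟩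
  rw [gen_apply, A.P.symm_apply_apply] at h
  have h2 := congrArg (fun z : E3 => z 1) ((map_eq_zero_iff _ A.P.injective).1 h)
  simp [rotGen_apply] at h2

/-- The time component at two instants determines `k` and `c`, the space component at the origin
determines `y`, and a point off the rotation axis determines `θ`; `inj` then applies. -/
theorem linearIndependent_generator (B : BVP) :
    LinearIndependent ℝ (fun i => fun p : B.domain => A.family.generator i p) := by
  rw [Fintype.linearIndependent_iff]
  intro g hg
  have h : ∀ t x, B.tStar < t → A.inf ((t, x), (B.u_v, B.v_m)) g = 0 := by
    intro t x ht
    have := congrFun hg ⟨((t, x), (B.u_v, B.v_m)), ht, B.u_v_mem, B.v_m_mem⟩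
    rw [← sum_generator]
    simpa [Finset.sum_apply] using this
  simp only [inf_apply, Prod.mk_eq_zero] at h
  have h0 := h (B.tStar + 1) 0 (by linarith)
  have h1 := h (B.tStar + 2) 0 (by linarith)
  have hk : A.k g = 0 := by linarith [h0.1.1, h1.1.1]
  have hc : A.c g = 0 := by have := h0.1.1; rw [hk] at this; linarith
  have hy : A.y g = 0 := by simpa using h0.1.2
  obtain ⟨x, hx⟩ := A.gen_ne_zero
  have h2 := (h (B.tStar + 1) x (by linarith)).1.2
  rw [hk, hy, zero_smul, zero_add, add_zero, smul_eq_zero] at h2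
  have := A.inj g hc hk (h2.resolve_right hx) hy
  simp [this]

theorem isLocalTransformationGroup (B : BVP) :
    IsLocalTransformationGroup B.domain (A.family.naturalDomain B.domain) A.family := by
  have hD := B.isOpen_domain
  refine ⟨A.lieGroup, ?_, ?_, ?_, ?_, ?_, ?_, ?_, ?_, ?_⟩
  · exact (hD.preimage continuous_snd).inter (hD.preimage A.contDiff_family.continuous)
  · exact fun q hq => ⟨trivial, hq.1⟩
  · exact fun p hp => ⟨hp, by rw [family_zero]; exact hp⟩
  · exact A.contDiff_family.contDiffOn
  · exact fun ε p h => h.2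
  · exact fun p _ => A.family_zero p
  · refine fun ε p h => ⟨h.2, ?_⟩
    have : (A.family (A.inv ε)).toFun ((A.family ε).toFun p) = p := by
      rw [← family_mul, param_inv_mul, family_zero]
    exact this.symm ▸ h.1
  · exact fun ε δ p _ _ _ _ => A.family_mul ε δ p
  · exact A.linearIndependent_generator B

/-! ### Invariance -/

theorem hasFDerivAt_base (ε : Fin N → ℝ) (b : Base) :
    HasFDerivAt (A.family ε).base
      (((Real.exp (2 * A.k ε)) • ContinuousLinearMap.fst ℝ ℝ E3).prod
        ((A.lin ε).comp (ContinuousLinearMap.snd ℝ ℝ E3))) b := by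
  have h1 : HasFDerivAt (fun q : Base => A.time ε q.1)
      ((Real.exp (2 * A.k ε)) • ContinuousLinearMap.fst ℝ ℝ E3) b := by
    have : HasFDerivAt (fun q : Base => q.1) (ContinuousLinearMap.fst ℝ ℝ E3) b := hasFDerivAt_fst
    exact (((this.sub_const A.t0).const_mul _).add_const A.t0).add_const (A.c ε)
  have h2 : HasFDerivAt (fun q : Base => A.lin ε q.2 + A.y ε)
      ((A.lin ε).comp (ContinuousLinearMap.snd ℝ ℝ E3)) b :=
    ((A.lin ε).comp (ContinuousLinearMap.snd ℝ ℝ E3)).hasFDerivAt.add_const _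
  exact h1.prodMk h2

theorem differentiableAt_base (ε : Fin N → ℝ) (b : Base) :
    DifferentiableAt ℝ (A.family ε).base b := (A.hasFDerivAt_base ε b).differentiableAt

theorem fderiv_base_time (ε : Fin N → ℝ) (b : Base) :
    fderiv ℝ (A.family ε).base b (1, 0) = (Real.exp (2 * A.k ε), 0) := by
  rw [(A.hasFDerivAt_base ε b).fderiv]; simp

theorem fderiv_base_space (ε : Fin N → ℝ) (b : Base) (z : E3) :
    fderiv ℝ (A.family ε).base b (0, z) = (0, A.lin ε z) := by
  rw [(A.hasFDerivAt_base ε b).fderiv]; simp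

/-- The flux is equivariant with respect to the group. -/
def Preserves (B : BVP) : Prop := ∀ ε t, B.tStar < t → B.tStar < A.time ε t →
  A.orth ε (B.Q t) = Real.exp (A.k ε) • B.Q (A.time ε t)

theorem lin_Q {B : BVP} (hQ : A.Preserves B) {ε : Fin N → ℝ} {t : ℝ} (ht : B.tStar < t)
    (ht' : B.tStar < A.time ε t) :
    A.lin ε (B.Q t) = Real.exp (2 * A.k ε) • B.Q (A.time ε t) := by
  rw [lin_apply, hQ ε t ht ht', smul_smul, ← Real.exp_add, two_mul]

theorem equation_aux {d : ℝ → ℝ} {I : Set ℝ} (hI : IsOpen I) (hd : ContDiffOn ℝ ∞ d I)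
    {ε : Fin N → ℝ} {b : Base} {f f' : Base → ℝ} (hf' : ContDiffAt ℝ ∞ f' ((A.family ε).base b))
    (h : ∀ᶠ q in 𝓝 b, f' ((A.family ε).base q) = f q) (hfI : f b ∈ I)
    (he : dt f b = divFlux d f b) :
    dt f' ((A.family ε).base b) = divFlux d f' ((A.family ε).base b) := by
  have hd' : ContDiffAt ℝ ∞ d (f' ((A.family ε).base b)) := by
    rw [h.self_of_nhds]; exact hd.contDiffAt (hI.mem_nhds hfI)
  rw [dt_comp (hf'.differentiableAt (by simp)) (A.differentiableAt_base ε b)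
    (A.fderiv_base_time ε b) h,
    divFlux_comp (Real.exp_pos _) (A.inner_lin ε) hf' hd'
      (Filter.Eventually.of_forall fun q => ⟨A.differentiableAt_base ε q,
        A.fderiv_base_space ε q⟩) h] at he
  exact mul_left_cancel₀ (Real.exp_pos _).ne' he

theorem dt_base {ε : Fin N → ℝ} {b : Base} {f f' : Base → ℝ}
    (hf' : ContDiffAt ℝ ∞ f' ((A.family ε).base b))
    (h : ∀ᶠ q in 𝓝 b, f' ((A.family ε).base q) = f q) :
    dt f b = Real.exp (2 * A.k ε) * dt f' ((A.family ε).base b) :=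
  dt_comp (hf'.differentiableAt (by simp)) (A.differentiableAt_base ε b)
    (A.fderiv_base_time ε b) h

theorem grad_base {ε : Fin N → ℝ} {b : Base} {f f' : Base → ℝ}
    (hf' : ContDiffAt ℝ ∞ f' ((A.family ε).base b))
    (h : ∀ᶠ q in 𝓝 b, f' ((A.family ε).base q) = f q) :
    grad f b = (A.lin ε).adjoint (grad f' ((A.family ε).base b)) :=
  grad_comp (hf'.differentiableAt (by simp)) (A.differentiableAt_base ε b)
    (A.fderiv_base_space ε b) h

theorem inner_adjoint_lin (ε : Fin N → ℝ) (x y : E3) :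
    inner ℝ ((A.lin ε).adjoint x) ((A.lin ε).adjoint y) = Real.exp (2 * A.k ε) * inner ℝ x y :=
  inner_adjoint_conformal (Real.exp_pos _) (A.inner_lin ε) x y

/-- Lengths scale by `e^k` and times by `e^{2k}`, so time derivatives, diffusion terms and products
of gradients all acquire the factor `e^{2k}`. By `Preserves` the term with `Q` acquires it too, and
the factor cancels from every condition. -/
theorem admits {B : BVP} (hQ : A.Preserves B) : B.Admits A.family := by
  have exp_ne : ∀ ε, Real.exp (2 * A.k ε) ≠ 0 := fun ε => (Real.exp_pos _).ne'
  refine ⟨A.isLocalTransformationGroup B, ?_, ?_, ?_, ?_, ?_⟩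
  · rintro ε b w w' ⟨⟨-, hu, hv⟩, -⟩ ⟨-, hw', h⟩ ⟨e1, e2⟩
    exact ⟨A.equation_aux B.isOpen_I₁ B.smooth_d₁ hw'.fst (h.mono fun q hq => congrArg Prod.fst hq)
        hu e1,
      A.equation_aux B.isOpen_I₂ B.smooth_d₂ hw'.snd (h.mono fun q hq => congrArg Prod.snd hq)
        hv e2⟩
  · rintro ε b w w' S S' ⟨⟨ht, -, -⟩, ht', -, -⟩ ⟨-, hw', h⟩ ⟨-, hS', hS⟩ hb
    rw [BVP.onSurface₁_iff] at hb ⊢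
    obtain ⟨h1, h2, h3, h4, h5⟩ := hb
    have hu : ∀ᶠ q in 𝓝 b, (w' ((A.family ε).base q)).1 = (w q).1 :=
      h.mono fun q hq => congrArg Prod.fst hq
    have hq : B.Q ((A.family ε).base b).1
        = (Real.exp (2 * A.k ε))⁻¹ • A.lin ε (B.Q b.1) := by
      rw [A.lin_Q hQ ht ht', smul_smul, inv_mul_cancel₀ (exp_ne ε), one_smul]; rfl
    rw [A.dt_base hS' hS] at h2 h4
    rw [A.grad_base hS' hS, ContinuousLinearMap.adjoint_inner_right] at h3
    rw [A.grad_base hS' hS, A.grad_base (f' := fun q => (w' q).1) hw'.fst hu, inner_adjoint_lin,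
      ContinuousLinearMap.adjoint_inner_right] at h4
    refine ⟨by rw [hS.self_of_nhds, h1], right_ne_zero_of_mul h2, ?_, ?_, ?_⟩
    · rw [hq, inner_smul_left]
      exact mul_ne_zero (by simp) h3
    · rw [hq, inner_smul_left, conj_trivial]
      have := exp_ne ε
      field_simp
      linear_combination h4
    · exact hu.self_of_nhds.trans h5
  · rintro ε b w w' S S' - ⟨-, hw', h⟩ ⟨-, hS', hS⟩ hb
    rw [BVP.onSurface₂_iff] at hb ⊢
    obtain ⟨h1, h2, h3, h4, h5, h6⟩ := hb
    have hu : ∀ᶠ q in 𝓝 b, (w' ((A.family ε).base q)).1 = (w q).1 :=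
      h.mono fun q hq => congrArg Prod.fst hq
    have hv : ∀ᶠ q in 𝓝 b, (w' ((A.family ε).base q)).2 = (w q).2 :=
      h.mono fun q hq => congrArg Prod.snd hq
    rw [A.dt_base hS' hS] at h2 h4
    rw [A.grad_base hS' hS] at h3
    rw [A.grad_base hS' hS, A.grad_base (f' := fun q => (w' q).1) hw'.fst hu,
      A.grad_base (f' := fun q => (w' q).2) hw'.snd hv, inner_adjoint_lin,
      inner_adjoint_lin] at h4
    refine ⟨by rw [hS.self_of_nhds, h1], right_ne_zero_of_mul h2, ?_, ?_,
      hu.self_of_nhds.trans h5, hv.self_of_nhds.trans h6⟩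
    · rintro h; rw [h, map_zero] at h3; exact h3 rfl
    · exact mul_left_cancel₀ (exp_ne ε) (by linear_combination h4)
  · intro t u ht hu
    -- Small parameters keep the transformed time in the time interval, the only constraint on the
    -- image that has to be secured.
    have h1 : ∀ᶠ ε in 𝓝 (0 : Fin N → ℝ), B.tStar < A.time ε t := by
      have hc : Continuous fun ε => A.time ε t :=
        A.contDiff_time.continuous.comp (continuous_id.prodMk continuous_const)
      refine hc.continuousAt.eventually (lt_mem_nhds ?_)
      simpa [time] using ht
    have h2 : ∀ᶠ v in 𝓝 B.v_inf, v ∈ B.I₂ := B.isOpen_I₂.mem_nhds B.v_inf_mem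
    filter_upwards [h1.prod_mk ((Filter.Eventually.of_forall
      (f := Bornology.cobounded E3) (fun _ => trivial)).prod_mk h2)] with q hq
    exact ⟨⟨ht, hu, hq.2.2⟩, hq.1, hu, hq.2.2⟩
  · intro t u ht hu
    refine Filter.Eventually.of_forall fun ε => ⟨?_, ?_⟩
    · have h1 : Filter.Tendsto (fun x : E3 => Real.exp (A.k ε) * ‖x‖ - ‖A.y ε‖)
          (Bornology.cobounded E3) Filter.atTop :=
        Filter.tendsto_atTop_add_const_right _ _
          (Filter.Tendsto.const_mul_atTop (Real.exp_pos _) tendsto_norm_cobounded_atTop)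
      rw [← tendsto_norm_atTop_iff_cobounded]
      refine Filter.tendsto_atTop_mono (fun x => ?_) h1
      have h2 : ‖A.lin ε x‖ = Real.exp (A.k ε) * ‖x‖ := by
        have : ‖A.orth ε x‖ = ‖x‖ := by
          rw [← Real.sqrt_sq (norm_nonneg _), ← real_inner_self_eq_norm_sq, inner_orth,
            real_inner_self_eq_norm_sq, Real.sqrt_sq (norm_nonneg _)]
        rw [lin_apply, norm_smul, this, Real.norm_eq_abs, abs_of_pos (Real.exp_pos _)]
      rw [family_base, ← h2]
      have := norm_sub_norm_le (A.lin ε x) (-A.y ε)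
      rwa [norm_neg, sub_neg_eq_add] at this
    · exact Filter.tendsto_snd

end SimilarityData

/-! ### The linear algebra of the interface condition -/

/-- Two planes do not cover space. If `k` lies in the plane orthogonal to `Q`, then `k + Q` avoids
both planes; otherwise `k` does. -/
theorem exists_inner_ne_zero {Q k : E3} (hQ : Q ≠ 0) (hk : k ≠ 0) :
    ∃ z : E3, inner ℝ Q z ≠ 0 ∧ inner ℝ z k ≠ 0 := by
  have hQ' : inner ℝ Q Q ≠ 0 := inner_self_ne_zero.2 hQ
  have hk' : inner ℝ k k ≠ 0 := inner_self_ne_zero.2 hk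
  by_cases h : inner ℝ Q k = 0
  · refine ⟨k + Q, ?_, ?_⟩
    · rwa [inner_add_right, h, zero_add]
    · rwa [inner_add_left, h, add_zero]
  · exact ⟨k, h, hk'⟩

/-- A linear functional on `ℝ³` which vanishes off a plane vanishes. -/
theorem eq_zero_of_off_plane {Q : E3} (hQ : Q ≠ 0) (f : E3 → ℝ)
    (hf : ∀ y z, f (y + z) = f y + f z) (h : ∀ z, inner ℝ Q z ≠ 0 → f z = 0) (z : E3) :
    f z = 0 := by
  have hQ' : inner ℝ Q Q ≠ 0 := inner_self_ne_zero.2 hQ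
  by_cases hz : inner ℝ Q z = 0
  · have h1 := h (z + Q) (by rwa [inner_add_right, hz, zero_add])
    rw [hf, h Q hQ', add_zero] at h1
    exact h1
  · exact h z hz

/-- A linear change `(σ_t, σ_x) ↦ (a σ_t + ⟨σ_x, k⟩, σ_t β + N† σ_x)` of covectors which preserves
the flux condition on the first free surface is block diagonal and conformal. -/
theorem conformal_of_interface {d H ν a : ℝ} {Q Q' k β : E3} {N : E3 →L[ℝ] E3} (hd : 0 < d)
    (hH : 0 < H) (hν : ν ≠ 0) (ha : a ≠ 0) (hQ : Q ≠ 0)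
    (h : ∀ (lt : ℝ) (lx : E3) (st : ℝ) (sx : E3), st ≠ 0 → inner ℝ Q sx ≠ 0 →
      d * inner ℝ lx sx = -H * st - inner ℝ Q sx →
      st * a + inner ℝ sx k ≠ 0 ∧
      d * inner ℝ (ν • (lt • β + N.adjoint lx)) (st • β + N.adjoint sx)
        = -H * (st * a + inner ℝ sx k) - inner ℝ Q' (st • β + N.adjoint sx)) :
    k = 0 ∧ β = 0 ∧ N Q' = a • Q ∧
      ∀ y z, ν * inner ℝ (N.adjoint y) (N.adjoint z) = a * inner ℝ y z := by
  have hQQ : inner ℝ Q Q ≠ 0 := inner_self_ne_zero.2 hQ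
  -- The flux condition is one scalar equation for `lx`, solvable by a multiple of `sx`.
  have hlx : ∀ st sx, inner ℝ Q sx ≠ 0 → ∃ lx : E3,
      d * inner ℝ lx sx = -H * st - inner ℝ Q sx := by
    intro st sx hs
    have hs0 : inner ℝ sx sx ≠ 0 := by
      refine inner_self_ne_zero.2 ?_
      rintro rfl; simp at hs
    refine ⟨((-H * st - inner ℝ Q sx) / (d * inner ℝ sx sx)) • sx, ?_⟩
    rw [inner_smul_left, conj_trivial]
    field_simp
  -- If `k ≠ 0`, the value of `st` can be tuned so that the transformed time component vanishes,
  -- which the nondegeneracy of the image forbids.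
  have hk : k = 0 := by
    by_contra hk
    obtain ⟨z, hz, hzk⟩ := exists_inner_ne_zero hQ hk
    obtain ⟨lx, hl⟩ := hlx (-inner ℝ z k / a) z hz
    refine (h 0 lx (-inner ℝ z k / a) z (div_ne_zero (neg_ne_zero.2 hzk) ha) hz hl).1 ?_
    field_simp; ring
  subst hk
  -- The time component `lt` is absent from the original condition but enters the transformed one
  -- through `β`. Comparing `lt = 0` with `lt = 1` leaves an identity affine in `st`, whose slope is
  -- `⟨β, β⟩`.
  have hβ : β = 0 := by
    have key : ∀ st : ℝ, st ≠ 0 → inner ℝ β (st • β + N.adjoint Q) = 0 := by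
      intro st hst
      obtain ⟨lx, hl⟩ := hlx st Q hQQ
      have h0 := (h 0 lx st Q hst hQQ hl).2
      have h1 := (h 1 lx st Q hst hQQ hl).2
      rw [← h0, inner_smul_left, inner_smul_left, zero_smul, zero_add, one_smul,
        inner_add_left, conj_trivial] at h1
      have h2 : d * ν * inner ℝ β (st • β + N.adjoint Q) = 0 := by linear_combination h1
      exact (mul_eq_zero.1 h2).resolve_left (mul_ne_zero hd.ne' hν)
    have h1 := key 1 one_ne_zero
    have h2 := key 2 two_ne_zero
    rw [inner_add_right, inner_smul_right] at h1 h2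
    exact inner_self_eq_zero.1 (by linear_combination h2 - h1 : inner ℝ β β = 0)
  subst hβ
  -- The original condition is solved for `st`; the second hypothesis says that the resulting `st`
  -- is nonzero.
  have key : ∀ y z, inner ℝ Q z ≠ 0 → d * inner ℝ y z + inner ℝ Q z ≠ 0 →
      d * ν * inner ℝ (N.adjoint y) (N.adjoint z)
        = a * (d * inner ℝ y z + inner ℝ Q z) - inner ℝ (N Q') z := by
    intro y z hz hyz
    have := (h 0 y (-(d * inner ℝ y z + inner ℝ Q z) / H) z
      (div_ne_zero (neg_ne_zero.2 hyz) hH.ne') hz (by field_simp; ring)).2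
    simp only [smul_zero, zero_add, inner_zero_right, add_zero, inner_smul_left, conj_trivial,
      ContinuousLinearMap.adjoint_inner_right N Q' z] at this
    field_simp at this
    linear_combination this
  -- The choice `y = 0` isolates the part of `key` that does not involve `lx`.
  have hNQ : ∀ z, inner ℝ (N Q') z = a * inner ℝ Q z := by
    intro z
    have := eq_zero_of_off_plane hQ (fun z => inner ℝ (N Q') z - a * inner ℝ Q z)
      (fun y z => by simp only [inner_add_right]; ring) (fun z hz => by
        have := key 0 z hz (by simpa using hz)
        simp only [map_zero, inner_zero_left] at this
        linear_combination this) z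
    linarith
  refine ⟨rfl, rfl, ext_inner_right ℝ fun z => by rw [hNQ, inner_smul_left]; rfl, fun y z => ?_⟩
  have := eq_zero_of_off_plane hQ
    (fun z => ν * inner ℝ (N.adjoint y) (N.adjoint z) - a * inner ℝ y z)
      (fun y z => by simp only [inner_add_right, map_add]; ring) (fun z hz => by
        by_cases hyz : d * inner ℝ y z + inner ℝ Q z = 0
        -- For this pair `key` is unavailable because `st` would be zero. Doubling `y` changes the
        -- excluded quantity to `-⟨Q, z⟩ ≠ 0`, and the claim is homogeneous in `y`.
        · have := key ((2 : ℝ) • y) z hz (by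
            rw [inner_smul_left, conj_trivial]
            intro h; apply hz; linear_combination -h + 2 * hyz)
          rw [hNQ, map_smul, inner_smul_left, inner_smul_left, conj_trivial] at this
          refine mul_left_cancel₀ (mul_ne_zero hd.ne' two_ne_zero) ?_
          linear_combination this
        · have := key y z hz hyz
          rw [hNQ] at this
          refine mul_left_cancel₀ hd.ne' ?_
          linear_combination this) z
  linarith

/-- The same in terms of the derivative `J` of the transformation of `(t, x)`. -/
theorem conformal_of_interface_inverse {d H ν : ℝ} {Q Q' : E3} (J : Base ≃L[ℝ] Base) (hd : 0 < d)
    (hH : 0 < H) (hν : ν ≠ 0) (hQ : Q ≠ 0)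
    (hJ : ‖(J : Base →L[ℝ] Base) - ContinuousLinearMap.id ℝ Base‖ < 1 / 2)
    (h : ∀ (l σ : Base →L[ℝ] ℝ) (lx sx : E3), (∀ y, l (0, y) = inner ℝ lx y) →
      (∀ y, σ (0, y) = inner ℝ sx y) → σ (1, 0) ≠ 0 → inner ℝ Q sx ≠ 0 →
      d * inner ℝ lx sx = -H * σ (1, 0) - inner ℝ Q sx →
      ∃ lx' sx' : E3, (∀ y, ν * l (J.symm (0, y)) = inner ℝ lx' y) ∧
        (∀ y, σ (J.symm (0, y)) = inner ℝ sx' y) ∧ σ (J.symm (1, 0)) ≠ 0 ∧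
        d * inner ℝ lx' sx' = -H * σ (J.symm (1, 0)) - inner ℝ Q' sx') :
    (J (1, 0)).2 = 0 ∧ (∀ y, (J (0, y)).1 = 0) ∧
      (J (1, 0)).1 • Q' = (J (0, Q)).2 ∧ 0 < ν * (J (1, 0)).1 ∧
      ∀ y z, inner ℝ (J (0, y)).2 (J (0, z)).2 = ν * (J (1, 0)).1 * inner ℝ y z := by
  -- Covectors are transported by the inverse Jacobian, so the linear algebra is done for `K` and
  -- inverted at the end.
  set K : Base →L[ℝ] Base := (J.symm : Base →L[ℝ] Base) with hK
  set a := (K (1, 0)).1 with ha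
  set k := (K (1, 0)).2 with hk
  set N : E3 →L[ℝ] E3 := (ContinuousLinearMap.snd ℝ ℝ E3).comp
    (K.comp (ContinuousLinearMap.inr ℝ ℝ E3)) with hN
  set β : E3 := (InnerProductSpace.toDual ℝ E3).symm ((ContinuousLinearMap.fst ℝ ℝ E3).comp
    (K.comp (ContinuousLinearMap.inr ℝ ℝ E3))) with hβ
  have hβ' : ∀ y, inner ℝ β y = (K (0, y)).1 := fun y => by
    rw [hβ, InnerProductSpace.toDual_symm_apply]; rfl
  have hJK : ∀ x, J (K x) = x := fun x => J.apply_symm_apply x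
  -- If `a = 0`, then `J (0, k) = (1, 0)` and `J - id` maps `(0, k)` to `(1, -k)`. Closeness to the
  -- identity gives `‖k‖ ≤ ‖k‖ / 2`, hence `k = 0`, which is absurd.
  have ha0 : a ≠ 0 := by
    intro h0
    have h1 : J (0, k) = (1, 0) := by
      rw [← hJK (1, 0), ← h0]
    have h2 := ((J : Base →L[ℝ] Base) - ContinuousLinearMap.id ℝ Base).le_of_opNorm_le hJ.le (0, k)
    have h3 : ((J : Base →L[ℝ] Base) - ContinuousLinearMap.id ℝ Base) (0, k) = (1, -k) := by
      simp [h1]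
    rw [h3] at h2
    have h4 : ‖k‖ ≤ 1 / 2 * ‖k‖ := by
      calc ‖k‖ = ‖((1 : ℝ), -k).2‖ := (norm_neg k).symm
        _ ≤ ‖((1 : ℝ), -k)‖ := norm_snd_le _
        _ ≤ 1 / 2 * ‖((0 : ℝ), k)‖ := h2
        _ = 1 / 2 * ‖k‖ := by simp [Prod.norm_def]
    have h5 : k = 0 := norm_eq_zero.1 (by linarith [norm_nonneg k])
    rw [h5, Prod.mk_zero_zero, map_zero] at h1
    exact zero_ne_one (congrArg Prod.fst h1)
  have hdec : ∀ l : Base →L[ℝ] ℝ, ∀ lx : E3, (∀ y, l (0, y) = inner ℝ lx y) → ∀ x,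
      l x = l (1, 0) * x.1 + inner ℝ lx x.2 := by
    intro l lx hl x
    have : x = x.1 • ((1 : ℝ), (0 : E3)) + (0, x.2) := by ext1 <;> simp
    conv_lhs => rw [this]
    rw [map_add, map_smul, hl, smul_eq_mul, mul_comm]
  obtain ⟨hk0, hβ0, hNQ, hNN⟩ := conformal_of_interface (k := k) (β := β) (N := N) (Q' := Q')
    hd hH hν ha0 hQ (by
      intro lt lx st sx hst hsx hcond
      let L : ℝ → E3 → (Base →L[ℝ] ℝ) := fun r z =>
        r • ContinuousLinearMap.fst ℝ ℝ E3 + (innerSL ℝ z).comp (ContinuousLinearMap.snd ℝ ℝ E3)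
      have hL0 : ∀ r z y, L r z (0, y) = inner ℝ z y := fun r z y => by simp [L]
      have hL1 : ∀ r z, L r z (1, 0) = r := fun r z => by simp [L]
      obtain ⟨lx', sx', h1, h2, h3, h4⟩ := h (L lt lx) (L st sx) lx sx (hL0 _ _) (hL0 _ _)
        (by rwa [hL1]) hsx (by rwa [hL1])
      have e1 : lx' = ν • (lt • β + N.adjoint lx) := ext_inner_right ℝ fun y => by
        rw [← h1, hdec _ lx (hL0 _ _), hL1, inner_smul_left, inner_add_left, inner_smul_left,
          ContinuousLinearMap.adjoint_inner_left, hβ']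
        rfl
      have e2 : sx' = st • β + N.adjoint sx := ext_inner_right ℝ fun y => by
        rw [← h2, hdec _ sx (hL0 _ _), hL1, inner_add_left, inner_smul_left,
          ContinuousLinearMap.adjoint_inner_left, hβ']
        rfl
      have e3 : L st sx (J.symm (1, 0)) = st * a + inner ℝ sx k := by
        rw [hdec _ sx (hL0 _ _), hL1]; rfl
      rw [e3] at h3 h4
      rw [e1, e2] at h4
      exact ⟨h3, h4⟩)
  have hK1 : K (1, 0) = (a, 0) := Prod.ext rfl hk0
  have hK2 : ∀ y, K (0, y) = (0, N y) := fun y => Prod.ext (by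
    rw [← hβ', hβ0, inner_zero_left]) rfl
  have hJ1 : J (1, 0) = (a⁻¹, 0) := by
    have h1 : J (a, 0) = (1, 0) := by rw [← hK1, hJK]
    have h2 : ((1 : ℝ), (0 : E3)) = a⁻¹ • (a, 0) := by ext1 <;> simp [ha0]
    rw [h2, map_smul, h1]; ext1 <;> simp
  have hJ2 : ∀ y, J (0, N y) = (0, y) := fun y => by rw [← hK2, hJK]
  -- The sign is read off from the squared length of `N.adjoint Q`.
  have hpos : 0 < ν⁻¹ * a := by
    have h1 := hNN Q Q
    have h2 : inner ℝ (N.adjoint Q) (N.adjoint Q) = ν⁻¹ * a * inner ℝ Q Q := by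
      rw [mul_assoc, ← h1]; field_simp
    have h3 : 0 ≤ inner ℝ (N.adjoint Q) (N.adjoint Q) := real_inner_self_nonneg
    have h4 : 0 < inner ℝ Q Q := real_inner_self_pos.2 hQ
    rw [h2] at h3
    exact lt_of_le_of_ne (nonneg_of_mul_nonneg_left h3 h4)
      (Ne.symm (mul_ne_zero (inv_ne_zero hν) ha0))
  have hNc : ∀ x y, inner ℝ (N.adjoint x) (N.adjoint y) = (ν⁻¹ * a) * inner ℝ x y := by
    intro x y
    rw [mul_assoc, ← hNN]; field_simp
  have hNc' := inner_adjoint_conformal hpos hNc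
  rw [ContinuousLinearMap.adjoint_adjoint] at hNc'
  have hsurj := conformal_surjective hpos hNc'
  have hpos' : 0 < ν * a⁻¹ := by
    have := inv_pos.2 hpos
    rwa [_root_.mul_inv, inv_inv] at this
  rw [hJ1]
  refine ⟨rfl, fun y => ?_, ?_, hpos', fun y z => ?_⟩
  · obtain ⟨y, rfl⟩ := hsurj y
    rw [hJ2]
  · have : Q = N (a⁻¹ • Q') := by rw [map_smul, hNQ, smul_smul, inv_mul_cancel₀ ha0, one_smul]
    rw [this, hJ2]
  · obtain ⟨y, rfl⟩ := hsurj y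
    obtain ⟨z, rfl⟩ := hsurj z
    rw [hJ2, hJ2, hNc']
    field_simp

/-! ### Curves of invariance transformations -/

theorem exists_local_inverse {φ : Base → Base} {b : Base} (hφ : ContDiffAt ℝ ∞ φ b)
    (e : Base ≃L[ℝ] Base) (he : (e : Base →L[ℝ] Base) = fderiv ℝ φ b) :
    ∃ h : Base → Base, ContDiffAt ℝ ∞ h (φ b) ∧ ∀ᶠ q in 𝓝 b, h (φ q) = q := by
  have hd : HasFDerivAt φ (e : Base →L[ℝ] Base) b := by
    rw [he]; exact (hφ.differentiableAt (by simp)).hasFDerivAt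
  refine ⟨hφ.localInverse hd (by simp), hφ.to_localInverse hd (by simp), ?_⟩
  let Φ := hφ.toOpenPartialHomeomorph φ hd (by simp)
  filter_upwards [Φ.open_source.mem_nhds
    (hφ.mem_toOpenPartialHomeomorph_source hd (by simp))] with q hq
  exact Φ.left_inv hq

/-- Neumann series for `1 - (1 - J)`. -/
theorem exists_equiv_of_near {J : Base →L[ℝ] Base}
    (h : ‖J - ContinuousLinearMap.id ℝ Base‖ < 1 / 2) :
    ∃ e : Base ≃L[ℝ] Base, (e : Base →L[ℝ] Base) = J := by
  have h' : ‖1 - J‖ < 1 := by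
    rw [norm_sub_rev]; exact lt_trans h (by norm_num)
  refine ⟨ContinuousLinearEquiv.ofUnit (Units.oneSub (1 - J) h'), ?_⟩
  refine ContinuousLinearMap.ext fun x => ?_
  change ((Units.oneSub (1 - J) h' : (Base →L[ℝ] Base)ˣ) : Base →L[ℝ] Base) x = J x
  rw [Units.val_oneSub, sub_sub_cancel]

theorem fderiv_image {φ : Base → Base} {f f' : Base → ℝ} {b : Base}
    (hf' : DifferentiableAt ℝ f' (φ b)) (hφ : DifferentiableAt ℝ φ b)
    (e : Base ≃L[ℝ] Base) (he : (e : Base →L[ℝ] Base) = fderiv ℝ φ b)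
    (h : ∀ᶠ q in 𝓝 b, f' (φ q) = f q) (x : Base) :
    fderiv ℝ f' (φ b) x = fderiv ℝ f b (e.symm x) := by
  rw [fderiv_eq_comp hf' hφ h, ← he, ContinuousLinearMap.comp_apply]
  congr 1
  exact (e.apply_symm_apply x).symm

/-- A smooth curve of local transformations through the identity which leave the problem
invariant. -/
structure InvCurve (B : BVP) (W : Set (ℝ × Point)) (g : ℝ → PointTransformation) : Prop where
  isOpen : IsOpen W
  subset : ∀ s p, (s, p) ∈ W → p ∈ B.domain
  mapsTo : ∀ s p, (s, p) ∈ W → (g s).toFun p ∈ B.domain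
  zero_mem : ∀ p ∈ B.domain, ((0 : ℝ), p) ∈ W
  smooth : ContDiffOn ℝ ∞ (fun z : ℝ × Point => (g z.1).toFun z.2) W
  zero : ∀ p ∈ B.domain, (g 0).toFun p = p
  equations : ∀ s b w w', (s, (b, w b)) ∈ W → IsImage (g s) b w w' →
    B.OnEquations w b → B.OnEquations w' ((g s).base b)
  surface₁ : ∀ s b w w' S S', (s, (b, w b)) ∈ W → IsImage (g s) b w w' →
    IsImageSurface (g s) b S S' → B.OnSurface₁ w S b → B.OnSurface₁ w' S' ((g s).base b)
  surface₂ : ∀ s b w w' S S', (s, (b, w b)) ∈ W → IsImage (g s) b w w' →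
    IsImageSurface (g s) b S S' → B.OnSurface₂ w S b → B.OnSurface₂ w' S' ((g s).base b)

namespace InvCurve

variable {B : BVP} {W : Set (ℝ × Point)} {g : ℝ → PointTransformation}

theorem contDiffAt (h : InvCurve B W g) {z : ℝ × Point} (hz : z ∈ W) :
    ContDiffAt ℝ ∞ (fun z : ℝ × Point => (g z.1).toFun z.2) z :=
  h.smooth.contDiffAt (h.isOpen.mem_nhds hz)

theorem contDiffAt_toFun (h : InvCurve B W g) {s : ℝ} {p : Point} (hz : (s, p) ∈ W) :
    ContDiffAt ℝ ∞ (g s).toFun p :=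
  (h.contDiffAt hz).comp p (contDiffAt_const.prodMk contDiffAt_id)

theorem contDiffAt_base₂ (h : InvCurve B W g) {s : ℝ} {b : Base} {y : Fibre}
    (hz : (s, (b, y)) ∈ W) :
    ContDiffAt ℝ ∞ (fun z : ℝ × Base => (g z.1).base z.2) (s, b) :=
  ContDiffAt.fst (f := fun z : ℝ × Base => (g z.1).toFun (z.2, y))
    ((h.contDiffAt hz).comp (s, b) (contDiffAt_fst.prodMk (contDiffAt_snd.prodMk contDiffAt_const)))

theorem contDiffAt_base (h : InvCurve B W g) {s : ℝ} {b : Base} {y : Fibre}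
    (hz : (s, (b, y)) ∈ W) : ContDiffAt ℝ ∞ (g s).base b :=
  (h.contDiffAt_base₂ hz).comp b (contDiffAt_const.prodMk contDiffAt_id)

/-- The transformation of `(t, x)` does not involve the unknowns, so a local inverse of it suffices
to make the image of a graph a graph. Every test jet thereby has an image to which invariance can be
applied. -/
theorem exists_image (h : InvCurve B W g) {s : ℝ} {b : Base} {w : Base → Fibre}
    (hz : (s, (b, w b)) ∈ W) (hw : ContDiffAt ℝ ∞ w b)
    (e : Base ≃L[ℝ] Base) (he : (e : Base →L[ℝ] Base) = fderiv ℝ (g s).base b) :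
    ∃ w', IsImage (g s) b w w' := by
  obtain ⟨k, hk, hkl⟩ := exists_local_inverse (h.contDiffAt_base hz) e he
  have hkb := hkl.self_of_nhds
  refine ⟨fun z => ((g s).toFun (k z, w (k z))).2, hw, ?_, ?_⟩
  · have h1 : ContDiffAt ℝ ∞ (fun z => (k z, w (k z))) ((g s).base b) := by
      refine hk.prodMk (ContDiffAt.comp ((g s).base b) ?_ hk)
      rwa [hkb]
    have h2 : ContDiffAt ℝ ∞ (g s).toFun (k ((g s).base b), w (k ((g s).base b))) := by
      rw [hkb]; exact h.contDiffAt_toFun hz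
    exact ContDiffAt.snd (f := fun z => (g s).toFun (k z, w (k z)))
      (ContDiffAt.comp (g := (g s).toFun) ((g s).base b) h2 h1)
  · filter_upwards [hkl] with q hq
    simp [PointTransformation.toFun, hq]

theorem exists_imageSurface (h : InvCurve B W g) {s : ℝ} {b : Base} {y : Fibre}
    (hz : (s, (b, y)) ∈ W) {S : Base → ℝ} (hS : ContDiffAt ℝ ∞ S b)
    (e : Base ≃L[ℝ] Base) (he : (e : Base →L[ℝ] Base) = fderiv ℝ (g s).base b) :
    ∃ S', IsImageSurface (g s) b S S' := by
  obtain ⟨k, hk, hkl⟩ := exists_local_inverse (h.contDiffAt_base hz) e he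
  refine ⟨fun z => S (k z), hS, ContDiffAt.comp ((g s).base b) ?_ hk, ?_⟩
  · rwa [hkl.self_of_nhds]
  · filter_upwards [hkl] with q hq
    rw [hq]

theorem fderiv_affine (c : ℝ) (l : Base →L[ℝ] ℝ) (b : Base) :
    fderiv ℝ (fun q => c + l (q - b)) b = l :=
  ((l.hasFDerivAt.comp b ((hasFDerivAt_id b).sub_const b)).const_add c).fderiv

theorem contDiffAt_affine (c : ℝ) (l : Base →L[ℝ] ℝ) (b : Base) :
    ContDiffAt ℝ ∞ (fun q => c + l (q - b)) b :=
  contDiffAt_const.add (l.contDiff.contDiffAt.comp b (contDiffAt_id.sub contDiffAt_const))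

/-- Affine functions realise any pair of covectors `l`, `σ` as differentials of `u` and `S₁`.
Invariance of the first surface thus becomes a purely algebraic statement about pairs of covectors.
-/
theorem interface₁ (h : InvCurve B W g) {s : ℝ} {b : Base} {v : ℝ}
    (hz : (s, (b, (B.u_v, v))) ∈ W)
    (e : Base ≃L[ℝ] Base) (he : (e : Base →L[ℝ] Base) = fderiv ℝ (g s).base b)
    {l σ : Base →L[ℝ] ℝ} {lx sx : E3} (hl : ∀ y, l (0, y) = inner ℝ lx y)
    (hσ : ∀ y, σ (0, y) = inner ℝ sx y) (hσ1 : σ (1, 0) ≠ 0) (hsx : inner ℝ (B.Q b.1) sx ≠ 0)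
    (hc : B.d₁ B.u_v * inner ℝ lx sx = -B.H_v * σ (1, 0) - inner ℝ (B.Q b.1) sx) :
    ((g s).toFun (b, (B.u_v, v))).2.1 = B.u_v ∧ ∃ lx' sx' : E3,
      (∀ y, fderiv ℝ (fun q => ((g s).toFun (q, (B.u_v + l (q - b), v))).2.1) b
        (e.symm (0, y)) = inner ℝ lx' y) ∧
      (∀ y, σ (e.symm (0, y)) = inner ℝ sx' y) ∧ σ (e.symm (1, 0)) ≠ 0 ∧
      B.d₁ B.u_v * inner ℝ lx' sx'
        = -B.H_v * σ (e.symm (1, 0)) - inner ℝ (B.Q ((g s).base b).1) sx' := by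
  set w : Base → Fibre := fun q => (B.u_v + l (q - b), v) with hw
  have hwb : w b = (B.u_v, v) := by simp [hw]
  have hws : ContDiffAt ℝ ∞ w b := (contDiffAt_affine _ _ _).prodMk contDiffAt_const
  set S : Base → ℝ := fun q => 0 + σ (q - b) with hS
  obtain ⟨w', hw'⟩ := h.exists_image (w := w) (by rwa [hwb]) hws e he
  obtain ⟨S', hS'⟩ := h.exists_imageSurface hz (contDiffAt_affine 0 σ b) e he
  have hS1 : dt S b = σ (1, 0) := by rw [dt, fderiv_affine]
  have hS2 : grad S b = sx := grad_eq_of_forall fun y => by rw [fderiv_affine, hσ]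
  have hw2 : grad (fun q => (w q).1) b = lx := grad_eq_of_forall fun y => by
    rw [fderiv_affine, hl]
  have hon : B.OnSurface₁ w S b := by
    rw [BVP.onSurface₁_iff, hS1, hS2, hw2]
    exact ⟨by simp [hS], hσ1, hsx, hc, by simp [hw]⟩
  have himg := h.surface₁ s b w w' S S' (by rwa [hwb]) hw' hS' hon
  rw [BVP.onSurface₁_iff] at himg
  obtain ⟨-, h2, -, h4, h5⟩ := himg
  have hφ : DifferentiableAt ℝ (g s).base b := (h.contDiffAt_base hz).differentiableAt (by simp)
  have hSd : ∀ x, fderiv ℝ S' ((g s).base b) x = σ (e.symm x) := fun x => by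
    rw [fderiv_image (hS'.2.1.differentiableAt (by simp)) hφ e he hS'.2.2, fderiv_affine]
  have hwd : ∀ x, fderiv ℝ (fun q => (w' q).1) ((g s).base b) x
      = fderiv ℝ (fun q => ((g s).toFun (q, w q)).2.1) b (e.symm x) := fun x => by
    refine fderiv_image (f' := fun q => (w' q).1) (hw'.2.1.fst.differentiableAt (by simp))
      hφ e he (hw'.2.2.mono fun q hq => ?_) x
    rw [hq]; rfl
  constructor
  · have h6 := hw'.2.2.self_of_nhds
    rw [h6, hwb] at h5
    exact h5
  · refine ⟨grad (fun q => (w' q).1) ((g s).base b), grad S' ((g s).base b), fun y => ?_,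
      fun y => ?_, ?_, ?_⟩
    · rw [inner_grad, hwd]
    · rw [inner_grad, hSd]
    · rw [← hSd]; exact h2
    · rw [← hSd]; exact h4

/-- The derivative of the transformation of `(t, x)`. -/
noncomputable def jac (g : ℝ → PointTransformation) (s : ℝ) (b : Base) : Base →L[ℝ] Base :=
  fderiv ℝ (g s).base b

/-- The transformation of `(t, x)` is close to the identity to first order. -/
def Near (g : ℝ → PointTransformation) (s : ℝ) (b : Base) : Prop :=
  ‖jac g s b - ContinuousLinearMap.id ℝ Base‖ < 1 / 2

theorem jac_eq (h : InvCurve B W g) {s : ℝ} {b : Base} {y : Fibre} (hz : (s, (b, y)) ∈ W) :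
    jac g s b = (fderiv ℝ (fun z : ℝ × Base => (g z.1).base z.2) (s, b)).comp
      (ContinuousLinearMap.inr ℝ ℝ Base) := by
  have h1 := ((h.contDiffAt_base₂ hz).differentiableAt (by simp)).hasFDerivAt.comp b
    (hasFDerivAt_prodMk_right s b)
  exact h1.fderiv

theorem contDiffAt_jac (h : InvCurve B W g) {s : ℝ} {b : Base} {y : Fibre}
    (hz : (s, (b, y)) ∈ W) : ContDiffAt ℝ ∞ (fun z : ℝ × Base => jac g z.1 z.2) (s, b) := by
  have h1 : ContDiffAt ℝ ∞ (fun z => (fderiv ℝ (fun z : ℝ × Base => (g z.1).base z.2) z).comp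
      (ContinuousLinearMap.inr ℝ ℝ Base)) (s, b) :=
    ((h.contDiffAt_base₂ hz).fderiv_right (m := ∞) (by simp)).clm_comp contDiffAt_const
  refine h1.congr_of_eventuallyEq ?_
  have hc : ContinuousAt (fun z : ℝ × Base => ((z.1, (z.2, y)) : ℝ × Point)) (s, b) := by fun_prop
  filter_upwards [hc.eventually (h.isOpen.mem_nhds hz)] with z hz'
  exact h.jac_eq hz'

theorem near_eventually (h : InvCurve B W g) {s : ℝ} {b : Base} {y : Fibre}
    (hz : (s, (b, y)) ∈ W) (hn : Near g s b) : ∀ᶠ z : ℝ × Base in 𝓝 (s, b), Near g z.1 z.2 :=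
  (((h.contDiffAt_jac hz).continuousAt.sub continuousAt_const).norm).eventually (gt_mem_nhds hn)

/-- Boundary values `u = u_v` are preserved. -/
theorem fixes_u_v (h : InvCurve B W g) {s : ℝ} {b : Base} {v : ℝ}
    (hz : (s, (b, (B.u_v, v))) ∈ W) (hn : Near g s b) :
    ((g s).toFun (b, (B.u_v, v))).2.1 = B.u_v := by
  obtain ⟨e, he⟩ := exists_equiv_of_near hn
  have hQ : B.Q b.1 ≠ 0 := B.Q_ne_zero _ (h.subset _ _ hz).1
  have hQQ : inner ℝ (B.Q b.1) (B.Q b.1) ≠ 0 := inner_self_ne_zero.2 hQ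
  have hd : B.d₁ B.u_v ≠ 0 := (B.d₁_pos _ B.u_v_mem).ne'
  let L : ℝ → E3 → (Base →L[ℝ] ℝ) := fun r z =>
    r • ContinuousLinearMap.fst ℝ ℝ E3 + (innerSL ℝ z).comp (ContinuousLinearMap.snd ℝ ℝ E3)
  -- One admissible jet is enough: `S` has time derivative 1 and gradient `Q`, and the multiple of
  -- `Q` taken as gradient of `u` is the solution of the flux condition.
  refine (h.interface₁ hz e he (l := L 0 (((-B.H_v - inner ℝ (B.Q b.1) (B.Q b.1)) /
    (B.d₁ B.u_v * inner ℝ (B.Q b.1) (B.Q b.1))) • B.Q b.1)) (σ := L 1 (B.Q b.1))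
    (lx := ((-B.H_v - inner ℝ (B.Q b.1) (B.Q b.1)) /
      (B.d₁ B.u_v * inner ℝ (B.Q b.1) (B.Q b.1))) • B.Q b.1)
    (fun y => by simp [L, inner_smul_left]) (fun y => by simp [L]) (by simp [L]) hQQ ?_).1
  have hσ : L 1 (B.Q b.1) (1, 0) = 1 := by simp [L]
  rw [inner_smul_left, conj_trivial, hσ]
  field_simp

theorem fixes_u_v_eventually (h : InvCurve B W g) {s : ℝ} {b : Base} {v : ℝ}
    (hz : (s, (b, (B.u_v, v))) ∈ W) (hn : Near g s b) :
    ∀ᶠ z : Base × ℝ in 𝓝 (b, v), ((g s).toFun (z.1, (B.u_v, z.2))).2.1 = B.u_v := by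
  have hc : ContinuousAt (fun z : Base × ℝ => ((s, (z.1, (B.u_v, z.2))) : ℝ × Point)) (b, v) := by
    fun_prop
  have hc' : ContinuousAt (fun z : Base × ℝ => ((s, z.1) : ℝ × Base)) (b, v) := by fun_prop
  filter_upwards [hc.eventually (h.isOpen.mem_nhds hz),
    hc'.eventually (h.near_eventually hz hn)] with z hz1 hz2
  exact h.fixes_u_v hz1 hz2

/-- The derivative of the transformed `u` with respect to `(t, x, u, v)`. -/
noncomputable def dU (g : ℝ → PointTransformation) (s : ℝ) (p : Point) : Point →L[ℝ] ℝ :=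
  fderiv ℝ (fun p => ((g s).toFun p).2.1) p

/-- The derivative of the transformed `v` with respect to `(t, x, u, v)`. -/
noncomputable def dV (g : ℝ → PointTransformation) (s : ℝ) (p : Point) : Point →L[ℝ] ℝ :=
  fderiv ℝ (fun p => ((g s).toFun p).2.2) p

theorem hasFDerivAt_U (h : InvCurve B W g) {s : ℝ} {p : Point} (hz : (s, p) ∈ W) :
    HasFDerivAt (fun p => ((g s).toFun p).2.1) (dU g s p) p :=
  ((h.contDiffAt_toFun hz).snd.fst.differentiableAt (by simp)).hasFDerivAt

theorem hasFDerivAt_V (h : InvCurve B W g) {s : ℝ} {p : Point} (hz : (s, p) ∈ W) :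
    HasFDerivAt (fun p => ((g s).toFun p).2.2) (dV g s p) p :=
  ((h.contDiffAt_toFun hz).snd.snd.differentiableAt (by simp)).hasFDerivAt

/-- The transformed `u` is constant on the hypersurface `u = u_v`, so only its derivative across
that hypersurface can survive. -/
theorem dU_tangent (h : InvCurve B W g) {s : ℝ} {b : Base} {v : ℝ}
    (hz : (s, (b, (B.u_v, v))) ∈ W) (hn : Near g s b) (x : Base) (r : ℝ) :
    dU g s (b, (B.u_v, v)) (x, (0, r)) = 0 := by
  have hj : HasFDerivAt (fun z : Base × ℝ => ((z.1, (B.u_v, z.2)) : Point))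
      ((ContinuousLinearMap.fst ℝ Base ℝ).prod ((0 : Base × ℝ →L[ℝ] ℝ).prod
        (ContinuousLinearMap.snd ℝ Base ℝ))) (b, v) :=
    hasFDerivAt_fst.prodMk ((hasFDerivAt_const _ _).prodMk hasFDerivAt_snd)
  have h1 := HasFDerivAt.comp (b, v) (h.hasFDerivAt_U hz) hj
  have h2 : HasFDerivAt (fun z : Base × ℝ => ((g s).toFun (z.1, (B.u_v, z.2))).2.1)
      (0 : Base × ℝ →L[ℝ] ℝ) (b, v) :=
    (hasFDerivAt_const B.u_v (b, v)).congr_of_eventuallyEq (h.fixes_u_v_eventually hz hn)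
  have h3 := congrArg (fun L => L (x, r)) (h1.unique h2)
  simpa using h3

/-- The transformation of `(t, x)` is block diagonal and conformal. -/
theorem jac_block (h : InvCurve B W g) {s : ℝ} {b : Base} {v : ℝ}
    (hz : (s, (b, (B.u_v, v))) ∈ W) (hn : Near g s b)
    (hν : dU g s (b, (B.u_v, v)) (0, (1, 0)) ≠ 0) :
    (jac g s b (1, 0)).2 = 0 ∧ (∀ y, (jac g s b (0, y)).1 = 0) ∧
      (jac g s b (1, 0)).1 • B.Q ((g s).base b).1 = (jac g s b (0, B.Q b.1)).2 ∧
      0 < dU g s (b, (B.u_v, v)) (0, (1, 0)) * (jac g s b (1, 0)).1 ∧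
      ∀ y z, inner ℝ (jac g s b (0, y)).2 (jac g s b (0, z)).2
        = dU g s (b, (B.u_v, v)) (0, (1, 0)) * (jac g s b (1, 0)).1 * inner ℝ y z := by
  obtain ⟨e, he⟩ := exists_equiv_of_near hn
  have hn' := hn
  unfold Near at hn'
  rw [← he] at hn' ⊢
  refine conformal_of_interface_inverse e (B.d₁_pos _ B.u_v_mem) B.H_v_pos hν
    (B.Q_ne_zero _ (h.subset _ _ hz).1) hn' ?_
  intro l σ lx sx hl hσ hσ1 hsx hc
  obtain ⟨-, lx', sx', h1, h2, h3, h4⟩ := h.interface₁ hz e he hl hσ hσ1 hsx hc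
  refine ⟨lx', sx', fun y => ?_, h2, h3, h4⟩
  rw [← h1]
  have hj : HasFDerivAt (fun q : Base => ((q, (B.u_v + l (q - b), v)) : Point))
      ((ContinuousLinearMap.id ℝ Base).prod (l.prod 0)) b :=
    (hasFDerivAt_id b).prodMk (((l.hasFDerivAt.comp b
      ((hasFDerivAt_id b).sub_const b)).const_add B.u_v).prodMk (hasFDerivAt_const v b))
  have hU : HasFDerivAt (fun p => ((g s).toFun p).2.1) (dU g s (b, (B.u_v, v)))
      (b, (B.u_v + l (b - b), v)) := by
    rw [sub_self, map_zero, add_zero]; exact h.hasFDerivAt_U hz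
  have h5 := HasFDerivAt.comp b hU hj
  have h6 : fderiv ℝ (fun q => ((g s).toFun (q, (B.u_v + l (q - b), v))).2.1) b = _ := h5.fderiv
  rw [h6, ContinuousLinearMap.comp_apply]
  set x := e.symm (0, y)
  -- The direction splits into a part tangent to `u = u_v`, which contributes nothing, and a
  -- multiple of the `u`-direction. Hence the covector of `u` is multiplied by `ν = ∂U/∂u`.
  have h7 : ((ContinuousLinearMap.id ℝ Base).prod (l.prod (0 : Base →L[ℝ] ℝ))) x
      = (x, ((0 : ℝ), (0 : ℝ))) + l x • ((0 : Base), ((1 : ℝ), (0 : ℝ))) := by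
    refine Prod.ext ?_ (Prod.ext ?_ ?_) <;> simp
  rw [h7, map_add, map_smul, h.dU_tangent hz hn, zero_add, smul_eq_mul, mul_comm]

end InvCurve

/-! ### Rigidity of conformal maps with constant factor -/

theorem fderiv_eq_of_second_eq_zero {E F : Type*} [NormedAddCommGroup E] [NormedSpace ℝ E]
    [NormedAddCommGroup F] [NormedSpace ℝ F] {f : E → F} {O : Set E} (hO : IsOpen O)
    (hOc : IsPreconnected O) (hf : ∀ x ∈ O, ContDiffAt ℝ ∞ f x)
    (h : ∀ x ∈ O, fderiv ℝ (fderiv ℝ f) x = 0) {x y : E} (hx : x ∈ O) (hy : y ∈ O) :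
    fderiv ℝ f x = fderiv ℝ f y :=
  hO.is_const_of_fderiv_eq_zero hOc (fun z hz =>
    (((hf z hz).fderiv_right (m := ∞) (by simp)).differentiableAt (by simp)).differentiableWithinAt)
    h hx hy

theorem eq_affine_of_fderiv_const {E F : Type*} [NormedAddCommGroup E] [NormedSpace ℝ E]
    [NormedAddCommGroup F] [NormedSpace ℝ F] {f : E → F} {O : Set E} (hO : IsOpen O)
    (hOc : IsPreconnected O) {L : E →L[ℝ] F} (hf : ∀ x ∈ O, HasFDerivAt f L x)
    {x y : E} (hx : x ∈ O) (hy : y ∈ O) : f y = f x + L (y - x) := by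
  have h1 : ∀ z ∈ O, HasFDerivAt (fun z => f z - L z) (L - L) z := fun z hz =>
    (hf z hz).sub L.hasFDerivAt
  have h2 := hO.is_const_of_fderiv_eq_zero (f := fun z => f z - L z) hOc
    (fun z hz => (h1 z hz).differentiableAt.differentiableWithinAt)
    (fun z hz => by rw [(h1 z hz).fderiv]; exact sub_self L) hy hx
  rw [map_sub]
  rw [sub_eq_iff_eq_add] at h2
  rw [h2]; abel

/-- Koszul's argument. Differentiating the conformality relation with constant `μ`, the trilinear
form `⟨D(a, y), DX z⟩` is antisymmetric in `y, z`; it is symmetric in `a, y` as a second derivative.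
A form with both symmetries vanishes. -/
theorem fderiv_const_of_conformal {X : E3 → E3} {O : Set E3} (hO : IsOpen O)
    (hOc : IsPreconnected O) {μ : ℝ} (hμ : 0 < μ)
    (hX : ∀ x ∈ O, ContDiffAt ℝ ∞ X x)
    (h : ∀ x ∈ O, ∀ y z, inner ℝ (fderiv ℝ X x y) (fderiv ℝ X x z) = μ * inner ℝ y z)
    {x x' : E3} (hx : x ∈ O) (hx' : x' ∈ O) : fderiv ℝ X x = fderiv ℝ X x' := by
  refine fderiv_eq_of_second_eq_zero hO hOc hX (fun x hx => ?_) hx hx'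
  have hd : HasFDerivAt (fderiv ℝ X) (fderiv ℝ (fderiv ℝ X) x) x :=
    (((hX x hx).fderiv_right (m := ∞) (by simp)).differentiableAt (by simp)).hasFDerivAt
  set D := fderiv ℝ (fderiv ℝ X) x with hD
  have hsymm : ∀ a b, D a b = D b a := by
    have : IsSymmSndFDerivAt ℝ X x := (hX x hx).isSymmSndFDerivAt (by
      rw [minSmoothness_of_isRCLikeNormedField]; exact WithTop.coe_le_coe.2 (le_top : (2 : ℕ∞) ≤ ⊤))
    exact this
  have hanti : ∀ a y z, inner ℝ (D a y) (fderiv ℝ X x z) = -inner ℝ (D a z) (fderiv ℝ X x y) := by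
    intro a y z
    have h1 : HasFDerivAt (fun x => inner ℝ (fderiv ℝ X x y) (fderiv ℝ X x z)) _ x :=
      (hd.clm_apply (hasFDerivAt_const y x)).inner ℝ (hd.clm_apply (hasFDerivAt_const z x))
    have h2 : HasFDerivAt (fun x => inner ℝ (fderiv ℝ X x y) (fderiv ℝ X x z))
        (0 : E3 →L[ℝ] ℝ) x := by
      refine (hasFDerivAt_const (μ * inner ℝ y z) x).congr_of_eventuallyEq ?_
      filter_upwards [hO.mem_nhds hx] with q hq
      exact h q hq y z
    have h3 := congrArg (fun L => L a) (h1.unique h2)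
    simp at h3
    rw [real_inner_comm _ (D a z)]
    linarith
  have hzero : ∀ a y z, inner ℝ (D a y) (fderiv ℝ X x z) = 0 := by
    intro a y z
    have e1 := hanti a y z
    have e2 := hanti z a y
    have e3 := hanti y z a
    rw [hsymm z a] at e2
    rw [hsymm y z, hsymm y a] at e3
    linarith
  refine ContinuousLinearMap.ext fun a => ContinuousLinearMap.ext fun y => ?_
  obtain ⟨z, hz⟩ := conformal_surjective hμ (h x hx) (D a y)
  have := hzero a y z
  rw [hz] at this
  exact inner_self_eq_zero.1 this

/-- A block diagonal transformation of `(t, x)` which is conformal in `x` and carries the direction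
of a nowhere vanishing `Q(t)` to itself has a constant space derivative. -/
theorem space_derivative_const {φ : Base → Base} {t₀ : ℝ} {x₀ : E3} {r : ℝ} {Q : ℝ → E3}
    {μ : Base → ℝ} (hr : 0 < r)
    (hφ : ∀ b ∈ Metric.ball t₀ r ×ˢ Metric.ball x₀ r, ContDiffAt ℝ ∞ φ b)
    (h1 : ∀ b ∈ Metric.ball t₀ r ×ˢ Metric.ball x₀ r, (fderiv ℝ φ b (1, 0)).2 = 0)
    (h2 : ∀ b ∈ Metric.ball t₀ r ×ˢ Metric.ball x₀ r, ∀ y, (fderiv ℝ φ b (0, y)).1 = 0)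
    (hQ : ∀ b ∈ Metric.ball t₀ r ×ˢ Metric.ball x₀ r, Q b.1 ≠ 0)
    (h3 : ∀ b ∈ Metric.ball t₀ r ×ˢ Metric.ball x₀ r,
      (fderiv ℝ φ b (1, 0)).1 • Q (φ b).1 = (fderiv ℝ φ b (0, Q b.1)).2)
    (hμ : ∀ b ∈ Metric.ball t₀ r ×ˢ Metric.ball x₀ r, 0 < μ b)
    (h4 : ∀ b ∈ Metric.ball t₀ r ×ˢ Metric.ball x₀ r, ∀ y z,
      inner ℝ (fderiv ℝ φ b (0, y)).2 (fderiv ℝ φ b (0, z)).2 = μ b * inner ℝ y z) :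
    ∀ b ∈ Metric.ball t₀ r ×ˢ Metric.ball x₀ r,
      (∀ y, fderiv ℝ φ b (0, y) = fderiv ℝ φ (t₀, x₀) (0, y)) ∧ μ b = μ (t₀, x₀) := by
  have ht₀ : t₀ ∈ Metric.ball t₀ r := Metric.mem_ball_self hr
  have hx₀ : x₀ ∈ Metric.ball x₀ r := Metric.mem_ball_self hr
  have hdφ : ∀ b ∈ Metric.ball t₀ r ×ˢ Metric.ball x₀ r, HasFDerivAt φ (fderiv ℝ φ b) b :=
    fun b hb => ((hφ b hb).differentiableAt (by simp)).hasFDerivAt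
  have hspace : ∀ t ∈ Metric.ball t₀ r, ∀ x ∈ Metric.ball x₀ r,
      HasFDerivAt (fun x => φ (t, x))
        ((fderiv ℝ φ (t, x)).comp (ContinuousLinearMap.inr ℝ ℝ E3)) x := fun t ht x hx =>
    (hdφ (t, x) ⟨ht, hx⟩).comp x (hasFDerivAt_prodMk_right t x)
  have htime : ∀ t ∈ Metric.ball t₀ r, ∀ x ∈ Metric.ball x₀ r,
      HasFDerivAt (fun t => φ (t, x))
        ((fderiv ℝ φ (t, x)).comp (ContinuousLinearMap.inl ℝ ℝ E3)) t := fun t ht x hx =>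
    (hdφ (t, x) ⟨ht, hx⟩).comp t (hasFDerivAt_prodMk_left t x)
  have hT : ∀ t ∈ Metric.ball t₀ r, ∀ x ∈ Metric.ball x₀ r, (φ (t, x)).1 = (φ (t, x₀)).1 := by
    intro t ht x hx
    refine Metric.isOpen_ball.is_const_of_fderiv_eq_zero (f := fun x => (φ (t, x)).1)
      (convex_ball x₀ r).isPreconnected (fun z hz =>
        (hspace t ht z hz).fst.differentiableAt.differentiableWithinAt) (fun z hz => ?_) hx hx₀
    rw [(hspace t ht z hz).fst.fderiv]
    exact ContinuousLinearMap.ext fun y => h2 (t, z) ⟨ht, hz⟩ y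
  have hX : ∀ t ∈ Metric.ball t₀ r, ∀ x ∈ Metric.ball x₀ r, (φ (t, x)).2 = (φ (t₀, x)).2 := by
    intro t ht x hx
    refine Metric.isOpen_ball.is_const_of_fderiv_eq_zero (f := fun t => (φ (t, x)).2)
      (convex_ball t₀ r).isPreconnected (fun z hz =>
        (htime z hz x hx).snd.differentiableAt.differentiableWithinAt) (fun z hz => ?_) ht ht₀
    rw [(htime z hz x hx).snd.fderiv]
    refine ContinuousLinearMap.ext fun y => ?_
    have : ((y, 0) : Base) = y • (1, 0) := by ext1 <;> simp
    change (fderiv ℝ φ (z, x) (y, 0)).2 = 0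
    rw [this, map_smul, Prod.smul_snd, h1 (z, x) ⟨hz, hx⟩, smul_zero]
  have hm : ∀ t ∈ Metric.ball t₀ r, ∀ x ∈ Metric.ball x₀ r,
      (fderiv ℝ φ (t, x) (1, 0)).1 = (fderiv ℝ φ (t, x₀) (1, 0)).1 := by
    intro t ht x hx
    have e1 := (htime t ht x hx).fst
    have e2 := (htime t ht x₀ hx₀).fst
    have e3 := e1.congr_of_eventuallyEq (f₁ := fun t => (φ (t, x₀)).1) (by
      filter_upwards [Metric.isOpen_ball.mem_nhds ht] with t' ht'
      exact (hT t' ht' x hx).symm)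
    exact congrArg (fun L => L 1) (e3.unique e2)
  have hM : ∀ t ∈ Metric.ball t₀ r, ∀ x ∈ Metric.ball x₀ r, ∀ y,
      (fderiv ℝ φ (t, x) (0, y)).2 = (fderiv ℝ φ (t₀, x) (0, y)).2 := by
    intro t ht x hx y
    have e1 := (hspace t ht x hx).snd
    have e2 := (hspace t₀ ht₀ x hx).snd
    have e3 := e1.congr_of_eventuallyEq (f₁ := fun x => (φ (t₀, x)).2) (by
      filter_upwards [Metric.isOpen_ball.mem_nhds hx] with x' hx'
      exact (hX t ht x' hx').symm)
    exact congrArg (fun L => L y) (e3.unique e2)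
  -- The factor is measured on `Q`: `μ |Q|²` is the squared length of the image of `Q`, which by
  -- `h3` is a vector depending on `t` only.
  have hμt : ∀ t ∈ Metric.ball t₀ r, ∀ x ∈ Metric.ball x₀ r, μ (t, x) = μ (t, x₀) := by
    intro t ht x hx
    have hq : inner ℝ (Q t) (Q t) ≠ 0 := inner_self_ne_zero.2 (hQ (t, x) ⟨ht, hx⟩)
    refine mul_right_cancel₀ hq ?_
    rw [← h4 (t, x) ⟨ht, hx⟩, ← h4 (t, x₀) ⟨ht, hx₀⟩, ← h3 (t, x) ⟨ht, hx⟩,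
      ← h3 (t, x₀) ⟨ht, hx₀⟩, hm t ht x hx, hT t ht x hx]
  -- For fixed `x` the space derivative is the same at all times, hence so is the factor by which it
  -- stretches the nonzero vector `Q t`.
  have hμx : ∀ t ∈ Metric.ball t₀ r, ∀ x ∈ Metric.ball x₀ r, μ (t, x) = μ (t₀, x) := by
    intro t ht x hx
    have hq : inner ℝ (Q t) (Q t) ≠ 0 := inner_self_ne_zero.2 (hQ (t, x) ⟨ht, hx⟩)
    refine mul_right_cancel₀ hq ?_
    rw [← h4 (t, x) ⟨ht, hx⟩, ← h4 (t₀, x) ⟨ht₀, hx⟩, hM t ht x hx]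
  have hder : ∀ x ∈ Metric.ball x₀ r, ∀ y,
      fderiv ℝ (fun x => (φ (t₀, x)).2) x y = (fderiv ℝ φ (t₀, x) (0, y)).2 := fun x hx y => by
    rw [(hspace t₀ ht₀ x hx).snd.fderiv]; rfl
  rintro ⟨t, x⟩ ⟨ht, hx⟩
  refine ⟨fun y => Prod.ext ?_ ?_, ?_⟩
  · rw [h2 (t, x) ⟨ht, hx⟩, h2 (t₀, x₀) ⟨ht₀, hx₀⟩]
  · rw [hM t ht x hx, ← hder x hx, ← hder x₀ hx₀]
    refine congrArg (fun L => L y) (fderiv_const_of_conformal Metric.isOpen_ball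
      (convex_ball x₀ r).isPreconnected (hμ (t₀, x₀) ⟨ht₀, hx₀⟩) (fun z hz => ?_)
      (fun z hz y y' => ?_) hx hx₀)
    · exact ((hφ (t₀, z) ⟨ht₀, hz⟩).comp z (contDiffAt_const.prodMk contDiffAt_id)).snd
    · rw [hder z hz, hder z hz, h4 (t₀, z) ⟨ht₀, hz⟩, hμt t₀ ht₀ z hz]
  · rw [hμx t ht x hx, hμt t₀ ht₀ x hx]

/-! ### The coefficients of the diffusion operator on a composite function -/

theorem divFlux_expand {d : ℝ → ℝ} {f : Base → ℝ} {b : Base} (hf : ContDiffAt ℝ ∞ f b)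
    (hd : DifferentiableAt ℝ d (f b)) :
    divFlux d f b = ∑ a : Fin 3, (deriv d (f b) * dx a f b ^ 2 + d (f b) * dx a (dx a f) b) := by
  unfold divFlux
  refine Finset.sum_congr rfl fun a _ => ?_
  have h1 : HasFDerivAt (fun q => d (f q)) (deriv d (f b) • fderiv ℝ f b) b :=
    hd.hasDerivAt.comp_hasFDerivAt b (hf.differentiableAt (by simp)).hasFDerivAt
  have h2 : HasFDerivAt (dx a f) (fderiv ℝ (dx a f) b) b :=
    ((contDiffAt_dx hf a).differentiableAt (by simp)).hasFDerivAt
  have h3 := (h1.mul h2).fderiv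
  rw [dx]
  change fderiv ℝ ((fun q => d (f q)) * dx a f) b _ = _
  rw [h3]
  simp only [add_apply, smul_apply, smul_eq_mul, dx]
  ring

/-- A quadratic function of `t` and `x₁`. -/
noncomputable def quad (b : Base) (c l p m : ℝ) (q : Base) : ℝ :=
  c + l * (q.1 - b.1) + p * (q.2 0 - b.2 0) + m / 2 * (q.2 0 - b.2 0) ^ 2

/-- The coordinate `x₁` on `(t, x)`. -/
noncomputable def coordOne : Base →L[ℝ] ℝ :=
  (EuclideanSpace.proj (0 : Fin 3) : E3 →L[ℝ] ℝ).comp (ContinuousLinearMap.snd ℝ ℝ E3)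

theorem hasFDerivAt_quad (b : Base) (c l p m : ℝ) (q : Base) :
    HasFDerivAt (quad b c l p m) (l • ContinuousLinearMap.fst ℝ ℝ E3
      + (p + m * (q.2 0 - b.2 0)) • coordOne) q := by
  have h1 : HasFDerivAt (fun q : Base => q.1 - b.1) (ContinuousLinearMap.fst ℝ ℝ E3) q :=
    (ContinuousLinearMap.fst ℝ ℝ E3).hasFDerivAt.sub_const _
  have h2 : HasFDerivAt (fun q : Base => q.2 0 - b.2 0) coordOne q :=
    coordOne.hasFDerivAt.sub_const _
  have h3 := (((h1.const_mul l).const_add c).add (h2.const_mul p)).add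
    ((h2.pow 2).const_mul (m / 2))
  refine h3.congr_fderiv (ContinuousLinearMap.ext fun v => ?_)
  simp
  ring

theorem contDiff_quad (b : Base) (c l p m : ℝ) : ContDiff ℝ ∞ (quad b c l p m) := by
  have h1 : ContDiff ℝ ∞ (fun q : Base => q.1 - b.1) := contDiff_fst.sub contDiff_const
  have h2 : ContDiff ℝ ∞ (fun q : Base => q.2 0 - b.2 0) := coordOne.contDiff.sub contDiff_const
  exact ((contDiff_const.add (contDiff_const.mul h1)).add (contDiff_const.mul h2)).add
    (contDiff_const.mul (h2.pow 2))

theorem quad_self (b : Base) (c l p m : ℝ) : quad b c l p m b = c := by simp [quad]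

/-- `1` in the direction of `x₁`, `0` in the directions of `x₂`, `x₃`. -/
def dir (a : Fin 3) : ℝ := if a = 0 then 1 else 0

theorem fderiv_quad_space (b : Base) (c l p m : ℝ) (q : Base) (a : Fin 3) :
    fderiv ℝ (quad b c l p m) q (0, EuclideanSpace.single a 1)
      = (p + m * (q.2 0 - b.2 0)) * dir a := by
  rw [(hasFDerivAt_quad b c l p m q).fderiv]
  simp [coordOne, dir, eq_comm]

theorem dt_quad (b : Base) (c l p m : ℝ) : dt (quad b c l p m) b = l := by
  rw [dt, (hasFDerivAt_quad b c l p m b).fderiv]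
  simp [coordOne]

theorem dx_quad (b : Base) (c l p m : ℝ) (a : Fin 3) :
    dx a (quad b c l p m) = fun q => (p + m * (q.2 0 - b.2 0)) * dir a :=
  funext fun q => fderiv_quad_space b c l p m q a

theorem hasFDerivAt_slope (b : Base) (p m : ℝ) (a : Fin 3) (q : Base) :
    HasFDerivAt (fun q : Base => (p + m * (q.2 0 - b.2 0)) * dir a)
      ((dir a * m) • coordOne) q := by
  have h2 : HasFDerivAt (fun q : Base => q.2 0 - b.2 0) coordOne q :=
    coordOne.hasFDerivAt.sub_const _
  refine (((h2.const_mul m).const_add p).mul_const (dir a)).congr_fderiv ?_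
  rw [smul_smul]

theorem coordOne_single (a : Fin 3) : coordOne (0, EuclideanSpace.single a 1) = dir a := by
  simp [coordOne, dir, eq_comm]

theorem dir_mul_dir (a : Fin 3) : dir a * dir a = dir a := by
  unfold dir; split_ifs <;> simp

/-- Setting `l` equal to this value makes the quadratic satisfy the diffusion equation at the single
point `b`, while the slope `p` and the curvature `m` remain free. -/
theorem divFlux_quad (b : Base) (c l p m : ℝ) {d : ℝ → ℝ} (hd : DifferentiableAt ℝ d c) :
    divFlux d (quad b c l p m) b = d c * m + deriv d c * p ^ 2 := by
  rw [divFlux_expand (contDiff_quad b c l p m).contDiffAt (by rwa [quad_self]), quad_self]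
  simp only [dx_quad]
  have : ∀ a, dx a (fun q : Base => (p + m * (q.2 0 - b.2 0)) * dir a) b = m * dir a := by
    intro a
    rw [dx, (hasFDerivAt_slope b p m a b).fderiv, smul_apply, coordOne_single,
      smul_eq_mul, mul_comm (dir a) m, mul_assoc, dir_mul_dir]
  rw [Fin.sum_univ_three, this, this, this]
  simp only [dir]
  simp
  ring

/-! ### Second-order jets of composite test functions. -/

/-- The second derivative of a function as a bilinear form. -/
noncomputable def hess (F : Point → ℝ) (p x y : Point) : ℝ := fderiv ℝ (fderiv ℝ F) p x y

/-- The unit vector of the direction of `x_a` in the space of all variables. -/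
noncomputable def spaceDir (a : Fin 3) : Point := ((0, EuclideanSpace.single a 1), (0, 0))

/-- The unit vector of the direction of `u`. -/
def uDir : Point := ((0, 0), (1, 0))

/-- The unit vector of the direction of `v`. -/
def vDir : Point := ((0, 0), (0, 1))

/-- The test functions. -/
noncomputable def test (p : Point) (l₁ l₂ p₁ p₂ m₁ m₂ : ℝ) (q : Base) : Fibre :=
  (quad p.1 p.2.1 l₁ p₁ m₁ q, quad p.1 p.2.2 l₂ p₂ m₂ q)

theorem contDiff_test (p : Point) (l₁ l₂ p₁ p₂ m₁ m₂ : ℝ) :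
    ContDiff ℝ ∞ (test p l₁ l₂ p₁ p₂ m₁ m₂) :=
  (contDiff_quad _ _ _ _ _).prodMk (contDiff_quad _ _ _ _ _)

theorem test_self (p : Point) (l₁ l₂ p₁ p₂ m₁ m₂ : ℝ) :
    test p l₁ l₂ p₁ p₂ m₁ m₂ p.1 = p.2 := by
  simp [test, quad_self]

theorem fderiv_comp_test {F : Point → ℝ} {p : Point} {l₁ l₂ p₁ p₂ m₁ m₂ : ℝ} {q : Base}
    (hF : DifferentiableAt ℝ F (q, test p l₁ l₂ p₁ p₂ m₁ m₂ q)) (x : Base) :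
    fderiv ℝ (fun q => F (q, test p l₁ l₂ p₁ p₂ m₁ m₂ q)) q x
      = fderiv ℝ F (q, test p l₁ l₂ p₁ p₂ m₁ m₂ q)
        (x, (fderiv ℝ (quad p.1 p.2.1 l₁ p₁ m₁) q x, fderiv ℝ (quad p.1 p.2.2 l₂ p₂ m₂) q x)) := by
  have h1 : HasFDerivAt (fun q => (q, test p l₁ l₂ p₁ p₂ m₁ m₂ q)) _ q :=
    (hasFDerivAt_id q).prodMk
      (((contDiff_quad p.1 p.2.1 l₁ p₁ m₁).differentiable (by simp) q).hasFDerivAt.prodMk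
        ((contDiff_quad p.1 p.2.2 l₂ p₂ m₂).differentiable (by simp) q).hasFDerivAt)
  have h2 := (hF.hasFDerivAt.comp q h1).fderiv
  change fderiv ℝ (F ∘ fun q => (q, test p l₁ l₂ p₁ p₂ m₁ m₂ q)) q x = _
  rw [h2]; rfl

theorem dt_comp_test {F : Point → ℝ} {p : Point} (hF : ContDiffAt ℝ ∞ F p)
    (l₁ l₂ p₁ p₂ m₁ m₂ : ℝ) :
    dt (fun q => F (q, test p l₁ l₂ p₁ p₂ m₁ m₂ q)) p.1
      = fderiv ℝ F p ((1, 0), (0, 0)) + l₁ * fderiv ℝ F p uDir + l₂ * fderiv ℝ F p vDir := by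
  have hp : (p.1, test p l₁ l₂ p₁ p₂ m₁ m₂ p.1) = p := by rw [test_self]
  have := dt_quad p.1
  unfold dt at this ⊢
  rw [fderiv_comp_test (by rw [hp]; exact hF.differentiableAt (by simp)), hp, this, this]
  have h : (((1, 0), (l₁, l₂)) : Point) = ((1, 0), (0, 0)) + l₁ • uDir + l₂ • vDir := by
    simp [uDir, vDir]
  rw [h]; simp

theorem dx_comp_test {F : Point → ℝ} {p : Point} (hF : ContDiffAt ℝ ∞ F p)
    (l₁ l₂ p₁ p₂ m₁ m₂ : ℝ) (a : Fin 3) :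
    ∀ᶠ q in 𝓝 p.1, dx a (fun q => F (q, test p l₁ l₂ p₁ p₂ m₁ m₂ q)) q
      = fderiv ℝ F (q, test p l₁ l₂ p₁ p₂ m₁ m₂ q) (spaceDir a
        + ((p₁ + m₁ * (q.2 0 - p.1.2 0)) * dir a) • uDir
        + ((p₂ + m₂ * (q.2 0 - p.1.2 0)) * dir a) • vDir) := by
  have hp : (p.1, test p l₁ l₂ p₁ p₂ m₁ m₂ p.1) = p := by rw [test_self]
  have hc : ContinuousAt (fun q => (q, test p l₁ l₂ p₁ p₂ m₁ m₂ q)) p.1 :=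
    (continuous_id.prodMk (contDiff_test p l₁ l₂ p₁ p₂ m₁ m₂).continuous).continuousAt
  have hev : ∀ᶠ z in 𝓝 (p.1, test p l₁ l₂ p₁ p₂ m₁ m₂ p.1), ContDiffAt ℝ 1 F z := by
    rw [hp]; exact (hF.of_le (m := 1) (by simp)).eventually (by simp)
  filter_upwards [hc.eventually hev] with q hq
  rw [dx, fderiv_comp_test (hq.differentiableAt (by simp)), fderiv_quad_space, fderiv_quad_space]
  congr 1
  simp [spaceDir, uDir, vDir]

/-- The direction in which `F` is differentiated varies with the point, at rates `m₁` and `m₂` along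
`u` and `v`; this produces the two terms next to the Hessian. -/
theorem dx_dx_comp_test {F : Point → ℝ} {p : Point} (hF : ContDiffAt ℝ ∞ F p)
    (l₁ l₂ p₁ p₂ m₁ m₂ : ℝ) (a : Fin 3) :
    dx a (dx a (fun q => F (q, test p l₁ l₂ p₁ p₂ m₁ m₂ q))) p.1
      = hess F p (spaceDir a + (p₁ * dir a) • uDir + (p₂ * dir a) • vDir)
          (spaceDir a + (p₁ * dir a) • uDir + (p₂ * dir a) • vDir)
        + (m₁ * dir a) * fderiv ℝ F p uDir + (m₂ * dir a) * fderiv ℝ F p vDir := by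
  have hp : (p.1, test p l₁ l₂ p₁ p₂ m₁ m₂ p.1) = p := by rw [test_self]
  rw [dx_congr (dx_comp_test hF l₁ l₂ p₁ p₂ m₁ m₂ a)]
  have h1 : HasFDerivAt (fun q => (q, test p l₁ l₂ p₁ p₂ m₁ m₂ q)) _ p.1 :=
    (hasFDerivAt_id p.1).prodMk
      (((contDiff_quad p.1 p.2.1 l₁ p₁ m₁).differentiable (by simp) p.1).hasFDerivAt.prodMk
        ((contDiff_quad p.1 p.2.2 l₂ p₂ m₂).differentiable (by simp) p.1).hasFDerivAt)
  have h2 : HasFDerivAt (fderiv ℝ F) (fderiv ℝ (fderiv ℝ F) p)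
      (p.1, test p l₁ l₂ p₁ p₂ m₁ m₂ p.1) := by
    rw [hp]
    exact ((hF.fderiv_right (m := ∞) (by simp)).differentiableAt (by simp)).hasFDerivAt
  have h3 := h2.comp p.1 h1
  have h4 : HasFDerivAt (fun q : Base => spaceDir a
        + ((p₁ + m₁ * (q.2 0 - p.1.2 0)) * dir a) • uDir
        + ((p₂ + m₂ * (q.2 0 - p.1.2 0)) * dir a) • vDir) _ p.1 :=
    (((hasFDerivAt_slope p.1 p₁ m₁ a p.1).smul_const uDir).const_add (spaceDir a)).add
      ((hasFDerivAt_slope p.1 p₂ m₂ a p.1).smul_const vDir)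
  have h5 := (h3.clm_apply h4).fderiv
  rw [dx]
  simp only [Function.comp_def] at h5
  rw [h5]
  have e1 : ((0, EuclideanSpace.single a 1), (p₁ * dir a, p₂ * dir a))
      = spaceDir a + (p₁ * dir a) • uDir + (p₂ * dir a) • vDir := by
    simp [spaceDir, uDir, vDir]
  simp only [add_apply, ContinuousLinearMap.comp_apply,
    ContinuousLinearMap.flip_apply, ContinuousLinearMap.prod_apply, fderiv_quad_space,
    ContinuousLinearMap.smulRight_apply, smul_apply, coordOne_single,
    sub_self, mul_zero, add_zero, hp, smul_eq_mul, map_add, map_smul, hess]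
  have e2 : ((ContinuousLinearMap.id ℝ Base) (0, EuclideanSpace.single a (1 : ℝ)))
      = (0, EuclideanSpace.single a 1) := rfl
  rw [e2, e1]
  simp only [map_add, map_smul, smul_eq_mul, add_apply,
    smul_apply]
  have e3 : ∀ m, dir a * m * dir a = m * dir a := fun m => by
    rw [mul_comm (dir a), mul_assoc, dir_mul_dir]
  rw [e3, e3]
  ring

/-- The relations between the derivatives of `F` obtained by comparison of coefficients in the
equation `ν ∂f/∂t = ∇ · (d(f) ∇f)` for `f = F(t, x, u, v)`. -/
structure CoefficientRelations (F : Point → ℝ) (p : Point) (d d₁ d₂ : ℝ → ℝ) (ν : ℝ) : Prop where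
  u : ν * (fderiv ℝ F p uDir * d₁ p.2.1) = d (F p) * fderiv ℝ F p uDir
  v : ν * (fderiv ℝ F p vDir * d₂ p.2.2) = d (F p) * fderiv ℝ F p vDir
  uu : ν * (fderiv ℝ F p uDir * deriv d₁ p.2.1)
      = deriv d (F p) * fderiv ℝ F p uDir ^ 2 + d (F p) * hess F p uDir uDir
  vv : ν * (fderiv ℝ F p vDir * deriv d₂ p.2.2)
      = deriv d (F p) * fderiv ℝ F p vDir ^ 2 + d (F p) * hess F p vDir vDir
  uv : 0 = 2 * deriv d (F p) * fderiv ℝ F p uDir * fderiv ℝ F p vDir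
      + d (F p) * (hess F p uDir vDir + hess F p vDir uDir)

/-- Comparison of coefficients in the equation `ν ∂f/∂t = ∇ · (d(f) ∇f)` for
`f = F(t, x, u, v)`, imposed for all solutions `u`, `v` of the governing equations. -/
theorem coefficients {F : Point → ℝ} {p : Point} (hF : ContDiffAt ℝ ∞ F p) {d d₁ d₂ : ℝ → ℝ}
    (hd : DifferentiableAt ℝ d (F p)) (hd₁ : DifferentiableAt ℝ d₁ p.2.1)
    (hd₂ : DifferentiableAt ℝ d₂ p.2.2) {ν : ℝ}
    (h : ∀ w : Base → Fibre, ContDiffAt ℝ ∞ w p.1 → w p.1 = p.2 →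
      dt (fun q => (w q).1) p.1 = divFlux d₁ (fun q => (w q).1) p.1 →
      dt (fun q => (w q).2) p.1 = divFlux d₂ (fun q => (w q).2) p.1 →
      ν * dt (fun q => F (q, w q)) p.1 = divFlux d (fun q => F (q, w q)) p.1) :
    CoefficientRelations F p d d₁ d₂ ν := by
  -- The invariance condition as a polynomial identity in the free jet parameters, the time slopes
  -- having been eliminated by the governing equations.
  have key : ∀ p₁ p₂ m₁ m₂ : ℝ,
      ν * (fderiv ℝ F p ((1, 0), (0, 0)) + (d₁ p.2.1 * m₁ + deriv d₁ p.2.1 * p₁ ^ 2)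
        * fderiv ℝ F p uDir + (d₂ p.2.2 * m₂ + deriv d₂ p.2.2 * p₂ ^ 2) * fderiv ℝ F p vDir)
      = ∑ a : Fin 3, (deriv d (F p) * (fderiv ℝ F p (spaceDir a + (p₁ * dir a) • uDir
          + (p₂ * dir a) • vDir)) ^ 2 + d (F p) *
        (hess F p (spaceDir a + (p₁ * dir a) • uDir + (p₂ * dir a) • vDir)
          (spaceDir a + (p₁ * dir a) • uDir + (p₂ * dir a) • vDir)
        + (m₁ * dir a) * fderiv ℝ F p uDir + (m₂ * dir a) * fderiv ℝ F p vDir)) := by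
    intro p₁ p₂ m₁ m₂
    set l₁ := d₁ p.2.1 * m₁ + deriv d₁ p.2.1 * p₁ ^ 2
    set l₂ := d₂ p.2.2 * m₂ + deriv d₂ p.2.2 * p₂ ^ 2
    have hp : (p.1, test p l₁ l₂ p₁ p₂ m₁ m₂ p.1) = p := by rw [test_self]
    have h1 := h (test p l₁ l₂ p₁ p₂ m₁ m₂) (contDiff_test p l₁ l₂ p₁ p₂ m₁ m₂).contDiffAt
      (test_self _ _ _ _ _ _ _) ((dt_quad _ _ _ _ _).trans (divFlux_quad _ _ _ _ _ hd₁).symm)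
      ((dt_quad _ _ _ _ _).trans (divFlux_quad _ _ _ _ _ hd₂).symm)
    have hcomp : ContDiffAt ℝ ∞ (fun q => F (q, test p l₁ l₂ p₁ p₂ m₁ m₂ q)) p.1 := by
      have : ContDiffAt ℝ ∞ F (p.1, test p l₁ l₂ p₁ p₂ m₁ m₂ p.1) := by rwa [hp]
      exact this.comp p.1 (contDiffAt_id.prodMk (contDiff_test p l₁ l₂ p₁ p₂ m₁ m₂).contDiffAt)
    rw [dt_comp_test hF, divFlux_expand hcomp (by rwa [hp]), hp] at h1
    rw [h1]
    refine Finset.sum_congr rfl fun a _ => ?_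
    rw [dx_dx_comp_test hF, (dx_comp_test hF l₁ l₂ p₁ p₂ m₁ m₂ a).self_of_nhds, hp]
    simp only [sub_self, mul_zero, add_zero]
  -- Coefficients are extracted by finite differences: sampling `m = 1` gives those of `m₁` and
  -- `m₂`, and averaging over opposite slopes removes the linear terms and leaves the quadratic and
  -- mixed ones.
  have k0 := key 0 0 0 0
  have k1 := key 0 0 1 0
  have k2 := key 0 0 0 1
  have k3 := key 1 0 0 0
  have k4 := key (-1) 0 0 0
  have k5 := key 0 1 0 0
  have k6 := key 0 (-1) 0 0
  have k7 := key 1 1 0 0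
  have k8 := key (-1) (-1) 0 0
  simp only [hess, Fin.sum_univ_three, dir, map_add, map_smul, add_apply,
    smul_apply, smul_eq_mul] at *
  simp only [if_true, Fin.reduceEq, if_false, mul_zero, mul_one, zero_mul, add_zero, one_mul,
    zero_add, ne_eq, OfNat.ofNat_ne_zero, not_false_eq_true, zero_pow, one_pow] at *
  refine ⟨?_, ?_, ?_, ?_, ?_⟩
  · linear_combination k1 - k0
  · linear_combination k2 - k0
  · unfold hess; linear_combination (k3 + k4) / 2 - k0
  · unfold hess; linear_combination (k5 + k6) / 2 - k0
  · unfold hess; linear_combination (k7 + k8) / 2 - (k3 + k4) / 2 - (k5 + k6) / 2 + k0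

/-! ### Affinity -/

/-- The derivative is locally constant, hence constant on a connected open set. -/
theorem hasFDerivAt_of_locally_affine {E F : Type*} [NormedAddCommGroup E] [NormedSpace ℝ E]
    [NormedAddCommGroup F] [NormedSpace ℝ F] {f : E → F} {O : Set E} (hO : IsOpen O)
    (hOc : IsPreconnected O)
    (h : ∀ x ∈ O, ∃ L : E →L[ℝ] F, ∀ᶠ y in 𝓝 x, f y = f x + L (y - x))
    {x₀ x : E} (hx₀ : x₀ ∈ O) (hx : x ∈ O) : HasFDerivAt f (fderiv ℝ f x₀) x := by
  have h1 : ∀ x ∈ O, ∃ L : E →L[ℝ] F, ∀ᶠ y in 𝓝 x, HasFDerivAt f L y := by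
    intro x hx
    obtain ⟨L, hL⟩ := h x hx
    refine ⟨L, hL.eventually_nhds.mono fun y hy => ?_⟩
    have : HasFDerivAt (fun y => f x + L (y - x)) L y :=
      (L.hasFDerivAt.comp y ((hasFDerivAt_id y).sub_const x)).const_add (f x)
    exact this.congr_of_eventuallyEq hy
  have h2 : ∀ x ∈ O, HasFDerivAt (fderiv ℝ f) (0 : E →L[ℝ] E →L[ℝ] F) x := by
    intro x hx
    obtain ⟨L, hL⟩ := h1 x hx
    exact (hasFDerivAt_const L x).congr_of_eventuallyEq (hL.mono fun y hy => hy.fderiv)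
  have h3 := hO.is_const_of_fderiv_eq_zero hOc
    (fun z hz => (h2 z hz).differentiableAt.differentiableWithinAt)
    (fun z hz => (h2 z hz).fderiv) hx₀ hx
  obtain ⟨L, hL⟩ := h1 x hx
  rw [h3]
  exact hL.self_of_nhds.differentiableAt.hasFDerivAt

/-- Spreads the vanishing of a velocity from a neighbourhood of a boundary value to the whole fibre.
-/
theorem eq_zero_of_locally_affine {E F : Type*} [NormedAddCommGroup E] [NormedSpace ℝ E]
    [NormedAddCommGroup F] [NormedSpace ℝ F] {f : E → F} {O : Set E} (hO : IsOpen O)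
    (hOc : IsPreconnected O)
    (h : ∀ x ∈ O, ∃ L : E →L[ℝ] F, ∀ᶠ y in 𝓝 x, f y = f x + L (y - x))
    {x₀ x : E} (hx₀ : x₀ ∈ O) (h0 : ∀ᶠ y in 𝓝 x₀, f y = 0) (hx : x ∈ O) : f x = 0 := by
  have h1 : fderiv ℝ f x₀ = 0 :=
    ((hasFDerivAt_const (0 : F) x₀).congr_of_eventuallyEq h0).fderiv
  have h2 := eq_affine_of_fderiv_const hO hOc
    (fun y hy => hasFDerivAt_of_locally_affine hO hOc h hx₀ hy) hx₀ hx
  rw [h2, h1, h0.self_of_nhds]; simp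

/-- The hypotheses are the relations of `CoefficientRelations` with `ν = 1`, stated so that the
lemma serves for both U and V with `u` and `v` exchanged. -/
theorem hess_eq_zero {F : Point → ℝ} {O : Set Point} (hO : IsOpen O)
    (hF : ∀ p ∈ O, ContDiffAt ℝ ∞ F p) {y z : Point →L[ℝ] ℝ} {Y Z : Point} (hyY : y Y = 1)
    (hyZ : y Z = 0) (hzZ : z Z = 1) {d e : ℝ → ℝ}
    (hdF : ∀ p ∈ O, DifferentiableAt ℝ d (F p)) (hd : ∀ p ∈ O, DifferentiableAt ℝ d (y p))
    (he : ∀ p ∈ O, DifferentiableAt ℝ e (z p)) (hd0 : ∀ p ∈ O, d (F p) ≠ 0)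
    (he0 : ∀ p ∈ O, e (z p) ≠ 0) (h0 : ∀ p ∈ O, fderiv ℝ F p Y ≠ 0)
    (h1 : ∀ p ∈ O, fderiv ℝ F p Y * d (y p) = d (F p) * fderiv ℝ F p Y)
    (h2 : ∀ p ∈ O, fderiv ℝ F p Z * e (z p) = d (F p) * fderiv ℝ F p Z)
    (h3 : ∀ p ∈ O, fderiv ℝ F p Y * deriv d (y p)
      = deriv d (F p) * fderiv ℝ F p Y ^ 2 + d (F p) * hess F p Y Y)
    (h4 : ∀ p ∈ O, fderiv ℝ F p Z * deriv e (z p)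
      = deriv d (F p) * fderiv ℝ F p Z ^ 2 + d (F p) * hess F p Z Z)
    (h5 : ∀ p ∈ O, 0 = 2 * deriv d (F p) * fderiv ℝ F p Y * fderiv ℝ F p Z
      + d (F p) * (hess F p Y Z + hess F p Z Y)) :
    ∀ p ∈ O, hess F p Y Y = 0 ∧ hess F p Y Z = 0 ∧ hess F p Z Y = 0 ∧ hess F p Z Z = 0 := by
  intro p hp
  -- Because `F` really depends on `y`, the first relation says that the diffusivity is unchanged.
  -- Differentiating this identity along `Y` and `Z` gives `e4` and `e5`, which cancel the
  -- `d'`-terms in `h3` and `h5`.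
  have hdd : ∀ p ∈ O, d (F p) = d (y p) := fun p hp =>
    mul_right_cancel₀ (h0 p hp) ((h1 p hp).symm.trans (mul_comm _ _))
  have hev : ∀ᶠ q in 𝓝 p, q ∈ O := hO.mem_nhds hp
  have e1 : HasFDerivAt (fun q => d (F q)) (deriv d (F p) • fderiv ℝ F p) p :=
    (hdF p hp).hasDerivAt.comp_hasFDerivAt p ((hF p hp).differentiableAt (by simp)).hasFDerivAt
  have e2 : HasFDerivAt (fun q => d (y q)) (deriv d (y p) • y) p :=
    (hd p hp).hasDerivAt.comp_hasFDerivAt p y.hasFDerivAt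
  have e3 := e1.unique (e2.congr_of_eventuallyEq (hev.mono fun q hq => hdd q hq))
  have e4 : deriv d (F p) * fderiv ℝ F p Y = deriv d (y p) := by
    have := congrArg (fun L => L Y) e3
    simpa [hyY] using this
  have e5 : deriv d (F p) * fderiv ℝ F p Z = 0 := by
    have := congrArg (fun L => L Z) e3
    simpa [hyZ] using this
  have hsym : hess F p Y Z = hess F p Z Y := by
    have : IsSymmSndFDerivAt ℝ F p := (hF p hp).isSymmSndFDerivAt (by
      rw [minSmoothness_of_isRCLikeNormedField]; exact WithTop.coe_le_coe.2 (le_top : (2 : ℕ∞) ≤ ⊤))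
    exact this Y Z
  have hYY : hess F p Y Y = 0 := by
    refine (mul_eq_zero.1 ?_).resolve_left (hd0 p hp)
    linear_combination -(h3 p hp) - fderiv ℝ F p Y * e4
  have hYZ : hess F p Y Z = 0 := by
    refine (mul_eq_zero.1 ?_).resolve_left (hd0 p hp)
    linear_combination -(h5 p hp) / 2 - fderiv ℝ F p Y * e5 + d (F p) / 2 * hsym
  refine ⟨hYY, hYZ, hsym ▸ hYZ, ?_⟩
  -- The product of `F_Z` and `e(z) - d(y)` vanishes identically. Its derivative along `Z`, combined
  -- with `h4` and `e5`, gives `e(z) F_ZZ = 0`; no comparison of `d` with `e` is needed.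
  have e6 : HasFDerivAt (fun q => fderiv ℝ F q Z * (e (z q) - d (y q))) _ p :=
    ((((hF p hp).fderiv_right (m := ∞) (by simp)).differentiableAt (by simp)).hasFDerivAt.clm_apply
      (hasFDerivAt_const Z p)).mul
      (((he p hp).hasDerivAt.comp_hasFDerivAt p z.hasFDerivAt).sub e2)
  have e7 : HasFDerivAt (fun q => fderiv ℝ F q Z * (e (z q) - d (y q)))
      (0 : Point →L[ℝ] ℝ) p := by
    refine (hasFDerivAt_const (0 : ℝ) p).congr_of_eventuallyEq (hev.mono fun q hq => ?_)
    have := h2 q hq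
    rw [hdd q hq] at this
    linear_combination this
  have e8 := congrArg (fun L => L Z) (e6.unique e7)
  simp [hyZ, hzZ] at e8
  have e9 : hess F p Z Z * (e (z p) - d (y p)) + fderiv ℝ F p Z * deriv e (z p) = 0 := by
    unfold hess; linear_combination e8
  refine (mul_eq_zero.1 ?_).resolve_left (he0 p hp)
  have := h4 p hp
  rw [hdd p hp] at this
  linear_combination e9 - this - fderiv ℝ F p Z * e5

theorem fibre_eq (q : Fibre) : (((0 : Base), q) : Point) = q.1 • uDir + q.2 • vDir := by
  simp [uDir, vDir]
  rfl

theorem affine_of_hess_eq_zero {F : Point → ℝ} {b : Base} {O : Set Fibre} (hO : IsOpen O)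
    (hOc : IsPreconnected O) (hF : ∀ q ∈ O, ContDiffAt ℝ ∞ F (b, q))
    (h : ∀ q ∈ O, hess F (b, q) uDir uDir = 0 ∧ hess F (b, q) uDir vDir = 0 ∧
      hess F (b, q) vDir uDir = 0 ∧ hess F (b, q) vDir vDir = 0)
    {q₀ q : Fibre} (hq₀ : q₀ ∈ O) (hq : q ∈ O) :
    F (b, q) = F (b, q₀) + (q.1 - q₀.1) * fderiv ℝ F (b, q₀) uDir
      + (q.2 - q₀.2) * fderiv ℝ F (b, q₀) vDir := by
  have hG : ∀ q ∈ O, HasFDerivAt (fun q => F (b, q))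
      ((fderiv ℝ F (b, q)).comp (ContinuousLinearMap.inr ℝ Base Fibre)) q := fun q hq =>
    ((hF q hq).differentiableAt (by simp)).hasFDerivAt.comp q (hasFDerivAt_prodMk_right b q)
  have hGs : ∀ q ∈ O, ContDiffAt ℝ ∞ (fun q => F (b, q)) q := fun q hq =>
    (hF q hq).comp q (contDiffAt_const.prodMk contDiffAt_id)
  have h2 : ∀ q ∈ O, fderiv ℝ (fderiv ℝ (fun q => F (b, q))) q = 0 := by
    intro q hq
    have e1 : HasFDerivAt (fderiv ℝ F) (fderiv ℝ (fderiv ℝ F) (b, q)) (b, q) :=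
      (((hF q hq).fderiv_right (m := ∞) (by simp)).differentiableAt (by simp)).hasFDerivAt
    have e2 := (e1.comp q (hasFDerivAt_prodMk_right b q)).clm_comp
      (hasFDerivAt_const (ContinuousLinearMap.inr ℝ Base Fibre) q)
    have e3 := e2.congr_of_eventuallyEq (f₁ := fderiv ℝ (fun q => F (b, q))) (by
      filter_upwards [hO.mem_nhds hq] with q' hq'
      exact (hG q' hq').fderiv)
    rw [e3.fderiv]
    refine ContinuousLinearMap.ext fun η => ContinuousLinearMap.ext fun ζ => ?_
    have e4 : fderiv ℝ (fderiv ℝ F) (b, q) ((0 : Base), η) ((0 : Base), ζ) = 0 := by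
      obtain ⟨h1, h2, h3, h4⟩ := h q hq
      unfold hess at h1 h2 h3 h4
      rw [fibre_eq η, fibre_eq ζ]
      simp [h1, h2, h3, h4]
    simpa using e4
  have h3 : ∀ x ∈ O, HasFDerivAt (fun q => F (b, q))
      ((fderiv ℝ F (b, q₀)).comp (ContinuousLinearMap.inr ℝ Base Fibre)) x := by
    intro x hx
    have := fderiv_eq_of_second_eq_zero hO hOc hGs h2 hq₀ hx
    rw [(hG q₀ hq₀).fderiv, (hG x hx).fderiv] at this
    rw [this]; exact hG x hx
  have h4 := eq_affine_of_fderiv_const hO hOc h3 hq₀ hq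
  rw [h4, ContinuousLinearMap.comp_apply, ContinuousLinearMap.inr_apply]
  have := fibre_eq (q - q₀)
  rw [this, map_add, map_smul, map_smul]
  simp [add_assoc]

/-! ### Pull-back of the diffusion equations to the original variables. -/

namespace InvCurve

variable {B : BVP} {W : Set (ℝ × Point)} {g : ℝ → PointTransformation}

/-- The transformed unknowns satisfy the diffusion equations in the original variables, up to the
factor `ν`. -/
theorem transfer (h : InvCurve B W g) {s : ℝ} {p : Point} (hz : (s, p) ∈ W) (hn : Near g s p.1)
    {M : E3 →L[ℝ] E3} {m ν : ℝ} (hμ : 0 < ν * m)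
    (hM : ∀ x y, inner ℝ (M x) (M y) = ν * m * inner ℝ x y) (hJ1 : jac g s p.1 (1, 0) = (m, 0))
    (hφ : ∀ᶠ q in 𝓝 p.1, ∀ y, jac g s q (0, y) = (0, M y)) {w : Base → Fibre}
    (hw : ContDiffAt ℝ ∞ w p.1) (hwb : w p.1 = p.2)
    (h1 : dt (fun q => (w q).1) p.1 = divFlux B.d₁ (fun q => (w q).1) p.1)
    (h2 : dt (fun q => (w q).2) p.1 = divFlux B.d₂ (fun q => (w q).2) p.1) :
    ν * dt (fun q => ((g s).toFun (q, w q)).2.1) p.1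
      = divFlux B.d₁ (fun q => ((g s).toFun (q, w q)).2.1) p.1 ∧
    ν * dt (fun q => ((g s).toFun (q, w q)).2.2) p.1
      = divFlux B.d₂ (fun q => ((g s).toFun (q, w q)).2.2) p.1 := by
  obtain ⟨b, y⟩ := p
  simp only at *
  subst hwb
  obtain ⟨e, he⟩ := exists_equiv_of_near hn
  obtain ⟨w', hw'⟩ := h.exists_image hz hw e he
  obtain ⟨e1, e2⟩ := h.equations s b w w' hz hw' ⟨h1, h2⟩
  have hbs : ContDiffAt ℝ ∞ (g s).base b := h.contDiffAt_base hz
  have hbd : DifferentiableAt ℝ (g s).base b := hbs.differentiableAt (by simp)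
  have hφ' : ∀ᶠ q in 𝓝 b, DifferentiableAt ℝ (g s).base q ∧
      ∀ y, fderiv ℝ (g s).base q (0, y) = (0, M y) := by
    filter_upwards [hφ, (hbs.of_le (m := 1) (by simp)).eventually (by simp)] with q hq hq'
    exact ⟨hq'.differentiableAt (by simp), hq⟩
  have hmap : (w' ((g s).base b)) = ((g s).toFun (b, w b)).2 := hw'.2.2.self_of_nhds
  have hmem := h.mapsTo _ _ hz
  have i1 : ∀ᶠ q in 𝓝 b, (w' ((g s).base q)).1 = ((g s).toFun (q, w q)).2.1 :=
    hw'.2.2.mono fun q hq => congrArg Prod.fst hq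
  have i2 : ∀ᶠ q in 𝓝 b, (w' ((g s).base q)).2 = ((g s).toFun (q, w q)).2.2 :=
    hw'.2.2.mono fun q hq => congrArg Prod.snd hq
  have d1 : ContDiffAt ℝ ∞ B.d₁ (w' ((g s).base b)).1 := by
    rw [hmap]; exact B.smooth_d₁.contDiffAt (B.isOpen_I₁.mem_nhds hmem.2.1)
  have d2 : ContDiffAt ℝ ∞ B.d₂ (w' ((g s).base b)).2 := by
    rw [hmap]; exact B.smooth_d₂.contDiffAt (B.isOpen_I₂.mem_nhds hmem.2.2)
  -- Under the change of variables time derivatives acquire the factor `m` and diffusion terms the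
  -- factor `ν * m`; the quotient `ν` is what remains.
  constructor
  · rw [dt_comp (f' := fun q => (w' q).1) (hw'.2.1.fst.differentiableAt (by simp)) hbd hJ1 i1,
      divFlux_comp (f' := fun q => (w' q).1) hμ hM hw'.2.1.fst d1 hφ' i1, e1, mul_assoc]
  · rw [dt_comp (f' := fun q => (w' q).2) (hw'.2.1.snd.differentiableAt (by simp)) hbd hJ1 i2,
      divFlux_comp (f' := fun q => (w' q).2) hμ hM hw'.2.1.snd d2 hφ' i2, e2, mul_assoc]

end InvCurve

namespace InvCurve

variable {B : BVP} {W : Set (ℝ × Point)} {g : ℝ → PointTransformation}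

/-! ### Behaviour near the identity -/

theorem dU_eq (h : InvCurve B W g) {s : ℝ} {p : Point} (hz : (s, p) ∈ W) :
    dU g s p = (fderiv ℝ (fun z : ℝ × Point => ((g z.1).toFun z.2).2.1) (s, p)).comp
      (ContinuousLinearMap.inr ℝ ℝ Point) :=
  ((((h.contDiffAt hz).snd.fst).differentiableAt (by simp)).hasFDerivAt.comp p
    (hasFDerivAt_prodMk_right s p)).fderiv

theorem dV_eq (h : InvCurve B W g) {s : ℝ} {p : Point} (hz : (s, p) ∈ W) :
    dV g s p = (fderiv ℝ (fun z : ℝ × Point => ((g z.1).toFun z.2).2.2) (s, p)).comp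
      (ContinuousLinearMap.inr ℝ ℝ Point) :=
  ((((h.contDiffAt hz).snd.snd).differentiableAt (by simp)).hasFDerivAt.comp p
    (hasFDerivAt_prodMk_right s p)).fderiv

theorem contDiffAt_dU (h : InvCurve B W g) {s : ℝ} {p : Point} (hz : (s, p) ∈ W) :
    ContDiffAt ℝ ∞ (fun z : ℝ × Point => dU g z.1 z.2) (s, p) := by
  have h1 : ContDiffAt ℝ ∞ (fun z => (fderiv ℝ (fun z : ℝ × Point =>
      ((g z.1).toFun z.2).2.1) z).comp (ContinuousLinearMap.inr ℝ ℝ Point)) (s, p) :=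
    ((h.contDiffAt hz).snd.fst.fderiv_right (m := ∞) (by simp)).clm_comp contDiffAt_const
  exact h1.congr_of_eventuallyEq ((h.isOpen.eventually_mem hz).mono
    fun z hz => h.dU_eq hz)

theorem contDiffAt_dV (h : InvCurve B W g) {s : ℝ} {p : Point} (hz : (s, p) ∈ W) :
    ContDiffAt ℝ ∞ (fun z : ℝ × Point => dV g z.1 z.2) (s, p) := by
  have h1 : ContDiffAt ℝ ∞ (fun z => (fderiv ℝ (fun z : ℝ × Point =>
      ((g z.1).toFun z.2).2.2) z).comp (ContinuousLinearMap.inr ℝ ℝ Point)) (s, p) :=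
    ((h.contDiffAt hz).snd.snd.fderiv_right (m := ∞) (by simp)).clm_comp contDiffAt_const
  exact h1.congr_of_eventuallyEq ((h.isOpen.eventually_mem hz).mono
    fun z hz => h.dV_eq hz)

theorem eventually_zero (h : InvCurve B W g) {p : Point} (hp : p ∈ B.domain) :
    ∀ᶠ q in 𝓝 p, (g 0).toFun q = q :=
  (B.isOpen_domain.eventually_mem hp).mono fun q hq => h.zero q hq

theorem dU_zero (h : InvCurve B W g) {p : Point} (hp : p ∈ B.domain) (x : Point) :
    dU g 0 p x = x.2.1 := by
  have h1 : (fun p => ((g 0).toFun p).2.1) =ᶠ[𝓝 p] fun p : Point => p.2.1 :=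
    (h.eventually_zero hp).mono fun q hq => by simp only [hq]
  rw [dU, h1.fderiv_eq]
  have : HasFDerivAt (fun p : Point => p.2.1) ((ContinuousLinearMap.fst ℝ ℝ ℝ).comp
    (ContinuousLinearMap.snd ℝ Base Fibre)) p :=
    ((ContinuousLinearMap.fst ℝ ℝ ℝ).comp (ContinuousLinearMap.snd ℝ Base Fibre)).hasFDerivAt
  rw [this.fderiv]; rfl

theorem dV_zero (h : InvCurve B W g) {p : Point} (hp : p ∈ B.domain) (x : Point) :
    dV g 0 p x = x.2.2 := by
  have h1 : (fun p => ((g 0).toFun p).2.2) =ᶠ[𝓝 p] fun p : Point => p.2.2 :=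
    (h.eventually_zero hp).mono fun q hq => by simp only [hq]
  rw [dV, h1.fderiv_eq]
  have : HasFDerivAt (fun p : Point => p.2.2) ((ContinuousLinearMap.snd ℝ ℝ ℝ).comp
    (ContinuousLinearMap.snd ℝ Base Fibre)) p :=
    ((ContinuousLinearMap.snd ℝ ℝ ℝ).comp (ContinuousLinearMap.snd ℝ Base Fibre)).hasFDerivAt
  rw [this.fderiv]; rfl

theorem mem_reference {b : Base} (hb : B.tStar < b.1) : ((b, (B.u_v, B.v_m)) : Point) ∈ B.domain :=
  ⟨hb, B.u_v_mem, B.v_m_mem⟩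

theorem base_zero (h : InvCurve B W g) {b : Base} (hb : B.tStar < b.1) : (g 0).base b = b :=
  congrArg Prod.fst (h.zero (b, (B.u_v, B.v_m)) (mem_reference hb))

theorem jac_zero (h : InvCurve B W g) {b : Base} (hb : B.tStar < b.1) :
    jac g 0 b = ContinuousLinearMap.id ℝ Base := by
  have h1 : (g 0).base =ᶠ[𝓝 b] id := by
    have : ∀ᶠ q : Base in 𝓝 b, B.tStar < q.1 :=
      continuous_fst.continuousAt.eventually (lt_mem_nhds hb)
    exact this.mono fun q hq => h.base_zero hq
  rw [jac, h1.fderiv_eq, fderiv_id]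

theorem near_zero (h : InvCurve B W g) {b : Base} (hb : B.tStar < b.1) : Near g 0 b := by
  rw [Near, h.jac_zero hb]; simp

/-- The properties of the transformations of `(t, x)` close to the identity. -/
structure BaseForm (B : BVP) (g : ℝ → PointTransformation) (b₀ : Base) (s : ℝ) (b : Base) :
    Prop where
  near : Near g s b
  pos : 0 < (jac g s b₀ (1, 0)).1
  jac_eq : jac g s b = jac g s b₀
  time : (jac g s b₀ (1, 0)).2 = 0
  space : ∀ y, (jac g s b₀ (0, y)).1 = 0
  inner_eq : ∀ y z, inner ℝ (jac g s b₀ (0, y)).2 (jac g s b₀ (0, z)).2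
    = (jac g s b₀ (1, 0)).1 * inner ℝ y z
  flux : (jac g s b₀ (1, 0)).1 • B.Q ((g s).base b).1 = (jac g s b₀ (0, B.Q b.1)).2

theorem ball_prod (b : Base) (r : ℝ) :
    Metric.ball b r = Metric.ball b.1 r ×ˢ Metric.ball b.2 r :=
  (ball_prod_same b.1 b.2 r).symm

theorem coefficients_U (h : InvCurve B W g) {s : ℝ} {p : Point} (hz : (s, p) ∈ W)
    (hn : Near g s p.1) {M : E3 →L[ℝ] E3} {m ν : ℝ} (hμ : 0 < ν * m)
    (hM : ∀ x y, inner ℝ (M x) (M y) = ν * m * inner ℝ x y) (hJ1 : jac g s p.1 (1, 0) = (m, 0))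
    (hφ : ∀ᶠ q in 𝓝 p.1, ∀ y, jac g s q (0, y) = (0, M y)) :
    CoefficientRelations (fun p => ((g s).toFun p).2.1) p B.d₁ B.d₁ B.d₂ ν :=
  have hp := h.subset s p hz
  have hq := h.mapsTo s p hz
  coefficients (h.contDiffAt_toFun hz).snd.fst (d := B.d₁) (d₁ := B.d₁) (d₂ := B.d₂) (ν := ν)
    ((B.smooth_d₁.contDiffAt (B.isOpen_I₁.mem_nhds hq.2.1)).differentiableAt (by simp))
    ((B.smooth_d₁.contDiffAt (B.isOpen_I₁.mem_nhds hp.2.1)).differentiableAt (by simp))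
    ((B.smooth_d₂.contDiffAt (B.isOpen_I₂.mem_nhds hp.2.2)).differentiableAt (by simp))
    (fun w hw hwb h1 h2 => (h.transfer hz hn hμ hM hJ1 hφ hw hwb h1 h2).1)

theorem coefficients_V (h : InvCurve B W g) {s : ℝ} {p : Point} (hz : (s, p) ∈ W)
    (hn : Near g s p.1) {M : E3 →L[ℝ] E3} {m ν : ℝ} (hμ : 0 < ν * m)
    (hM : ∀ x y, inner ℝ (M x) (M y) = ν * m * inner ℝ x y) (hJ1 : jac g s p.1 (1, 0) = (m, 0))
    (hφ : ∀ᶠ q in 𝓝 p.1, ∀ y, jac g s q (0, y) = (0, M y)) :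
    CoefficientRelations (fun p => ((g s).toFun p).2.2) p B.d₂ B.d₁ B.d₂ ν :=
  have hp := h.subset s p hz
  have hq := h.mapsTo s p hz
  coefficients (h.contDiffAt_toFun hz).snd.snd (d := B.d₂) (d₁ := B.d₁) (d₂ := B.d₂) (ν := ν)
    ((B.smooth_d₂.contDiffAt (B.isOpen_I₂.mem_nhds hq.2.2)).differentiableAt (by simp))
    ((B.smooth_d₁.contDiffAt (B.isOpen_I₁.mem_nhds hp.2.1)).differentiableAt (by simp))
    ((B.smooth_d₂.contDiffAt (B.isOpen_I₂.mem_nhds hp.2.2)).differentiableAt (by simp))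
    (fun w hw hwb h1 h2 => (h.transfer hz hn hμ hM hJ1 hφ hw hwb h1 h2).2)

/-- Near the identity the hypotheses of the interface analysis hold by continuity, with one radius
for parameter and base point. That analysis leaves the stretching `ν = ∂U/∂u` undetermined; the
diffusion equation for `u` then fixes it. -/
theorem exists_baseForm (h : InvCurve B W g) {b₀ : Base} (hb₀ : B.tStar < b₀.1) :
    ∃ r > 0, ∀ s : ℝ, |s| < r → ∀ b ∈ Metric.ball b₀ r, BaseForm B g b₀ s b ∧
      (s, (b, (B.u_v, B.v_m))) ∈ W ∧ dU g s (b, (B.u_v, B.v_m)) uDir = 1 := by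
  have hp₀ := mem_reference hb₀
  have hz₀ := h.zero_mem _ hp₀
  have hc : ContinuousAt (fun z : ℝ × Base => ((z.1, (z.2, (B.u_v, B.v_m))) : ℝ × Point))
    (0, b₀) := by fun_prop
  have e1 : ∀ᶠ z : ℝ × Base in 𝓝 (0, b₀), (z.1, (z.2, (B.u_v, B.v_m))) ∈ W :=
    hc.eventually (h.isOpen.mem_nhds hz₀)
  have e2 := h.near_eventually hz₀ (h.near_zero hb₀)
  have e3 : ∀ᶠ z : ℝ × Base in 𝓝 (0, b₀), dU g z.1 (z.2, (B.u_v, B.v_m)) uDir ≠ 0 := by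
    have hc2 : ContinuousAt (fun z : ℝ × Point => dU g z.1 z.2 uDir)
        (0, (b₀, (B.u_v, B.v_m))) :=
      ((h.contDiffAt_dU hz₀).clm_apply contDiffAt_const).continuousAt
    have hc3 : ContinuousAt (fun z : ℝ × Base => dU g z.1 (z.2, (B.u_v, B.v_m)) uDir) (0, b₀) :=
      ContinuousAt.comp (f := fun z : ℝ × Base => ((z.1, (z.2, (B.u_v, B.v_m))) : ℝ × Point))
        (x := (0, b₀)) hc2 hc
    refine hc3.eventually_ne ?_
    rw [h.dU_zero hp₀]
    simp [uDir]
  obtain ⟨r, hr, hball⟩ := Metric.eventually_nhds_iff_ball.1 (e1.and (e2.and e3))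
  have hgood : ∀ s : ℝ, |s| < r → ∀ b ∈ Metric.ball b₀ r, (s, (b, (B.u_v, B.v_m))) ∈ W ∧
      Near g s b ∧ dU g s (b, (B.u_v, B.v_m)) uDir ≠ 0 := by
    intro s hs b hb
    refine hball (s, b) ?_
    rw [← ball_prod_same]
    exact ⟨by simpa using hs, hb⟩
  refine ⟨r, hr, fun s hs => ?_⟩
  have hblock := fun b hb => h.jac_block (hgood s hs b hb).1 (hgood s hs b hb).2.1
    (hgood s hs b hb).2.2
  have hrig := space_derivative_const (φ := (g s).base) (t₀ := b₀.1) (x₀ := b₀.2) (r := r)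
    (Q := B.Q) (μ := fun b => dU g s (b, (B.u_v, B.v_m)) uDir * (jac g s b (1, 0)).1) hr
    (by rw [← ball_prod]; exact fun b hb => h.contDiffAt_base (hgood s hs b hb).1)
    (by rw [← ball_prod]; exact fun b hb => (hblock b hb).1)
    (by rw [← ball_prod]; exact fun b hb => (hblock b hb).2.1)
    (by rw [← ball_prod]; exact fun b hb => B.Q_ne_zero _ (h.subset _ _ (hgood s hs b hb).1).1)
    (by rw [← ball_prod]; exact fun b hb => (hblock b hb).2.2.1)
    (by rw [← ball_prod]; exact fun b hb => (hblock b hb).2.2.2.1)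
    (by rw [← ball_prod]; exact fun b hb => (hblock b hb).2.2.2.2)
  rw [← ball_prod] at hrig
  set M : E3 →L[ℝ] E3 := (ContinuousLinearMap.snd ℝ ℝ E3).comp
    ((jac g s b₀).comp (ContinuousLinearMap.inr ℝ ℝ E3)) with hMdef
  have hb₀r : b₀ ∈ Metric.ball b₀ r := Metric.mem_ball_self hr
  have hM : ∀ b ∈ Metric.ball b₀ r, ∀ y, jac g s b (0, y) = (0, M y) := by
    intro b hb y
    have := (hrig b hb).1 y
    change jac g s b (0, y) = jac g s b₀ (0, y) at this
    rw [this]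
    exact Prod.ext ((hblock b₀ hb₀r).2.1 y) rfl
  -- On `u = u_v` the diffusivity takes the same value before and after, so the coefficient relation
  -- reads `ν² d₁ = ν d₁` with `ν ≠ 0`.
  have hν : ∀ b ∈ Metric.ball b₀ r, dU g s (b, (B.u_v, B.v_m)) uDir = 1 := by
    intro b hb
    obtain ⟨k1, k2, k3, k4, k5⟩ := hblock b hb
    have hU := h.fixes_u_v (hgood s hs b hb).1 (hgood s hs b hb).2.1
    have := (h.coefficients_U (hgood s hs b hb).1 (hgood s hs b hb).2.1 (M := M) k4
      (fun x y => by rw [← k5]; simp only [hM b hb]) (Prod.ext rfl k1)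
      (by filter_upwards [Metric.isOpen_ball.mem_nhds hb] with q hq using hM q hq)).u
    simp only [hU] at this
    change dU g s (b, (B.u_v, B.v_m)) uDir * (dU g s (b, (B.u_v, B.v_m)) uDir * B.d₁ B.u_v)
      = B.d₁ B.u_v * dU g s (b, (B.u_v, B.v_m)) uDir at this
    have hd := (B.d₁_pos _ B.u_v_mem).ne'
    have hne := (hgood s hs b hb).2.2
    refine mul_right_cancel₀ (mul_ne_zero hne hd) ?_
    linear_combination this
  intro b hb
  refine ⟨?_, (hgood s hs b hb).1, hν b hb⟩
  have hm : (jac g s b (1, 0)).1 = (jac g s b₀ (1, 0)).1 := by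
    have := (hrig b hb).2
    simp only [Prod.mk.eta] at this
    rw [hν b hb, hν b₀ hb₀r] at this
    simpa using this
  have hjac : jac g s b = jac g s b₀ := by
    refine ContinuousLinearMap.ext fun x => ?_
    have hx : x = x.1 • ((1 : ℝ), (0 : E3)) + (0, x.2) := by ext1 <;> simp
    rw [hx, map_add, map_add, map_smul, map_smul, hM b hb, hM b₀ hb₀r]
    congr 2
    exact Prod.ext hm ((hblock b hb).1.trans (hblock b₀ hb₀r).1.symm)
  obtain ⟨k1, k2, k3, k4, k5⟩ := hblock b hb
  obtain ⟨l1, l2, l3, l4, l5⟩ := hblock b₀ hb₀r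
  change 0 < dU g s (b₀, (B.u_v, B.v_m)) uDir * (jac g s b₀ (1, 0)).1 at l4
  have l5' : ∀ y z, inner ℝ (jac g s b₀ (0, y)).2 (jac g s b₀ (0, z)).2
    = dU g s (b₀, (B.u_v, B.v_m)) uDir * (jac g s b₀ (1, 0)).1 * inner ℝ y z := l5
  rw [hν b₀ hb₀r, one_mul] at l4 l5'
  refine ⟨(hgood s hs b hb).2.1, l4, hjac, l1, l2, l5', ?_⟩
  rw [← hjac]; exact k3

end InvCurve

namespace InvCurve

variable {B : BVP} {W : Set (ℝ × Point)} {g : ℝ → PointTransformation}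

/-! ### The second free surface -/

theorem grad_quad (b : Base) (c l p : ℝ) :
    grad (quad b c l p 0) b = p • EuclideanSpace.single 0 1 := by
  refine grad_eq_of_forall fun y => ?_
  rw [(hasFDerivAt_quad b c l p 0 b).fderiv]
  simp [coordOne, inner_smul_left, EuclideanSpace.inner_single_left]

theorem inner_grad_single (f : Base → ℝ) (b : Base) (a : Fin 3) :
    inner ℝ (grad f b) (EuclideanSpace.single a 1) = dx a f b := by
  rw [inner_grad]; rfl

/-- The space part of the derivative of the transformation of `(t, x)`. -/
noncomputable def spacePart (g : ℝ → PointTransformation) (s : ℝ) (b : Base) : E3 →L[ℝ] E3 :=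
  (ContinuousLinearMap.snd ℝ ℝ E3).comp ((jac g s b).comp (ContinuousLinearMap.inr ℝ ℝ E3))

theorem BaseForm.jac_space {b₀ b : Base} {s : ℝ} (hb : BaseForm B g b₀ s b) (y : E3) :
    jac g s b (0, y) = (0, spacePart g s b₀ y) := by
  rw [hb.jac_eq]
  exact Prod.ext (hb.space y) rfl

theorem BaseForm.jac_time {b₀ b : Base} {s : ℝ} (hb : BaseForm B g b₀ s b) :
    jac g s b (1, 0) = ((jac g s b₀ (1, 0)).1, 0) := by
  rw [hb.jac_eq]
  exact Prod.ext rfl hb.time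

/-- The jets used have gradient of `S₂` along `x₁` and slopes `X`, `Y` of `u`, `v` in that
direction. Products of gradients and the time derivative of `S₂` carry the same factor in
`BaseForm`, so it cancels and a relation between derivatives of U and V remains. -/
theorem interface₂ (h : InvCurve B W g) {s : ℝ} {b₀ b : Base}
    (hz : (s, (b, (B.u_m, B.v_m))) ∈ W) (hb : BaseForm B g b₀ s b) (X Y : ℝ)
    (hXY : B.d₁ B.u_m * X - B.d₂ B.v_m * Y ≠ 0) :
    (((g s).toFun (b, (B.u_m, B.v_m))).2.1 = B.u_m ∧
      ((g s).toFun (b, (B.u_m, B.v_m))).2.2 = B.v_m) ∧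
    B.d₂ B.v_m * dV g s (b, (B.u_m, B.v_m)) (spaceDir 0 + X • uDir + Y • vDir)
      = B.d₁ B.u_m * dU g s (b, (B.u_m, B.v_m)) (spaceDir 0 + X • uDir + Y • vDir)
        - (B.d₁ B.u_m * X - B.d₂ B.v_m * Y) := by
  obtain ⟨e, he⟩ := exists_equiv_of_near hb.near
  set p : Point := (b, (B.u_m, B.v_m)) with hp
  set w := test p 0 0 X Y 0 0 with hw
  have hwb : w b = (B.u_m, B.v_m) := test_self p 0 0 X Y 0 0
  -- The time derivative of `S₂` dictated by the interface condition; `hXY` makes it nonzero, as an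
  -- admissible surface requires.
  set l := (B.d₁ B.u_m * X - B.d₂ B.v_m * Y) / B.H_m with hl
  have hl0 : l ≠ 0 := div_ne_zero hXY B.H_m_pos.ne'
  set S := quad b 0 l 1 0 with hS
  have hws : ContDiffAt ℝ ∞ w b := (contDiff_test p 0 0 X Y 0 0).contDiffAt
  obtain ⟨w', hw'⟩ := h.exists_image (w := w) (by rwa [hwb]) hws e he
  obtain ⟨S', hS'⟩ := h.exists_imageSurface hz (S := S) (contDiff_quad _ _ _ _ _).contDiffAt e he
  have hgS : grad S b = EuclideanSpace.single 0 1 := by rw [hS, grad_quad, one_smul]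
  have hon : B.OnSurface₂ w S b := by
    rw [BVP.onSurface₂_iff, hgS]
    have e1 : grad (fun q => (w q).1) b = X • EuclideanSpace.single 0 1 := grad_quad _ _ _ _
    have e2 : grad (fun q => (w q).2) b = Y • EuclideanSpace.single 0 1 := grad_quad _ _ _ _
    refine ⟨quad_self _ _ _ _ _, by rw [hS, dt_quad]; exact hl0, ?_, ?_,
      congrArg Prod.fst hwb, congrArg Prod.snd hwb⟩
    · intro h0
      have := congrArg (fun z : E3 => z 0) h0
      simp at this
    · rw [e1, e2, hS, dt_quad, inner_smul_left, inner_smul_left, hl]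
      have := B.H_m_pos.ne'
      simp
      field_simp
      ring
  have himg := h.surface₂ s b w w' S S' (by rwa [hwb]) hw' hS' hon
  rw [BVP.onSurface₂_iff] at himg
  obtain ⟨-, -, -, h4, h5, h6⟩ := himg
  have hmap : w' ((g s).base b) = ((g s).toFun p).2 := by
    rw [hw'.2.2.self_of_nhds, hwb]; rfl
  refine ⟨⟨by rw [← hmap]; exact h5, by rw [← hmap]; exact h6⟩, ?_⟩
  have hbd : DifferentiableAt ℝ (g s).base b := (h.contDiffAt_base hz).differentiableAt (by simp)
  have i1 : ∀ᶠ q in 𝓝 b, (w' ((g s).base q)).1 = ((g s).toFun (q, w q)).2.1 :=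
    hw'.2.2.mono fun q hq => congrArg Prod.fst hq
  have i2 : ∀ᶠ q in 𝓝 b, (w' ((g s).base q)).2 = ((g s).toFun (q, w q)).2.2 :=
    hw'.2.2.mono fun q hq => congrArg Prod.snd hq
  have hM := fun y => hb.jac_space y
  have g1 := grad_comp (f' := fun q => (w' q).1) (hw'.2.1.fst.differentiableAt (by simp)) hbd hM i1
  have g2 := grad_comp (f' := fun q => (w' q).2) (hw'.2.1.snd.differentiableAt (by simp)) hbd hM i2
  have g3 := grad_comp (hS'.2.1.differentiableAt (by simp)) hbd hM hS'.2.2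
  have g4 := dt_comp (hS'.2.1.differentiableAt (by simp)) hbd hb.jac_time hS'.2.2
  have hconf := inner_adjoint_conformal hb.pos (M := spacePart g s b₀) hb.inner_eq
  have c1 := hconf (grad (fun q => (w' q).1) ((g s).base b)) (grad S' ((g s).base b))
  have c2 := hconf (grad (fun q => (w' q).2) ((g s).base b)) (grad S' ((g s).base b))
  rw [← g1, ← g3, hgS, inner_grad_single] at c1
  rw [← g2, ← g3, hgS, inner_grad_single] at c2
  have hz' : (s, p) ∈ W := hz
  have f1 := (dx_comp_test (h.contDiffAt_toFun hz').snd.fst 0 0 X Y 0 0 0).self_of_nhds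
  have f2 := (dx_comp_test (h.contDiffAt_toFun hz').snd.snd 0 0 X Y 0 0 0).self_of_nhds
  have hp2 : (p.1, test p 0 0 X Y 0 0 p.1) = p := by rw [test_self]
  rw [hp2] at f1 f2
  simp only [dir, if_true, mul_one, zero_mul, add_zero] at f1 f2
  have f1' : dx 0 (fun q => ((g s).toFun (q, w q)).2.1) b
      = dU g s p (spaceDir 0 + X • uDir + Y • vDir) := f1
  have f2' : dx 0 (fun q => ((g s).toFun (q, w q)).2.2) b
      = dV g s p (spaceDir 0 + X • uDir + Y • vDir) := f2
  rw [f1'] at c1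
  rw [f2'] at c2
  rw [hS, dt_quad, hl, div_eq_iff B.H_m_pos.ne'] at g4
  rw [c1, c2, g4]
  linear_combination (jac g s b₀ (1, 0)).1 * h4

theorem fixes_second (h : InvCurve B W g) {s : ℝ} {b₀ b : Base}
    (hz : (s, (b, (B.u_m, B.v_m))) ∈ W) (hb : BaseForm B g b₀ s b) :
    ((g s).toFun (b, (B.u_m, B.v_m))).2.1 = B.u_m ∧
      ((g s).toFun (b, (B.u_m, B.v_m))).2.2 = B.v_m :=
  (h.interface₂ hz hb 1 0 (by simpa using (B.d₁_pos _ B.u_m_mem).ne')).1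

theorem fderiv_spaceDir_of_const {F : Point → ℝ} {b : Base} {y : Fibre} {c : ℝ}
    (hF : DifferentiableAt ℝ F (b, y)) (h : ∀ᶠ q in 𝓝 b, F (q, y) = c) :
    fderiv ℝ F (b, y) (spaceDir 0) = 0 := by
  have h0 : HasFDerivAt (fun q : Base => ((q, y) : Point)) (ContinuousLinearMap.inl ℝ Base Fibre) b :=
    hasFDerivAt_prodMk_left b y
  have h1 : HasFDerivAt (fun q : Base => F (q, y))
      ((fderiv ℝ F (b, y)).comp (ContinuousLinearMap.inl ℝ Base Fibre)) b :=
    HasFDerivAt.comp (g := F) b hF.hasFDerivAt h0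
  have h2 : HasFDerivAt (fun q : Base => F (q, y)) (0 : Base →L[ℝ] ℝ) b :=
    (hasFDerivAt_const c b).congr_of_eventuallyEq h
  have := congrArg (fun L => L ((0, EuclideanSpace.single 0 1) : Base)) (h1.unique h2)
  exact this

/-- The values `(u_m, v_m)` are fixed at all nearby base points, so the space derivatives of U and V
vanish there. The slopes `(1, 0)` and `(0, 1)` then separate the two relations. -/
theorem derivatives_second (h : InvCurve B W g) {s : ℝ} {b₀ b : Base}
    (hz : (s, (b, (B.u_m, B.v_m))) ∈ W) (hb : ∀ᶠ q in 𝓝 b, BaseForm B g b₀ s q) :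
    B.d₂ B.v_m * dV g s (b, (B.u_m, B.v_m)) uDir
      = B.d₁ B.u_m * (dU g s (b, (B.u_m, B.v_m)) uDir - 1) ∧
    B.d₂ B.v_m * (dV g s (b, (B.u_m, B.v_m)) vDir - 1)
      = B.d₁ B.u_m * dU g s (b, (B.u_m, B.v_m)) vDir := by
  have hc : ContinuousAt (fun q : Base => ((s, (q, (B.u_m, B.v_m))) : ℝ × Point)) b := by fun_prop
  have hev : ∀ᶠ q in 𝓝 b, ((g s).toFun (q, (B.u_m, B.v_m))).2.1 = B.u_m ∧
      ((g s).toFun (q, (B.u_m, B.v_m))).2.2 = B.v_m := by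
    filter_upwards [hb, hc.eventually (h.isOpen.mem_nhds hz)] with q h1 h2
    exact h.fixes_second h2 h1
  have z1 : dU g s (b, (B.u_m, B.v_m)) (spaceDir 0) = 0 :=
    fderiv_spaceDir_of_const (h.hasFDerivAt_U hz).differentiableAt (hev.mono fun q hq => hq.1)
  have z2 : dV g s (b, (B.u_m, B.v_m)) (spaceDir 0) = 0 :=
    fderiv_spaceDir_of_const (h.hasFDerivAt_V hz).differentiableAt (hev.mono fun q hq => hq.2)
  have h1 := (h.interface₂ hz hb.self_of_nhds 1 0 (by simpa using (B.d₁_pos _ B.u_m_mem).ne')).2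
  have h2 := (h.interface₂ hz hb.self_of_nhds 0 1 (by simpa using (B.d₂_pos _ B.v_m_mem).ne')).2
  simp only [map_add, map_smul, z1, z2, smul_eq_mul, one_mul, zero_mul, add_zero, zero_add] at h1 h2
  constructor
  · linear_combination h1
  · linear_combination h2

/-! ### Affine dependence on the unknowns -/

/-- By `exists_baseForm` the factor in the coefficient relations is 1 at all unknowns, not only on
the boundary values, so `hess_eq_zero` applies near any point of the domain. The radius is uniform
in `s`, which permits differentiation in `s` afterwards. -/
theorem exists_fibreForm (h : InvCurve B W g) {b₀ : Base} {y₀ : Fibre}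
    (hp₀ : (b₀, y₀) ∈ B.domain) :
    ∃ r > 0, ∀ s : ℝ, |s| < r → (s, (b₀, y₀)) ∈ W ∧ (∀ b ∈ Metric.ball b₀ r, BaseForm B g b₀ s b) ∧
      ∀ q ∈ Metric.ball y₀ r,
      ((g s).toFun (b₀, q)).2.1 = ((g s).toFun (b₀, y₀)).2.1
        + (q.1 - y₀.1) * dU g s (b₀, y₀) uDir + (q.2 - y₀.2) * dU g s (b₀, y₀) vDir ∧
      ((g s).toFun (b₀, q)).2.2 = ((g s).toFun (b₀, y₀)).2.2
        + (q.1 - y₀.1) * dV g s (b₀, y₀) uDir + (q.2 - y₀.2) * dV g s (b₀, y₀) vDir := by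
  have hz₀ := h.zero_mem _ hp₀
  have e1 := h.isOpen.eventually_mem hz₀
  have e2 : ∀ᶠ z : ℝ × Point in 𝓝 (0, (b₀, y₀)), dU g z.1 z.2 uDir ≠ 0 := by
    refine ((h.contDiffAt_dU hz₀).clm_apply contDiffAt_const).continuousAt.eventually_ne ?_
    rw [h.dU_zero hp₀]; simp [uDir]
  have e3 : ∀ᶠ z : ℝ × Point in 𝓝 (0, (b₀, y₀)), dV g z.1 z.2 vDir ≠ 0 := by
    refine ((h.contDiffAt_dV hz₀).clm_apply contDiffAt_const).continuousAt.eventually_ne ?_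
    rw [h.dV_zero hp₀]; simp [vDir]
  obtain ⟨r₁, hr₁, hball⟩ := Metric.eventually_nhds_iff_ball.1 (e1.and (e2.and e3))
  obtain ⟨r₂, hr₂, hbase⟩ := h.exists_baseForm hp₀.1
  have hr : 0 < min r₁ r₂ := lt_min hr₁ hr₂
  refine ⟨min r₁ r₂, hr, fun s hs => ?_⟩
  have hs1 := hs.trans_le (min_le_left _ _)
  have hs2 := hs.trans_le (min_le_right _ _)
  have hbf : ∀ b ∈ Metric.ball b₀ (min r₁ r₂), BaseForm B g b₀ s b := fun b hb =>
    (hbase s hs2 b (Metric.ball_subset_ball (min_le_right _ _) hb)).1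
  have hgood : ∀ p ∈ Metric.ball (b₀, y₀) (min r₁ r₂), (s, p) ∈ W ∧ dU g s p uDir ≠ 0 ∧
      dV g s p vDir ≠ 0 := by
    intro p hp
    refine hball (s, p) ?_
    rw [← ball_prod_same]
    exact ⟨by simpa using hs1, Metric.ball_subset_ball (min_le_left _ _) hp⟩
  have hself : (b₀, y₀) ∈ Metric.ball (b₀, y₀) (min r₁ r₂) := Metric.mem_ball_self hr
  refine ⟨(hgood _ hself).1, hbf, fun q hq => ?_⟩
  have hpb : ∀ p ∈ Metric.ball (b₀, y₀) (min r₁ r₂), p.1 ∈ Metric.ball b₀ (min r₁ r₂) := by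
    intro p hp
    rw [← ball_prod_same] at hp
    exact hp.1
  have hcond : ∀ p ∈ Metric.ball (b₀, y₀) (min r₁ r₂),
      CoefficientRelations (fun p => ((g s).toFun p).2.1) p B.d₁ B.d₁ B.d₂ 1 ∧
      CoefficientRelations (fun p => ((g s).toFun p).2.2) p B.d₂ B.d₁ B.d₂ 1 := by
    intro p hp
    have hb := hbf p.1 (hpb p hp)
    have a1 : 0 < 1 * (jac g s b₀ (1, 0)).1 := by rw [one_mul]; exact hb.pos
    have a2 : ∀ x y, inner ℝ (spacePart g s b₀ x) (spacePart g s b₀ y)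
        = 1 * (jac g s b₀ (1, 0)).1 * inner ℝ x y := by rw [one_mul]; exact hb.inner_eq
    have a3 : ∀ᶠ q in 𝓝 p.1, ∀ y, jac g s q (0, y) = (0, spacePart g s b₀ y) := by
      filter_upwards [Metric.isOpen_ball.mem_nhds (hpb p hp)] with q hq using (hbf q hq).jac_space
    exact ⟨h.coefficients_U (hgood p hp).1 hb.near a1 a2 hb.jac_time a3,
      h.coefficients_V (hgood p hp).1 hb.near a1 a2 hb.jac_time a3⟩
  have hsub : ∀ p ∈ Metric.ball (b₀, y₀) (min r₁ r₂), p ∈ B.domain := fun p hp =>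
    h.subset s p (hgood p hp).1
  have hmap : ∀ p ∈ Metric.ball (b₀, y₀) (min r₁ r₂), (g s).toFun p ∈ B.domain := fun p hp =>
    h.mapsTo s p (hgood p hp).1
  have D1 : ∀ x ∈ B.I₁, DifferentiableAt ℝ B.d₁ x := fun x hx =>
    (B.smooth_d₁.contDiffAt (B.isOpen_I₁.mem_nhds hx)).differentiableAt (by simp)
  have D2 : ∀ x ∈ B.I₂, DifferentiableAt ℝ B.d₂ x := fun x hx =>
    (B.smooth_d₂.contDiffAt (B.isOpen_I₂.mem_nhds hx)).differentiableAt (by simp)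
  let cu : Point →L[ℝ] ℝ := (ContinuousLinearMap.fst ℝ ℝ ℝ).comp (ContinuousLinearMap.snd ℝ Base Fibre)
  let cv : Point →L[ℝ] ℝ := (ContinuousLinearMap.snd ℝ ℝ ℝ).comp (ContinuousLinearMap.snd ℝ Base Fibre)
  have hU := hess_eq_zero (F := fun p => ((g s).toFun p).2.1) (y := cu) (z := cv) (Y := uDir)
    (Z := vDir) (d := B.d₁) (e := B.d₂) Metric.isOpen_ball
    (fun p hp => (h.contDiffAt_toFun (hgood p hp).1).snd.fst) rfl rfl rfl
    (fun p hp => D1 _ (hmap p hp).2.1) (fun p hp => D1 _ (hsub p hp).2.1)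
    (fun p hp => D2 _ (hsub p hp).2.2) (fun p hp => (B.d₁_pos _ (hmap p hp).2.1).ne')
    (fun p hp => (B.d₂_pos _ (hsub p hp).2.2).ne') (fun p hp => (hgood p hp).2.1)
    (fun p hp => by have := (hcond p hp).1.u; rwa [one_mul] at this)
    (fun p hp => by have := (hcond p hp).1.v; rwa [one_mul] at this)
    (fun p hp => by have := (hcond p hp).1.uu; rwa [one_mul] at this)
    (fun p hp => by have := (hcond p hp).1.vv; rwa [one_mul] at this)
    (fun p hp => (hcond p hp).1.uv)
  have hV := hess_eq_zero (F := fun p => ((g s).toFun p).2.2) (y := cv) (z := cu) (Y := vDir)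
    (Z := uDir) (d := B.d₂) (e := B.d₁) Metric.isOpen_ball
    (fun p hp => (h.contDiffAt_toFun (hgood p hp).1).snd.snd) rfl rfl rfl
    (fun p hp => D2 _ (hmap p hp).2.2) (fun p hp => D2 _ (hsub p hp).2.2)
    (fun p hp => D1 _ (hsub p hp).2.1) (fun p hp => (B.d₂_pos _ (hmap p hp).2.2).ne')
    (fun p hp => (B.d₁_pos _ (hsub p hp).2.1).ne') (fun p hp => (hgood p hp).2.2)
    (fun p hp => by have := (hcond p hp).2.v; rwa [one_mul] at this)
    (fun p hp => by have := (hcond p hp).2.u; rwa [one_mul] at this)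
    (fun p hp => by have := (hcond p hp).2.vv; rwa [one_mul] at this)
    (fun p hp => by have := (hcond p hp).2.uu; rwa [one_mul] at this)
    (fun p hp => by have := (hcond p hp).2.uv; linear_combination this)
  have hin : ∀ q ∈ Metric.ball y₀ (min r₁ r₂), (b₀, q) ∈ Metric.ball (b₀, y₀) (min r₁ r₂) := by
    intro q hq
    rw [← ball_prod_same]
    exact ⟨Metric.mem_ball_self hr, hq⟩
  exact ⟨affine_of_hess_eq_zero (F := fun p => ((g s).toFun p).2.1) Metric.isOpen_ball
      (convex_ball _ _).isPreconnected
      (fun q hq => (h.contDiffAt_toFun (hgood _ (hin q hq)).1).snd.fst)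
      (fun q hq => hU _ (hin q hq)) (Metric.mem_ball_self hr) hq,
    affine_of_hess_eq_zero (F := fun p => ((g s).toFun p).2.2) Metric.isOpen_ball
      (convex_ball _ _).isPreconnected
      (fun q hq => (h.contDiffAt_toFun (hgood _ (hin q hq)).1).snd.snd)
      (fun q hq => by obtain ⟨h1, h2, h3, h4⟩ := hV _ (hin q hq); exact ⟨h4, h3, h2, h1⟩)
      (Metric.mem_ball_self hr) hq⟩

end InvCurve

theorem hasDerivAt_clm_comp {E F : Type*} [NormedAddCommGroup E] [NormedSpace ℝ E]
    [NormedAddCommGroup F] [NormedSpace ℝ F] (l : E →L[ℝ] F) {f : ℝ → E} {f' : E} {s : ℝ}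
    (hf : HasDerivAt f f' s) : HasDerivAt (fun s => l (f s)) (l f') s :=
  l.hasFDerivAt.comp_hasDerivAt s hf

namespace InvCurve

variable {B : BVP} {W : Set (ℝ × Point)} {g : ℝ → PointTransformation}

/-! ### The velocity of a curve of invariance transformations -/

/-- The velocity at the identity. -/
noncomputable def vel (g : ℝ → PointTransformation) (p : Point) : Point :=
  deriv (fun s => (g s).toFun p) 0

theorem hasDerivAt_vel (h : InvCurve B W g) {p : Point} (hp : p ∈ B.domain) :
    HasDerivAt (fun s => (g s).toFun p) (vel g p) 0 := by
  have h1 : ContDiffAt ℝ ∞ (fun s : ℝ => (g s).toFun p) 0 :=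
    ContDiffAt.comp (f := fun s : ℝ => (s, p)) (0 : ℝ) (h.contDiffAt (h.zero_mem p hp))
      (contDiffAt_id.prodMk contDiffAt_const)
  exact (h1.differentiableAt (by simp)).hasDerivAt

theorem hasDerivAt_vel_u (h : InvCurve B W g) {p : Point} (hp : p ∈ B.domain) :
    HasDerivAt (fun s => ((g s).toFun p).2.1) (vel g p).2.1 0 :=
  hasDerivAt_clm_comp ((ContinuousLinearMap.fst ℝ ℝ ℝ).comp (ContinuousLinearMap.snd ℝ Base Fibre))
    (h.hasDerivAt_vel hp)

theorem hasDerivAt_vel_v (h : InvCurve B W g) {p : Point} (hp : p ∈ B.domain) :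
    HasDerivAt (fun s => ((g s).toFun p).2.2) (vel g p).2.2 0 :=
  hasDerivAt_clm_comp ((ContinuousLinearMap.snd ℝ ℝ ℝ).comp (ContinuousLinearMap.snd ℝ Base Fibre))
    (h.hasDerivAt_vel hp)

theorem hasDerivAt_vel_base (h : InvCurve B W g) {p : Point} (hp : p ∈ B.domain) :
    HasDerivAt (fun s => (g s).base p.1) (vel g p).1 0 :=
  hasDerivAt_clm_comp (ContinuousLinearMap.fst ℝ Base Fibre) (h.hasDerivAt_vel hp)

theorem eventually_abs_lt {r : ℝ} (hr : 0 < r) : ∀ᶠ s : ℝ in 𝓝 0, |s| < r := by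
  have := Metric.ball_mem_nhds (0 : ℝ) hr
  filter_upwards [this] with s hs
  simpa using hs

theorem locally_affine_of_family {F : ℝ → Fibre → ℝ} {η : Fibre → ℝ} {cu cv : ℝ → ℝ}
    {O : Set Fibre} (hO : IsOpen O) (hη : ∀ q ∈ O, HasDerivAt (fun s => F s q) (η q) 0)
    {y₀ : Fibre} (hy₀ : y₀ ∈ O) (hcu : DifferentiableAt ℝ cu 0) (hcv : DifferentiableAt ℝ cv 0)
    {r : ℝ} (hr : 0 < r) (h : ∀ s : ℝ, |s| < r → ∀ q ∈ Metric.ball y₀ r,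
      F s q = F s y₀ + (q.1 - y₀.1) * cu s + (q.2 - y₀.2) * cv s) :
    ∃ L : Fibre →L[ℝ] ℝ, ∀ᶠ q in 𝓝 y₀, η q = η y₀ + L (q - y₀) := by
  refine ⟨deriv cu 0 • ContinuousLinearMap.fst ℝ ℝ ℝ + deriv cv 0 • ContinuousLinearMap.snd ℝ ℝ ℝ, ?_⟩
  filter_upwards [hO.mem_nhds hy₀, Metric.ball_mem_nhds y₀ hr] with q hq hqr
  have h1 : HasDerivAt (fun s => F s q)
      (η y₀ + (q.1 - y₀.1) * deriv cu 0 + (q.2 - y₀.2) * deriv cv 0) 0 :=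
    (((hη y₀ hy₀).add (hcu.hasDerivAt.const_mul _)).add
      (hcv.hasDerivAt.const_mul _)).congr_of_eventuallyEq
      ((eventually_abs_lt hr).mono fun s hs => h s hs q hqr)
  rw [(hη q hq).unique h1]
  simp
  ring

theorem isPreconnected_fibres (B : BVP) : IsPreconnected (B.I₁ ×ˢ B.I₂) :=
  B.ordConnected_I₁.isPreconnected.prod B.ordConnected_I₂.isPreconnected

theorem differentiableAt_dU (h : InvCurve B W g) {p : Point} (hp : p ∈ B.domain) (x : Point) :
    DifferentiableAt ℝ (fun s => dU g s p x) 0 := by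
  have h1 : ContDiffAt ℝ ∞ (fun s : ℝ => dU g s p) 0 :=
    ContDiffAt.comp (g := fun z : ℝ × Point => dU g z.1 z.2) (f := fun s : ℝ => (s, p)) (0 : ℝ)
      (h.contDiffAt_dU (h.zero_mem p hp)) (contDiffAt_id.prodMk contDiffAt_const)
  exact (h1.clm_apply contDiffAt_const).differentiableAt (by simp)

theorem differentiableAt_dV (h : InvCurve B W g) {p : Point} (hp : p ∈ B.domain) (x : Point) :
    DifferentiableAt ℝ (fun s => dV g s p x) 0 := by
  have h1 : ContDiffAt ℝ ∞ (fun s : ℝ => dV g s p) 0 :=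
    ContDiffAt.comp (g := fun z : ℝ × Point => dV g z.1 z.2) (f := fun s : ℝ => (s, p)) (0 : ℝ)
      (h.contDiffAt_dV (h.zero_mem p hp)) (contDiffAt_id.prodMk contDiffAt_const)
  exact (h1.clm_apply contDiffAt_const).differentiableAt (by simp)

theorem vel_u_locally_affine (h : InvCurve B W g) {b : Base} (hb : B.tStar < b.1) {y : Fibre}
    (hy : y ∈ B.I₁ ×ˢ B.I₂) :
    ∃ L : Fibre →L[ℝ] ℝ, ∀ᶠ q in 𝓝 y, (vel g (b, q)).2.1 = (vel g (b, y)).2.1 + L (q - y) := by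
  have hp : (b, y) ∈ B.domain := ⟨hb, hy⟩
  obtain ⟨r, hr, hform⟩ := h.exists_fibreForm hp
  exact locally_affine_of_family (η := fun q => (vel g (b, q)).2.1) (B.isOpen_I₁.prod B.isOpen_I₂)
    (fun q hq => h.hasDerivAt_vel_u ⟨hb, hq⟩) hy (h.differentiableAt_dU hp uDir)
    (h.differentiableAt_dU hp vDir) hr fun s hs q hq => ((hform s hs).2.2 q hq).1

theorem vel_v_locally_affine (h : InvCurve B W g) {b : Base} (hb : B.tStar < b.1) {y : Fibre}
    (hy : y ∈ B.I₁ ×ˢ B.I₂) :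
    ∃ L : Fibre →L[ℝ] ℝ, ∀ᶠ q in 𝓝 y, (vel g (b, q)).2.2 = (vel g (b, y)).2.2 + L (q - y) := by
  have hp : (b, y) ∈ B.domain := ⟨hb, hy⟩
  obtain ⟨r, hr, hform⟩ := h.exists_fibreForm hp
  exact locally_affine_of_family (η := fun q => (vel g (b, q)).2.2) (B.isOpen_I₁.prod B.isOpen_I₂)
    (fun q hq => h.hasDerivAt_vel_v ⟨hb, hq⟩) hy (h.differentiableAt_dV hp uDir)
    (h.differentiableAt_dV hp vDir) hr fun s hs q hq => ((hform s hs).2.2 q hq).2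

/-- At `u = u_v` one has U = u_v, U_u = 1, U_v = 0, so the affine form of U near `(u_v, v_m)` is U =
u. Vanishing spreads over the connected fibre by `eq_zero_of_locally_affine`. -/
theorem vel_u_eq_zero (h : InvCurve B W g) {p : Point} (hp : p ∈ B.domain) :
    (vel g p).2.1 = 0 := by
  obtain ⟨b, y⟩ := p
  have hb : B.tStar < b.1 := hp.1
  have hO : IsOpen (B.I₁ ×ˢ B.I₂) := B.isOpen_I₁.prod B.isOpen_I₂
  have hp₀ := mem_reference hb
  obtain ⟨r, hr, hform⟩ := h.exists_fibreForm hp₀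
  obtain ⟨r', hr', hbase⟩ := h.exists_baseForm hb
  refine eq_zero_of_locally_affine (f := fun q => (vel g (b, q)).2.1) hO (isPreconnected_fibres B)
    (fun y hy => h.vel_u_locally_affine hb hy) hp₀.2 ?_ hp.2
  filter_upwards [hO.mem_nhds hp₀.2, Metric.ball_mem_nhds _ hr] with q hq hqr
  refine (h.hasDerivAt_vel_u (p := (b, q)) ⟨hb, hq⟩).unique
    ((hasDerivAt_const (0 : ℝ) q.1).congr_of_eventuallyEq ?_)
  filter_upwards [eventually_abs_lt hr, eventually_abs_lt hr'] with s hs hs'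
  obtain ⟨hb1, hW, hU⟩ := hbase s hs' b (Metric.mem_ball_self hr')
  rw [((hform s hs).2.2 q hqr).1, hU, h.fixes_u_v hW hb1.near]
  have : dU g s (b, (B.u_v, B.v_m)) vDir = 0 := h.dU_tangent hW hb1.near 0 1
  rw [this]
  ring

/-- With the affine forms, `derivatives_second` integrates to d₂(v_m)(V - v) = d₁(u_m)(U - u) near
`(u_m, v_m)`, and the right side has zero velocity by `vel_u_eq_zero`. -/
theorem vel_v_eq_zero (h : InvCurve B W g) {p : Point} (hp : p ∈ B.domain) :
    (vel g p).2.2 = 0 := by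
  obtain ⟨b, y⟩ := p
  have hb : B.tStar < b.1 := hp.1
  have hO : IsOpen (B.I₁ ×ˢ B.I₂) := B.isOpen_I₁.prod B.isOpen_I₂
  have hp₀ : ((b, (B.u_m, B.v_m)) : Point) ∈ B.domain := ⟨hb, B.u_m_mem, B.v_m_mem⟩
  obtain ⟨r, hr, hform⟩ := h.exists_fibreForm hp₀
  refine eq_zero_of_locally_affine (f := fun q => (vel g (b, q)).2.2) hO (isPreconnected_fibres B)
    (fun y hy => h.vel_v_locally_affine hb hy) hp₀.2 ?_ hp.2
  filter_upwards [hO.mem_nhds hp₀.2, Metric.ball_mem_nhds _ hr] with q hq hqr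
  have hqd : (b, q) ∈ B.domain := ⟨hb, hq⟩
  have h1 : HasDerivAt (fun s => B.d₂ B.v_m * (((g s).toFun (b, q)).2.2 - q.2))
      (B.d₂ B.v_m * (vel g (b, q)).2.2) 0 :=
    ((h.hasDerivAt_vel_v hqd).sub_const _).const_mul _
  have h2 : HasDerivAt (fun s => B.d₁ B.u_m * (((g s).toFun (b, q)).2.1 - q.1))
      (B.d₁ B.u_m * (vel g (b, q)).2.1) 0 :=
    ((h.hasDerivAt_vel_u hqd).sub_const _).const_mul _
  have h3 := h1.unique (h2.congr_of_eventuallyEq ?_)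
  · rw [h.vel_u_eq_zero hqd, mul_zero] at h3
    exact (mul_eq_zero.1 h3).resolve_left (B.d₂_pos _ B.v_m_mem).ne'
  · filter_upwards [eventually_abs_lt hr] with s hs
    obtain ⟨hW, hbf, haff⟩ := hform s hs
    obtain ⟨f1, f2⟩ := h.fixes_second hW (hbf b (Metric.mem_ball_self hr))
    obtain ⟨e1, e2⟩ := h.derivatives_second hW
      ((Metric.isOpen_ball.eventually_mem (Metric.mem_ball_self hr)).mono hbf)
    rw [(haff q hqr).1, (haff q hqr).2, f1, f2]
    linear_combination (q.1 - B.u_m) * e1 + (q.2 - B.v_m) * e2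

theorem base_affine (h : InvCurve B W g) {b₀ : Base} {r s : ℝ}
    (hf : ∀ b ∈ Metric.ball b₀ r, BaseForm B g b₀ s b ∧
      (s, (b, (B.u_v, B.v_m))) ∈ W ∧ dU g s (b, (B.u_v, B.v_m)) uDir = 1)
    {b : Base} (hb : b ∈ Metric.ball b₀ r) :
    (g s).base b = (g s).base b₀ + jac g s b₀ (b - b₀) := by
  have hr : 0 < r := Metric.pos_of_mem_ball hb
  refine eq_affine_of_fderiv_const Metric.isOpen_ball (convex_ball b₀ r).isPreconnected
    (fun x hx => ?_) (Metric.mem_ball_self hr) hb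
  rw [← (hf x hx).1.jac_eq]
  exact ((h.contDiffAt_base (hf x hx).2.1).differentiableAt (by simp)).hasFDerivAt

theorem differentiableAt_jac (h : InvCurve B W g) {b : Base} (hb : B.tStar < b.1) :
    DifferentiableAt ℝ (fun s => jac g s b) 0 := by
  have h1 : ContDiffAt ℝ ∞ (fun s : ℝ => jac g s b) 0 :=
    ContDiffAt.comp (g := fun z : ℝ × Base => jac g z.1 z.2) (f := fun s : ℝ => (s, b)) (0 : ℝ)
      (h.contDiffAt_jac (h.zero_mem _ (mem_reference hb))) (contDiffAt_id.prodMk contDiffAt_const)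
  exact h1.differentiableAt (by simp)

/-- The velocity of the transformations of `(t, x)`. -/
noncomputable def baseVel (g : ℝ → PointTransformation) (b : Base) : Base :=
  deriv (fun s => (g s).base b) 0

theorem hasDerivAt_baseVel (h : InvCurve B W g) {b : Base} (hb : B.tStar < b.1) :
    HasDerivAt (fun s => (g s).base b) (baseVel g b) 0 :=
  (h.hasDerivAt_vel_base (mem_reference hb)).differentiableAt.hasDerivAt

theorem baseVel_locally_affine (h : InvCurve B W g) {b₀ : Base} (hb₀ : B.tStar < b₀.1) :
    ∀ᶠ b in 𝓝 b₀, baseVel g b = baseVel g b₀ + deriv (fun s => jac g s b₀) 0 (b - b₀) := by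
  obtain ⟨r, hr, hform⟩ := h.exists_baseForm hb₀
  have hc : ∀ᶠ q : Base in 𝓝 b₀, B.tStar < q.1 :=
    continuous_fst.continuousAt.eventually (lt_mem_nhds hb₀)
  filter_upwards [hc, Metric.ball_mem_nhds b₀ hr] with b hb hbr
  refine (h.hasDerivAt_baseVel hb).unique ?_
  have h1 : HasDerivAt (fun s => jac g s b₀ (b - b₀))
      (deriv (fun s => jac g s b₀) 0 (b - b₀)) 0 :=
    hasDerivAt_clm_comp (ContinuousLinearMap.apply ℝ Base (b - b₀))
      (h.differentiableAt_jac hb₀).hasDerivAt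
  refine ((h.hasDerivAt_baseVel hb₀).add h1).congr_of_eventuallyEq ?_
  filter_upwards [eventually_abs_lt hr] with s hs
  exact h.base_affine (hform s hs) hbr

/-- The half-space `t > tStar` is connected, so local affinity is global there. -/
theorem baseVel_affine (h : InvCurve B W g) {b₀ b : Base} (hb₀ : B.tStar < b₀.1)
    (hb : B.tStar < b.1) :
    deriv (fun s => jac g s b) 0 = fderiv ℝ (baseVel g) b₀ ∧
      baseVel g b = baseVel g b₀ + fderiv ℝ (baseVel g) b₀ (b - b₀) := by
  have hO : IsOpen {q : Base | B.tStar < q.1} := isOpen_lt continuous_const continuous_fst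
  have hOc : IsPreconnected {q : Base | B.tStar < q.1} :=
    ((convex_Ioi B.tStar).linear_preimage (LinearMap.fst ℝ ℝ E3)).isPreconnected
  have h1 : ∀ q ∈ {q : Base | B.tStar < q.1}, HasFDerivAt (baseVel g) (fderiv ℝ (baseVel g) b₀) q :=
    fun q hq => hasFDerivAt_of_locally_affine hO hOc
      (fun x hx => ⟨_, h.baseVel_locally_affine hx⟩) hb₀ hq
  refine ⟨?_, eq_affine_of_fderiv_const hO hOc h1 hb₀ hb⟩
  refine HasFDerivAt.unique ?_ (h1 b hb)
  have h2 : HasFDerivAt (fun q => baseVel g b + deriv (fun s => jac g s b) 0 (q - b))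
      (deriv (fun s => jac g s b) 0) b :=
    ((deriv (fun s => jac g s b) 0).hasFDerivAt.comp b ((hasFDerivAt_id b).sub_const b)).const_add _
  exact h2.congr_of_eventuallyEq (h.baseVel_locally_affine hb)

/-- Linearisation of the identities of `BaseForm` at `s = 0`, where the Jacobian is the identity. -/
theorem baseVel_relations (h : InvCurve B W g) {b : Base} (hb : B.tStar < b.1)
    {L : Base →L[ℝ] Base} (hL : deriv (fun s => jac g s b) 0 = L) :
    (L (1, 0)).2 = 0 ∧ (∀ y, (L (0, y)).1 = 0) ∧
    (∀ y z, inner ℝ y (L (0, z)).2 + inner ℝ (L (0, y)).2 z = (L (1, 0)).1 * inner ℝ y z) ∧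
    (baseVel g b).1 • deriv B.Q b.1 + (L (1, 0)).1 • B.Q b.1 = (L (0, B.Q b.1)).2 := by
  obtain ⟨r, hr, hform⟩ := h.exists_baseForm hb
  have hev : ∀ᶠ s in 𝓝 (0 : ℝ), BaseForm B g b s b :=
    (eventually_abs_lt hr).mono fun s hs => (hform s hs b (Metric.mem_ball_self hr)).1
  have hJ : ∀ x, HasDerivAt (fun s => jac g s b x) (L x) 0 := fun x => by
    rw [← hL]
    exact hasDerivAt_clm_comp (ContinuousLinearMap.apply ℝ Base x)
      (h.differentiableAt_jac hb).hasDerivAt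
  have hJ1 : ∀ x, HasDerivAt (fun s => (jac g s b x).1) (L x).1 0 := fun x =>
    hasDerivAt_clm_comp (ContinuousLinearMap.fst ℝ ℝ E3) (hJ x)
  have hJ2 : ∀ x, HasDerivAt (fun s => (jac g s b x).2) (L x).2 0 := fun x =>
    hasDerivAt_clm_comp (ContinuousLinearMap.snd ℝ ℝ E3) (hJ x)
  have hj0 := h.jac_zero hb
  refine ⟨?_, fun y => ?_, fun y z => ?_, ?_⟩
  · exact (hJ2 _).unique ((hasDerivAt_const _ _).congr_of_eventuallyEq (hev.mono fun s hs => hs.time))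
  · exact (hJ1 _).unique
      ((hasDerivAt_const _ _).congr_of_eventuallyEq (hev.mono fun s hs => hs.space y))
  · have h1 := (hJ2 (0, y)).inner ℝ (hJ2 (0, z))
    have h2 := (hJ1 (1, 0)).mul_const (inner ℝ y z)
    have h3 := h1.unique (h2.congr_of_eventuallyEq (hev.mono fun s hs => hs.inner_eq y z))
    simpa [hj0] using h3
  · have hQ : HasDerivAt B.Q (deriv B.Q b.1) b.1 :=
      ((B.smooth_Q.contDiffAt (isOpen_Ioi.mem_nhds hb)).differentiableAt (by simp)).hasDerivAt
    have h0 : HasDerivAt (fun s => ((g s).base b).1) (baseVel g b).1 0 :=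
      hasDerivAt_clm_comp (ContinuousLinearMap.fst ℝ ℝ E3) (h.hasDerivAt_baseVel hb)
    have h1 : HasDerivAt (fun s => B.Q ((g s).base b).1) ((baseVel g b).1 • deriv B.Q b.1) 0 := by
      refine HasDerivAt.scomp (h := fun s => ((g s).base b).1) (0 : ℝ) ?_ h0
      simpa [h.base_zero hb] using hQ
    have h2 := (hJ1 (1, 0)).smul h1
    have h3 := h2.unique ((hJ2 (0, B.Q b.1)).congr_of_eventuallyEq (hev.mono fun s hs => hs.flux))
    simpa [hj0, h.base_zero hb] using h3

/-- The velocity of a curve of invariance transformations. -/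
theorem exists_velocity (h : InvCurve B W g) :
    ∃ (κ₀ κ₁ : ℝ) (A : E3 →L[ℝ] E3) (y₀ : E3), (∀ x y, inner ℝ (A x) y = -inner ℝ x (A y)) ∧
      (∀ p ∈ B.domain, vel g p
        = ((κ₀ + 2 * κ₁ * p.1.1, κ₁ • p.1.2 + A p.1.2 + y₀), ((0, 0) : Fibre))) ∧
      ∀ t, B.tStar < t → (κ₀ + 2 * κ₁ * t) • deriv B.Q t = A (B.Q t) - κ₁ • B.Q t := by
  set b₀ : Base := (B.tStar + 1, 0) with hb₀
  have ht₀ : B.tStar < b₀.1 := by simp [hb₀]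
  set L := fderiv ℝ (baseVel g) b₀ with hL
  obtain ⟨r1, r2, r3, -⟩ := h.baseVel_relations ht₀ (h.baseVel_affine ht₀ ht₀).1
  set m := (L (1, 0)).1 with hm
  let M : E3 →L[ℝ] E3 :=
    (ContinuousLinearMap.snd ℝ ℝ E3).comp (L.comp (ContinuousLinearMap.inr ℝ ℝ E3))
  have hM : ∀ y, (L (0, y)).2 = M y := fun y => rfl
  simp only [← hL, hM] at r3
  have hval : ∀ b : Base, B.tStar < b.1 → baseVel g b
      = ((baseVel g b₀).1 + (b.1 - b₀.1) * m, (baseVel g b₀).2 + M b.2) := by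
    intro b hb
    rw [(h.baseVel_affine ht₀ hb).2]
    have : b - b₀ = (b.1 - b₀.1) • ((1, 0) : Base) + (0, b.2) := by
      ext <;> simp [hb₀]
    rw [this, map_add, map_smul]
    refine Prod.ext ?_ ?_
    · have := r2 b.2
      simp only [Prod.fst_add, Prod.smul_fst, smul_eq_mul]
      rw [this, hm]; ring
    · simp only [Prod.snd_add, Prod.smul_snd]
      rw [r1, smul_zero, zero_add]; rfl
  -- Time grows at rate `m` and squared lengths at the same rate, so lengths grow at rate `m / 2`;
  -- what remains of `M` is skew.
  refine ⟨(baseVel g b₀).1 - b₀.1 * m, m / 2, M - (m / 2) • ContinuousLinearMap.id ℝ E3,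
    (baseVel g b₀).2, fun x y => ?_, fun p hp => ?_, fun t ht => ?_⟩
  · have := r3 x y
    simp only [sub_apply, smul_apply, ContinuousLinearMap.id_apply,
      inner_sub_left, inner_sub_right, real_inner_smul_left, real_inner_smul_right]
    linarith
  · have hb : B.tStar < p.1.1 := hp.1
    have h1 : (vel g p).1 = baseVel g p.1 :=
      (h.hasDerivAt_vel_base hp).unique (h.hasDerivAt_baseVel hb)
    refine Prod.ext ?_ (Prod.ext (h.vel_u_eq_zero hp) (h.vel_v_eq_zero hp))
    rw [h1, hval _ hb]
    refine Prod.ext ?_ ?_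
    · simp only; ring
    · simp [add_comm]
  · obtain ⟨-, -, -, r4⟩ := h.baseVel_relations (b := (t, 0)) ht (h.baseVel_affine ht₀ ht).1
    rw [hval (t, 0) ht] at r4
    simp only [← hL, hM] at r4
    have e : (baseVel g b₀).1 - b₀.1 * m + 2 * (m / 2) * t
        = (baseVel g b₀).1 + (t - b₀.1) * m := by ring
    rw [e]
    have r4' : ((baseVel g b₀).1 + (t - b₀.1) * m) • deriv B.Q t = M (B.Q t) - m • B.Q t := by
      rw [← r4, hm]; simp
    rw [r4', sub_apply, smul_apply, ContinuousLinearMap.id_apply,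
      sub_sub, ← add_smul, add_halves]

end InvCurve

/-! ### Groups of invariance -/

/-- A parameter axis need not be a one-parameter subgroup. Smoothness, the identity at 0 and
invariance are all that is inherited, and its velocity is the generator. -/
theorem invCurve_of_group {B : BVP} {N : ℕ} {W : Set ((Fin N → ℝ) × Point)} {G : Family N}
    (hG : IsLocalTransformationGroup B.domain W G) (hB : B.InvariantUnder W G) (i : Fin N) :
    InvCurve B {z | (Pi.single i z.1, z.2) ∈ W} (fun s => G (Pi.single i s)) := by
  obtain ⟨L, hL⟩ := hG
  have hc : ContDiff ℝ ∞ (fun z : ℝ × Point => ((Pi.single i z.1, z.2) : (Fin N → ℝ) × Point)) := by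
    refine ContDiff.prodMk ?_ contDiff_snd
    exact (ContinuousLinearMap.single ℝ (fun _ : Fin N => ℝ) i).contDiff.comp contDiff_fst
  refine ⟨hL.isOpen.preimage hc.continuous, fun s p hp => (hL.subset hp).2,
    fun s p hp => hL.mapsTo _ _ hp, fun p hp => ?_,
    hL.smooth.comp hc.contDiffOn fun z hz => hz, fun p hp => ?_,
    fun s b w w' hz => hB.equations _ b w w' hz, fun s b w w' S S' hz => hB.surface₁ _ b w w' S S' hz,
    fun s b w w' S S' hz => hB.surface₂ _ b w w' S S' hz⟩
  · simpa using hL.zero_mem p hp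
  · simpa using hL.zero p hp

/-- The generators of the groups of invariance. -/
theorem generator_form {B : BVP} {N : ℕ} {W : Set ((Fin N → ℝ) × Point)} {G : Family N}
    (hG : IsLocalTransformationGroup B.domain W G) (hB : B.InvariantUnder W G) (i : Fin N) :
    ∃ (κ₀ κ₁ : ℝ) (A : E3 →L[ℝ] E3) (y₀ : E3), (∀ x y, inner ℝ (A x) y = -inner ℝ x (A y)) ∧
      (∀ p ∈ B.domain, G.generator i p
        = ((κ₀ + 2 * κ₁ * p.1.1, κ₁ • p.1.2 + A p.1.2 + y₀), ((0, 0) : Fibre))) ∧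
      ∀ t, B.tStar < t → (κ₀ + 2 * κ₁ * t) • deriv B.Q t = A (B.Q t) - κ₁ • B.Q t :=
  (invCurve_of_group hG hB i).exists_velocity

/-! ### Skew maps and rotations -/

/-- Skew-symmetric linear maps. -/
def IsSkew (A : E3 →L[ℝ] E3) : Prop := ∀ x y, inner ℝ (A x) y = -inner ℝ x (A y)

theorem IsSkew.inner_self {A : E3 →L[ℝ] E3} (hA : IsSkew A) (x : E3) : inner ℝ (A x) x = 0 := by
  have := hA x x
  rw [real_inner_comm (A x) x] at this
  linarith

theorem isSkew_rotGen : IsSkew rotGen := fun x y => by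
  simp only [inner_E3, rotGen_apply]
  simp

theorem IsSkew.smul {A : E3 →L[ℝ] E3} (hA : IsSkew A) (r : ℝ) : IsSkew (r • A) := fun x y => by
  rw [smul_apply, smul_apply, real_inner_smul_left, real_inner_smul_right, hA]
  ring

theorem IsSkew.sub {A C : E3 →L[ℝ] E3} (hA : IsSkew A) (hC : IsSkew C) : IsSkew (A - C) :=
  fun x y => by
    rw [sub_apply, sub_apply, inner_sub_left, inner_sub_right, hA, hC]
    ring

/-- Conjugation by an isometry. -/
noncomputable def conjBy (R : E3 ≃ₗᵢ[ℝ] E3) (A : E3 →L[ℝ] E3) : E3 →L[ℝ] E3 :=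
  (R.toContinuousLinearEquiv : E3 →L[ℝ] E3).comp
    (A.comp (R.symm.toContinuousLinearEquiv : E3 →L[ℝ] E3))

theorem conjBy_apply (R : E3 ≃ₗᵢ[ℝ] E3) (A : E3 →L[ℝ] E3) (x : E3) :
    conjBy R A x = R (A (R.symm x)) := rfl

theorem IsSkew.conj {A : E3 →L[ℝ] E3} (hA : IsSkew A) (R : E3 ≃ₗᵢ[ℝ] E3) :
    IsSkew (conjBy R A) := fun x y => by
  rw [conjBy_apply, conjBy_apply, ← R.symm.inner_map_map, R.symm_apply_apply, hA,
    ← R.inner_map_map (R.symm x), R.apply_symm_apply]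

theorem conjBy_ne_zero {A : E3 →L[ℝ] E3} (hA : A ≠ 0) (R : E3 ≃ₗᵢ[ℝ] E3) : conjBy R A ≠ 0 := by
  intro h
  refine hA (ContinuousLinearMap.ext fun x => ?_)
  have := congrArg (fun L => R.symm (L (R x))) h
  simpa [conjBy_apply] using this

theorem e3_decomp (x : E3) : x = x 0 • (!₂[1, 0, 0] : E3) + x 1 • (!₂[0, 1, 0] : E3)
    + x 2 • (!₂[0, 0, 1] : E3) := by
  ext i; fin_cases i <;> simp

/-- The coordinate form of a skew map. -/
theorem IsSkew.exists_coords {A : E3 →L[ℝ] E3} (hA : IsSkew A) : ∃ a b c : ℝ, ∀ x : E3,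
    A x = !₂[a * x 1 + b * x 2, -a * x 0 + c * x 2, -b * x 0 - c * x 1] := by
  have h00 := hA !₂[1, 0, 0] !₂[1, 0, 0]
  have h11 := hA !₂[0, 1, 0] !₂[0, 1, 0]
  have h22 := hA !₂[0, 0, 1] !₂[0, 0, 1]
  have h01 := hA !₂[1, 0, 0] !₂[0, 1, 0]
  have h02 := hA !₂[1, 0, 0] !₂[0, 0, 1]
  have h12 := hA !₂[0, 1, 0] !₂[0, 0, 1]
  simp only [inner_E3] at h00 h11 h22 h01 h02 h12
  simp at h00 h11 h22 h01 h02 h12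
  refine ⟨A !₂[0, 1, 0] 0, A !₂[0, 0, 1] 0, A !₂[0, 0, 1] 1, fun x => ?_⟩
  conv_lhs => rw [e3_decomp x, map_add, map_add, map_smul, map_smul, map_smul]
  ext i
  fin_cases i
  · simp; linear_combination x 0 * (1 / 2) * h00
  · simp; linear_combination x 0 * h01 + x 1 * (1 / 2) * h11
  · simp; linear_combination x 0 * h02 + x 1 * h12 + x 2 * (1 / 2) * h22

theorem IsSkew.eq_smul_rotGen {A : E3 →L[ℝ] E3} (hA : IsSkew A) {r : ℝ} (hr : r ≠ 0)
    (h : A !₂[0, 0, r] = 0) : ∃ θ : ℝ, A = θ • rotGen := by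
  obtain ⟨a, b, c, hf⟩ := hA.exists_coords
  rw [hf] at h
  have h0 := congrArg (fun z : E3 => z 0) h
  have h1 := congrArg (fun z : E3 => z 1) h
  simp [hr] at h0 h1
  refine ⟨a, ContinuousLinearMap.ext fun x => ?_⟩
  rw [hf, smul_apply, rotGen_apply, h0, h1]
  ext i; fin_cases i <;> simp

theorem IsSkew.exists_axis {A : E3 →L[ℝ] E3} (hA : IsSkew A) (h0 : A ≠ 0) :
    ∃ n : E3, n ≠ 0 ∧ A n = 0 := by
  obtain ⟨a, b, c, hf⟩ := hA.exists_coords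
  -- In these coordinates `A x` is the cross product of `x` with this vector.
  refine ⟨!₂[c, -b, a], fun h => h0 (ContinuousLinearMap.ext fun x => ?_), ?_⟩
  · have e0 := congrArg (fun z : E3 => z 0) h
    have e1 := congrArg (fun z : E3 => z 1) h
    have e2 := congrArg (fun z : E3 => z 2) h
    simp at e0 e1 e2
    rw [hf, e0, e1, e2]
    ext i; fin_cases i <;> simp
  · rw [hf]
    ext i; fin_cases i <;> simp <;> ring

/-- A skew map which vanishes on two vectors in different planes through the axis. -/
theorem IsSkew.eq_zero {A : E3 →L[ℝ] E3} (hA : IsSkew A) {x : E3} (h1 : A x = 0)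
    (h2 : A (rotGen x) = 0) (hx : x 0 ^ 2 + x 1 ^ 2 ≠ 0) : A = 0 := by
  obtain ⟨a, b, c, hf⟩ := hA.exists_coords
  rw [hf] at h1 h2
  have e0 := congrArg (fun z : E3 => z 0) h1
  have e1 := congrArg (fun z : E3 => z 1) h1
  have e2 := congrArg (fun z : E3 => z 2) h1
  have f0 := congrArg (fun z : E3 => z 0) h2
  have f1 := congrArg (fun z : E3 => z 1) h2
  have f2 := congrArg (fun z : E3 => z 2) h2
  simp [rotGen_apply] at e0 e1 e2 f0 f1 f2
  have ha : a = 0 := by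
    refine (mul_eq_zero.1 (?_ : a * (x 0 ^ 2 + x 1 ^ 2) = 0)).resolve_right hx
    rcases f0 with h | h <;> rcases f1 with h' | h' <;> simp [h, h']
  have hb : b = 0 := by
    refine (mul_eq_zero.1 (?_ : b * (x 0 ^ 2 + x 1 ^ 2) = 0)).resolve_right hx
    linear_combination -x 0 * e2 - x 1 * f2
  have hc : c = 0 := by
    refine (mul_eq_zero.1 (?_ : c * (x 0 ^ 2 + x 1 ^ 2) = 0)).resolve_right hx
    linear_combination x 0 * f2 - x 1 * e2
  refine ContinuousLinearMap.ext fun y => ?_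
  rw [hf, ha, hb, hc]
  ext i; fin_cases i <;> simp

/-! ### Rotations carrying the third axis to a given line. -/

/-- The isometry of a rotation matrix. -/
noncomputable def matIso (M : Matrix.specialOrthogonalGroup (Fin 3) ℝ) : E3 ≃ₗᵢ[ℝ] E3 where
  toFun x := WithLp.toLp 2 (M.1.mulVec x.ofLp)
  invFun x := WithLp.toLp 2 (M.1.transpose.mulVec x.ofLp)
  map_add' x y := by rw [WithLp.ofLp_add, Matrix.mulVec_add, WithLp.toLp_add]
  map_smul' r x := by rw [WithLp.ofLp_smul, Matrix.mulVec_smul, WithLp.toLp_smul]; rfl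
  left_inv x := by
    have h : M.1.transpose * M.1 = 1 :=
      (Matrix.mem_orthogonalGroup_iff' (Fin 3) ℝ).1 (Matrix.mem_specialOrthogonalGroup_iff.1 M.2).1
    simp [Matrix.mulVec_mulVec, h]
  right_inv x := by
    have h : M.1 * M.1.transpose = 1 :=
      (Matrix.mem_orthogonalGroup_iff (Fin 3) ℝ).1 (Matrix.mem_specialOrthogonalGroup_iff.1 M.2).1
    simp [Matrix.mulVec_mulVec, h]
  norm_map' x := by
    have h : M.1.transpose * M.1 = 1 :=
      (Matrix.mem_orthogonalGroup_iff' (Fin 3) ℝ).1 (Matrix.mem_specialOrthogonalGroup_iff.1 M.2).1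
    have h1 : ∀ y : E3, ‖y‖ ^ 2 = y.ofLp ⬝ᵥ y.ofLp := fun y => by
      rw [EuclideanSpace.real_norm_sq_eq, dotProduct]
      exact Finset.sum_congr rfl fun i _ => sq _
    refine (sq_eq_sq₀ (norm_nonneg _) (norm_nonneg _)).1 ?_
    change ‖(WithLp.toLp 2 (M.1.mulVec x.ofLp) : E3)‖ ^ 2 = ‖x‖ ^ 2
    rw [h1, h1, Matrix.dotProduct_mulVec, Matrix.vecMul_mulVec, h, Matrix.vecMul_one]

theorem matIso_apply (M : Matrix.specialOrthogonalGroup (Fin 3) ℝ) (x : E3) :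
    matIso M x = WithLp.toLp 2 (M.1.mulVec x.ofLp) := rfl

theorem matIso_one (x : E3) : matIso 1 x = x := by simp [matIso_apply]

/-- The matrix is the rotation along the great circle from the third basis vector to `(a, b, c)`.
Its coefficient `k = 1 / (1 + c)` is singular only at the antipode, which `0 ≤ c` avoids. -/
theorem exists_rotation_unit {a b c : ℝ} (h : a ^ 2 + b ^ 2 + c ^ 2 = 1) (hc : 0 ≤ c) :
    ∃ M : Matrix.specialOrthogonalGroup (Fin 3) ℝ, matIso M !₂[0, 0, 1] = !₂[a, b, c] := by
  obtain ⟨k, hk⟩ : ∃ k : ℝ, k * (1 + c) = 1 := ⟨(1 + c)⁻¹, inv_mul_cancel₀ (by linarith)⟩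
  have hab : k * (a ^ 2 + b ^ 2) = 1 - c := by linear_combination k * h + (1 - c) * hk
  let M : Matrix (Fin 3) (Fin 3) ℝ :=
    !![1 - k * a ^ 2, -k * a * b, a; -k * a * b, 1 - k * b ^ 2, b; -a, -b, c]
  have hM : M ∈ Matrix.specialOrthogonalGroup (Fin 3) ℝ := by
    rw [Matrix.mem_specialOrthogonalGroup_iff]
    constructor
    · rw [Matrix.mem_orthogonalGroup_iff]
      ext i j
      fin_cases i <;> fin_cases j <;>
        simp [M, Matrix.mul_apply, Fin.sum_univ_three]
      · linear_combination (k * a ^ 2) * hab - a ^ 2 * hk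
      · linear_combination (k * a * b) * hab - a * b * hk
      · linear_combination a * hab
      · linear_combination (k * a * b) * hab - a * b * hk
      · linear_combination (k * b ^ 2) * hab - b ^ 2 * hk
      · linear_combination b * hab
      · linear_combination a * hab
      · linear_combination b * hab
      · linear_combination h
    · rw [Matrix.det_fin_three]
      simp [M]
      linear_combination h - hab * c
  refine ⟨⟨M, hM⟩, ?_⟩
  rw [matIso_apply]
  ext i
  fin_cases i <;> simp [M, Matrix.mulVec, dotProduct, Fin.sum_univ_three]

theorem exists_rotation (n : E3) : ∃ M : Matrix.specialOrthogonalGroup (Fin 3) ℝ, ∃ r : ℝ,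
    n = matIso M !₂[0, 0, r] := by
  have hr : ∀ r : ℝ, (!₂[0, 0, r] : E3) = r • !₂[0, 0, 1] := fun r => by
    ext i; fin_cases i <;> simp
  by_cases hn : n = 0
  · exact ⟨1, 0, by rw [hr, zero_smul, map_zero, hn]⟩
  have hn' : ‖n‖ ≠ 0 := norm_ne_zero_iff.2 hn
  have hsq : n 0 ^ 2 + n 1 ^ 2 + n 2 ^ 2 = ‖n‖ ^ 2 := by
    rw [EuclideanSpace.real_norm_sq_eq, Fin.sum_univ_three]
  -- A sign moves `n` to the closed upper hemisphere; it is returned to the scalar `r`, which may be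
  -- negative.
  obtain ⟨σ, hσ, hσn⟩ : ∃ σ : ℝ, σ * σ = 1 ∧ 0 ≤ σ * n 2 := by
    rcases le_total 0 (n 2) with h | h
    · exact ⟨1, by norm_num, by linarith⟩
    · exact ⟨-1, by norm_num, by linarith⟩
  have hc : 0 ≤ σ * n 2 / ‖n‖ := div_nonneg hσn (norm_nonneg _)
  obtain ⟨M, hM⟩ := exists_rotation_unit (a := σ * n 0 / ‖n‖) (b := σ * n 1 / ‖n‖)
    (c := σ * n 2 / ‖n‖) (by
      field_simp
      linear_combination σ ^ 2 * hsq + ‖n‖ ^ 2 * hσ) hc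
  refine ⟨M, σ * ‖n‖, ?_⟩
  rw [hr, map_smul, hM]
  ext i
  fin_cases i <;> simp <;> field_simp
  · linear_combination (-n 0) * hσ
  · linear_combination (-n 1) * hσ
  · linear_combination (-n 2) * hσ

theorem IsSkew.exists_rotation {A : E3 →L[ℝ] E3} (hA : IsSkew A) :
    ∃ M : Matrix.specialOrthogonalGroup (Fin 3) ℝ, ∃ θ : ℝ, A = conjBy (matIso M) (θ • rotGen) := by
  by_cases h0 : A = 0
  · refine ⟨1, 0, ?_⟩
    ext x : 1
    rw [h0, conjBy_apply]; simp
  obtain ⟨n, hn, hAn⟩ := hA.exists_axis h0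
  obtain ⟨M, r, hr⟩ := StefanBVP.exists_rotation n
  have hr0 : r ≠ 0 := by
    rintro rfl
    refine hn (hr.trans ?_)
    have : (!₂[0, 0, 0] : E3) = 0 := by ext i; fin_cases i <;> simp
    rw [this, map_zero]
  obtain ⟨θ, hθ⟩ := (hA.conj (matIso M).symm).eq_smul_rotGen hr0 (by
    rw [conjBy_apply, LinearIsometryEquiv.symm_symm, ← hr, hAn, map_zero])
  refine ⟨M, θ, ?_⟩
  rw [← hθ]
  ext x : 1
  simp [conjBy_apply]

/-! ### Infinitesimal symmetries of the flux -/

theorem eq_of_hasDerivAt_zero {E : Type*} [NormedAddCommGroup E] [NormedSpace ℝ E] {f : ℝ → E}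
    {tS : ℝ} (h : ∀ t, tS < t → HasDerivAt f 0 t) {t : ℝ} (ht : tS < t) : f t = f (tS + 1) :=
  isOpen_Ioi.is_const_of_fderiv_eq_zero (𝕜 := ℝ) isPreconnected_Ioi
    (fun t ht => (h t ht).differentiableAt.differentiableWithinAt)
    (fun t ht => by
      ext
      simpa using (h t ht).deriv)
    (Set.mem_Ioi.2 ht) (Set.mem_Ioi.2 (lt_add_one tS))

/-- The flux is differentiable and does not vanish. -/
def IsFlux (Q : ℝ → E3) (tS : ℝ) : Prop :=
  ∀ t, tS < t → DifferentiableAt ℝ Q t ∧ Q t ≠ 0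

/-- The infinitesimal symmetry of the flux with time part `κ₀ + 2 κ₁ t`, scaling `κ₁` and
rotation `A`. -/
def FluxSym (Q : ℝ → E3) (tS κ₀ κ₁ : ℝ) (A : E3 →L[ℝ] E3) : Prop :=
  IsSkew A ∧ ∀ t, tS < t → (κ₀ + 2 * κ₁ * t) • deriv Q t = A (Q t) - κ₁ • Q t

theorem BVP.isFlux (B : BVP) : IsFlux B.Q B.tStar := fun t ht =>
  ⟨(B.smooth_Q.contDiffAt (isOpen_Ioi.mem_nhds ht)).differentiableAt (by simp), B.Q_ne_zero t ht⟩

section Transport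

variable {Q Q' : ℝ → E3} {tS tS' α γ : ℝ} {R : E3 ≃ₗᵢ[ℝ] E3}

theorem hasDerivAt_transport (hQ : IsFlux Q tS) (hα : 0 < α)
    (h : ∀ t, tS < t → Q' (α * t + γ) = R (Q t)) {t : ℝ} (ht : tS < t) :
    HasDerivAt Q' (α⁻¹ • R (deriv Q t)) (α * t + γ) := by
  have h1 : HasDerivAt (fun τ => (τ - γ) * α⁻¹) α⁻¹ (α * t + γ) := by
    simpa using ((hasDerivAt_id (α * t + γ)).sub_const γ).mul_const α⁻¹
  have hv : (α * t + γ - γ) * α⁻¹ = t := by field_simp; ring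
  have h2 : HasDerivAt Q (deriv Q t) ((α * t + γ - γ) * α⁻¹) := by
    rw [hv]; exact (hQ t ht).1.hasDerivAt
  have h3 : HasDerivAt (fun τ => Q ((τ - γ) * α⁻¹)) (α⁻¹ • deriv Q t) (α * t + γ) :=
    HasDerivAt.scomp (h := fun τ => (τ - γ) * α⁻¹) (α * t + γ) h2 h1
  have h4 : HasDerivAt (fun τ => R (Q ((τ - γ) * α⁻¹))) (α⁻¹ • R (deriv Q t)) (α * t + γ) := by
    rw [← map_smul]
    exact hasDerivAt_clm_comp (R.toContinuousLinearEquiv : E3 →L[ℝ] E3) h3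
  refine h4.congr_of_eventuallyEq ?_
  have : α * tS + γ < α * t + γ := by nlinarith
  filter_upwards [lt_mem_nhds this] with τ hτ
  have h5 : tS < (τ - γ) * α⁻¹ := by
    rw [← div_eq_mul_inv, lt_div_iff₀ hα]; linarith
  rw [← h _ h5]
  congr 1
  field_simp
  ring

theorem exists_time (hα : 0 < α) (htS : tS' = α * tS + γ) {t : ℝ} (ht : tS' < t) :
    ∃ τ, tS < τ ∧ t = α * τ + γ := by
  refine ⟨(t - γ) / α, ?_, by field_simp; ring⟩
  rw [lt_div_iff₀ hα]; linarith

theorem IsFlux.transport (hQ : IsFlux Q tS) (hα : 0 < α) (htS : tS' = α * tS + γ)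
    (h : ∀ t, tS < t → Q' (α * t + γ) = R (Q t)) : IsFlux Q' tS' := by
  intro t ht
  obtain ⟨τ, hτ, rfl⟩ := exists_time hα htS ht
  refine ⟨(hasDerivAt_transport hQ hα h hτ).differentiableAt, ?_⟩
  rw [h τ hτ]
  exact (map_ne_zero_iff _ R.injective).2 (hQ τ hτ).2

/-- In the new time the vector field `κ₀ + 2κ₁t` becomes `ακ₀ - 2κ₁γ + 2κ₁t'`; the rotation
conjugates `A`. -/
theorem FluxSym.transport (hQ : IsFlux Q tS) (hα : 0 < α) (htS : tS' = α * tS + γ)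
    (h : ∀ t, tS < t → Q' (α * t + γ) = R (Q t)) {κ₀ κ₁ : ℝ} {A : E3 →L[ℝ] E3}
    (hS : FluxSym Q tS κ₀ κ₁ A) :
    FluxSym Q' tS' (α * κ₀ - 2 * κ₁ * γ) κ₁ (conjBy R A) := by
  refine ⟨hS.1.conj R, fun t ht => ?_⟩
  obtain ⟨τ, hτ, rfl⟩ := exists_time hα htS ht
  rw [(hasDerivAt_transport hQ hα h hτ).deriv, h τ hτ, smul_smul, conjBy_apply,
    R.symm_apply_apply, ← map_smul, ← map_smul, ← map_sub, ← hS.2 τ hτ]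
  congr 2
  field_simp
  ring

theorem transport_symm (hα : 0 < α) (htS : tS' = α * tS + γ)
    (h : ∀ t, tS < t → Q' (α * t + γ) = R (Q t)) :
    0 < α⁻¹ ∧ tS = α⁻¹ * tS' + -(α⁻¹ * γ) ∧
      ∀ t, tS' < t → Q (α⁻¹ * t + -(α⁻¹ * γ)) = R.symm (Q' t) := by
  refine ⟨inv_pos.2 hα, by rw [htS]; field_simp; ring, fun t ht => ?_⟩
  obtain ⟨τ, hτ, rfl⟩ := exists_time hα htS ht
  rw [h τ hτ, R.symm_apply_apply]
  congr 1
  field_simp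
  ring

end Transport

/-- There is a rotational symmetry which fixes the time. -/
def HasRotation (Q : ℝ → E3) (tS : ℝ) : Prop := ∃ A, A ≠ 0 ∧ FluxSym Q tS 0 0 A

/-- There is a symmetry which scales. -/
def HasScaling (Q : ℝ → E3) (tS : ℝ) : Prop := ∃ κ₀ κ₁ A, κ₁ ≠ 0 ∧ FluxSym Q tS κ₀ κ₁ A

/-- There is a symmetry which translates the time. -/
def HasTranslation (Q : ℝ → E3) (tS : ℝ) : Prop := ∃ κ₀ A, κ₀ ≠ 0 ∧ FluxSym Q tS κ₀ 0 A

section Invariants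

variable {Q Q' : ℝ → E3} {tS tS' α γ : ℝ} {R : E3 ≃ₗᵢ[ℝ] E3}

theorem invariants_mp (hQ : IsFlux Q tS) (hα : 0 < α) (htS : tS' = α * tS + γ)
    (h : ∀ t, tS < t → Q' (α * t + γ) = R (Q t)) :
    (HasRotation Q tS → HasRotation Q' tS') ∧ (HasScaling Q tS → HasScaling Q' tS') ∧
      (HasTranslation Q tS → HasTranslation Q' tS') := by
  refine ⟨?_, ?_, ?_⟩
  · rintro ⟨A, hA, hS⟩
    have := hS.transport hQ hα htS h
    rw [mul_zero, mul_zero, zero_mul, sub_zero] at this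
    exact ⟨_, conjBy_ne_zero hA R, this⟩
  · rintro ⟨κ₀, κ₁, A, hκ, hS⟩
    exact ⟨_, _, _, hκ, hS.transport hQ hα htS h⟩
  · rintro ⟨κ₀, A, hκ, hS⟩
    have := hS.transport hQ hα htS h
    rw [mul_zero, zero_mul, sub_zero] at this
    exact ⟨_, _, mul_ne_zero hα.ne' hκ, this⟩

/-- These three properties are the invariants that tell the rows apart. -/
theorem invariants_iff (hQ : IsFlux Q tS) (hα : 0 < α) (htS : tS' = α * tS + γ)
    (h : ∀ t, tS < t → Q' (α * t + γ) = R (Q t)) :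
    (HasRotation Q tS ↔ HasRotation Q' tS') ∧ (HasScaling Q tS ↔ HasScaling Q' tS') ∧
      (HasTranslation Q tS ↔ HasTranslation Q' tS') := by
  obtain ⟨h1, h2, h3⟩ := invariants_mp hQ hα htS h
  obtain ⟨e1, e2, e3⟩ := transport_symm hα htS h
  obtain ⟨k1, k2, k3⟩ := invariants_mp (hQ.transport hα htS h) e1 e2 e3
  exact ⟨⟨h1, k1⟩, ⟨h2, k2⟩, ⟨h3, k3⟩⟩

end Invariants

/-- The skew part drops out, leaving a scalar equation for `|Q|²` that constrains `κ₀` and `κ₁`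
alone. -/
theorem FluxSym.inner_eq {Q : ℝ → E3} {tS κ₀ κ₁ : ℝ} {A : E3 →L[ℝ] E3}
    (h : FluxSym Q tS κ₀ κ₁ A) {t : ℝ} (ht : tS < t) :
    (κ₀ + 2 * κ₁ * t) * inner ℝ (deriv Q t) (Q t) = -κ₁ * inner ℝ (Q t) (Q t) := by
  have := congrArg (fun z => inner ℝ z (Q t)) (h.2 t ht)
  simp only [inner_sub_left, real_inner_smul_left, h.1.inner_self] at this
  linarith

/-! ### The fluxes of the table -/

namespace Row

/-- The function `Q` is the flux of the row `r` on `(tS, ∞)`. -/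
def FitsOn (r : Row) (Q : ℝ → E3) (tS : ℝ) : Prop :=
  Set.EqOn Q r.flux (Set.Ioi tS) ∧
    match r with
    | four _ _ _ _ => 0 ≤ tS
    | six _ => 0 ≤ tS
    | _ => True

theorem fits_iff (r : Row) (B : BVP) : r.Fits B ↔ r.FitsOn B.Q B.tStar := by
  cases r <;> exact Iff.rfl

/-- The infinitesimal symmetries of the flux of the row `r`. -/
def Sym (r : Row) (κ₀ κ₁ θ : ℝ) : Prop :=
  match r with
  | two _ => κ₀ = 0 ∧ κ₁ = 0
  | three l _ _ _ => κ₁ = 0 ∧ θ = l * κ₀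
  | four l _ _ _ => κ₀ = 0 ∧ θ = l * κ₁
  | five _ => κ₁ = 0
  | six _ => κ₀ = 0

theorem flux_three (l q₁ q₂ q₃ t : ℝ) : (three l q₁ q₂ q₃).flux t = rot (l * t) !₂[q₁, q₂, q₃] := by
  ext i; fin_cases i <;> simp [flux, rot, Theta₁, Theta₂]

theorem flux_four (l q₁ q₂ q₃ t : ℝ) : (four l q₁ q₂ q₃).flux t
    = (Real.sqrt t)⁻¹ • rot (1 / 2 * l * Real.log t) !₂[q₁, q₂, q₃] := by
  ext i; fin_cases i <;> simp [flux, rot, Theta₁, Theta₂]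
  ring

theorem flux_five (q t : ℝ) : (five q).flux t = !₂[0, 0, q] := rfl

theorem flux_six (q t : ℝ) : (six q).flux t = (Real.sqrt t)⁻¹ • !₂[0, 0, q] := by
  ext i; fin_cases i <;> simp [flux]; ring

end Row

theorem rotGen_axis (q : ℝ) : rotGen !₂[0, 0, q] = 0 := by
  rw [rotGen_apply]; ext i; fin_cases i <;> simp

theorem rotGen_rot (τ : ℝ) (x : E3) : rotGen (rot τ x) = rot τ (rotGen x) := by
  simp only [rotGen_apply, rot]
  ext i; fin_cases i <;> simp
  ring

theorem inner_rotGen_self (x : E3) : inner ℝ (rotGen x) x = 0 := isSkew_rotGen.inner_self x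

theorem hasDerivAt_rot_mul (l t : ℝ) (x : E3) :
    HasDerivAt (fun t => rot (l * t) x) (l • rotGen (rot (l * t) x)) t := by
  have h1 : HasDerivAt (fun t => l * t) l t := by simpa using (hasDerivAt_id t).const_mul l
  exact HasDerivAt.scomp (h := fun t => l * t) t (hasDerivAt_rot (l * t) x) h1

theorem hasDerivAt_inv_sqrt {t : ℝ} (ht : 0 < t) :
    HasDerivAt (fun t => (Real.sqrt t)⁻¹) (-(1 / (2 * t)) * (Real.sqrt t)⁻¹) t := by
  refine ((Real.hasDerivAt_sqrt ht.ne').inv (Real.sqrt_pos.2 ht).ne').congr_deriv ?_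
  have h := Real.sq_sqrt ht.le
  have h' := (Real.sqrt_pos.2 ht).ne'
  rw [show 2 * t = 2 * Real.sqrt t ^ 2 by rw [h]]
  field_simp

theorem hasDerivAt_rot_log {l t : ℝ} (ht : 0 < t) (x : E3) :
    HasDerivAt (fun t => rot (1 / 2 * l * Real.log t) x)
      ((l / (2 * t)) • rotGen (rot (1 / 2 * l * Real.log t) x)) t := by
  have h1 : HasDerivAt (fun t => 1 / 2 * l * Real.log t) (l / (2 * t)) t := by
    refine ((Real.hasDerivAt_log ht.ne').const_mul (1 / 2 * l)).congr_deriv ?_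
    field_simp
  exact HasDerivAt.scomp (h := fun t => 1 / 2 * l * Real.log t) t (hasDerivAt_rot _ x) h1

theorem hasDerivAt_spiral {l t : ℝ} (ht : 0 < t) (x : E3) :
    HasDerivAt (fun t => (Real.sqrt t)⁻¹ • rot (1 / 2 * l * Real.log t) x)
      ((l / (2 * t)) • rotGen ((Real.sqrt t)⁻¹ • rot (1 / 2 * l * Real.log t) x)
        - (1 / (2 * t)) • ((Real.sqrt t)⁻¹ • rot (1 / 2 * l * Real.log t) x)) t := by
  refine ((hasDerivAt_inv_sqrt ht).smul (hasDerivAt_rot_log (l := l) ht x)).congr_deriv ?_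
  rw [map_smul]
  module

theorem rot_axis (τ q : ℝ) : rot τ !₂[0, 0, q] = !₂[0, 0, q] := by
  ext i; fin_cases i <;> simp [rot]

theorem rot_sq (τ : ℝ) (x : E3) : rot τ x 0 ^ 2 + rot τ x 1 ^ 2 = x 0 ^ 2 + x 1 ^ 2 := by
  simp [rot]
  linear_combination (x 0 ^ 2 + x 1 ^ 2) * Real.sin_sq_add_cos_sq τ

/-! ### Differential equations satisfied by the fluxes of the table. -/

section Derivatives

variable {F : ℝ → E3} {tS : ℝ}

theorem deriv_of_eqOn {f : ℝ → E3} {f' : E3} (hF : Set.EqOn F f (Set.Ioi tS)) {t : ℝ}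
    (ht : tS < t) (hf : HasDerivAt f f' t) : deriv F t = f' :=
  (hf.congr_of_eventuallyEq ((lt_mem_nhds ht).mono fun _ hτ => hF hτ)).deriv

theorem Row.deriv_three {l q₁ q₂ q₃ : ℝ} (h : (three l q₁ q₂ q₃).FitsOn F tS) {t : ℝ}
    (ht : tS < t) : deriv F t = l • rotGen (F t) := by
  rw [deriv_of_eqOn (fun τ hτ => (h.1 hτ).trans (flux_three l q₁ q₂ q₃ τ)) ht
    (hasDerivAt_rot_mul l t _), h.1 ht, flux_three]

theorem Row.deriv_four {l q₁ q₂ q₃ : ℝ} (h : (four l q₁ q₂ q₃).FitsOn F tS) {t : ℝ}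
    (ht : tS < t) : deriv F t = (l / (2 * t)) • rotGen (F t) - (1 / (2 * t)) • F t := by
  have h0 : 0 ≤ tS := h.2
  rw [deriv_of_eqOn (fun τ hτ => (h.1 hτ).trans (flux_four l q₁ q₂ q₃ τ)) ht
    (hasDerivAt_spiral (h0.trans_lt ht) _), h.1 ht, flux_four]

theorem Row.deriv_five {q : ℝ} (h : (five q).FitsOn F tS) {t : ℝ}
    (ht : tS < t) : deriv F t = 0 :=
  deriv_of_eqOn h.1 ht (hasDerivAt_const _ _)

theorem Row.deriv_six {q : ℝ} (h : (six q).FitsOn F tS) {t : ℝ}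
    (ht : tS < t) : deriv F t = -(1 / (2 * t)) • F t := by
  have h0 : 0 ≤ tS := h.2
  rw [deriv_of_eqOn (fun τ hτ => (h.1 hτ).trans (flux_six q τ)) ht
    ((hasDerivAt_inv_sqrt (h0.trans_lt ht)).smul_const _), h.1 ht, flux_six, smul_smul]

/-- Time scalings which are symmetries of a flux of constant direction. -/
theorem Row.sym_two {q : ℝ → ℝ} (hF : IsFlux F tS) (h : (two q).FitsOn F tS)
    (hg : (two q).Generic tS) {κ₀ κ₁ : ℝ}
    (hS : ∀ t, tS < t → (κ₀ + 2 * κ₁ * t) * deriv q t = -κ₁ * q t) : κ₀ = 0 ∧ κ₁ = 0 := by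
  have hval : ∀ t, tS < t → F t = !₂[0, 0, q t] := fun t ht => h.1 ht
  have hq : ∀ t, tS < t → HasDerivAt q (deriv q t) t := by
    intro t ht
    have h1 := hasDerivAt_clm_comp (EuclideanSpace.proj (𝕜 := ℝ) (2 : Fin 3))
      (hF t ht).1.hasDerivAt
    refine (h1.congr_of_eventuallyEq ((lt_mem_nhds ht).mono fun τ hτ => ?_)).differentiableAt.hasDerivAt
    simp [hval τ hτ]
  have hq0 : ∀ t, tS < t → q t ≠ 0 := by
    intro t ht h0
    refine (hF t ht).2 ?_
    rw [hval t ht, h0]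
    ext i; fin_cases i <;> simp
  have hκ₁ : κ₁ = 0 := by
    by_contra hκ
    -- The zero of the time component. It cannot lie in the time interval, since the equation at `t
    -- = s` would give `q s = 0`; so `√(t - s) q` is a constant of motion, a form of `q` excluded by
    -- genericity.
    set s := -κ₀ / (2 * κ₁) with hs
    have hmul : ∀ t, κ₀ + 2 * κ₁ * t = 2 * κ₁ * (t - s) := fun t => by
      rw [hs]; field_simp; ring
    have hS' : ∀ t, tS < t → (t - s) * deriv q t = -(1 / 2) * q t := fun t ht => by
      have := hS t ht
      rw [hmul] at this
      refine mul_left_cancel₀ (mul_ne_zero two_ne_zero hκ) ?_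
      linear_combination this
    have hsS : s ≤ tS := by
      by_contra hlt
      have := hS' s (not_le.1 hlt)
      rw [sub_self, zero_mul] at this
      exact hq0 s (not_le.1 hlt) (by linarith)
    have hd : ∀ t, tS < t → HasDerivAt (fun t => Real.sqrt (t - s) * q t) 0 t := by
      intro t ht
      have hts : 0 < t - s := by linarith
      have h1 : HasDerivAt (fun t => Real.sqrt (t - s)) (1 / (2 * Real.sqrt (t - s))) t := by
        simpa using ((hasDerivAt_id t).sub_const s).sqrt hts.ne'
      refine (h1.mul (hq t ht)).congr_deriv ?_
      have h2 := Real.sq_sqrt hts.le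
      have h3 := (Real.sqrt_pos.2 hts).ne'
      have h4 := hS' t ht
      field_simp
      rw [h2]
      linear_combination 2 * h4
    refine hg.2 ⟨Real.sqrt (tS + 1 - s) * q (tS + 1), s, hsS, fun t ht => ?_⟩
    have hts : 0 < t - s := by linarith
    rw [eq_div_iff (Real.sqrt_pos.2 hts).ne', mul_comm]
    exact eq_of_hasDerivAt_zero (f := fun t => Real.sqrt (t - s) * q t) hd ht
  refine ⟨?_, hκ₁⟩
  by_contra hκ
  have hd : ∀ t, tS < t → HasDerivAt q 0 t := by
    intro t ht
    have := hS t ht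
    rw [hκ₁] at this
    have h0 : deriv q t = 0 := by simpa [hκ] using this
    exact h0 ▸ hq t ht
  exact hg.1 ⟨q (tS + 1), fun t ht => eq_of_hasDerivAt_zero hd ht⟩

end Derivatives

/-! ### Symmetry algebras of the rows and their separation. -/

section Symmetries

variable {F : ℝ → E3} {tS : ℝ}

theorem IsFlux.hasDerivAt {Q : ℝ → E3} (hQ : IsFlux Q tS) {t : ℝ} (ht : tS < t) :
    HasDerivAt Q (deriv Q t) t := (hQ t ht).1.hasDerivAt

theorem axis_eq_smul (r : ℝ) : (!₂[0, 0, r] : E3) = r • !₂[0, 0, 1] := by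
  ext i; fin_cases i <;> simp

theorem Row.deriv_two {q : ℝ → ℝ} (hF : IsFlux F tS) (h : (two q).FitsOn F tS) {t : ℝ}
    (ht : tS < t) : deriv F t = !₂[0, 0, deriv q t] := by
  have h1 := hasDerivAt_clm_comp (EuclideanSpace.proj (𝕜 := ℝ) (2 : Fin 3)) (hF.hasDerivAt ht)
  have h2 : HasDerivAt q (deriv q t) t := by
    refine (h1.congr_of_eventuallyEq
      ((lt_mem_nhds ht).mono fun τ hτ => ?_)).differentiableAt.hasDerivAt
    simp [h.1 hτ, flux]
  rw [axis_eq_smul]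
  exact deriv_of_eqOn (fun τ hτ => (h.1 hτ).trans (axis_eq_smul (q τ))) ht
    (h2.smul_const (!₂[0, 0, 1] : E3))

theorem axis_ne_zero {r : ℝ} (h : (!₂[0, 0, r] : E3) ≠ 0) : r ≠ 0 := by
  rintro rfl
  exact h (by ext i; fin_cases i <;> simp)

/-- Differentiating `C F = 0` along a flux that turns about the axis shows that `C` kills `rotGen (F
t)` as well as `F t`. Two independent vectors in its kernel force a skew map of space to vanish. -/
theorem eq_zero_of_rotating (hF : IsFlux F tS) {C : E3 →L[ℝ] E3} (hC : IsSkew C)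
    (h : ∀ t, tS < t → C (F t) = 0) {t a b : ℝ} (ht : tS < t)
    (hd : deriv F t = a • rotGen (F t) + b • F t) (ha : a ≠ 0)
    (hx : F t 0 ^ 2 + F t 1 ^ 2 ≠ 0) : C = 0 := by
  refine hC.eq_zero (h t ht) ?_ hx
  have h1 : HasDerivAt (fun t => C (F t)) (C (deriv F t)) t :=
    hasDerivAt_clm_comp C (hF.hasDerivAt ht)
  have h2 : C (deriv F t) = 0 :=
    h1.unique ((hasDerivAt_const t (0 : E3)).congr_of_eventuallyEq
      ((lt_mem_nhds ht).mono fun τ hτ => h τ hτ))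
  rw [hd, map_add, map_smul, map_smul, h t ht, smul_zero, add_zero] at h2
  exact (smul_eq_zero.1 h2).resolve_left ha

/-- `FluxSym.inner_eq` settles the time part in rows 3 to 6: `|F|²` is constant in rows 3 and 5, so
`κ₁ = 0`, and proportional to `1/t` in rows 4 and 6, so `κ₀ = 0`. On an axial flux `A` has to
annihilate the axis; on a rotating one `A` minus the expected multiple of `rotGen` annihilates the
flux at all times, and `eq_zero_of_rotating` applies. -/
theorem Row.fluxSym_mp {r : Row} (hF : IsFlux F tS) (h : r.FitsOn F tS) (hg : r.Generic tS)
    {κ₀ κ₁ : ℝ} {A : E3 →L[ℝ] E3} (hS : FluxSym F tS κ₀ κ₁ A) :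
    ∃ θ : ℝ, A = θ • rotGen ∧ r.Sym κ₀ κ₁ θ := by
  have ht₁ : tS < tS + 1 := lt_add_one tS
  have hne := (hF _ ht₁).2
  have hin : ∀ t, tS < t → inner ℝ (F t) (F t) ≠ 0 := fun t ht => inner_self_ne_zero.2 (hF t ht).2
  cases r with
  | two q =>
    have hval : ∀ t, tS < t → F t = !₂[0, 0, q t] := fun t ht => h.1 ht
    obtain ⟨h0, h1⟩ : κ₀ = 0 ∧ κ₁ = 0 := by
      refine Row.sym_two hF h hg fun t ht => ?_
      have e := hS.inner_eq ht
      have hq := axis_ne_zero ((hval t ht) ▸ (hF t ht).2)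
      rw [deriv_two hF h ht, hval t ht] at e
      simp only [inner_E3] at e
      simp at e
      refine mul_right_cancel₀ hq ?_
      linear_combination e
    have e := hS.2 _ ht₁
    rw [h0, h1, hval _ ht₁] at e
    rw [hval _ ht₁] at hne
    obtain ⟨θ, hθ⟩ := hS.1.eq_smul_rotGen (axis_ne_zero hne) (by simpa using e.symm)
    exact ⟨θ, hθ, h0, h1⟩
  | three l q₁ q₂ q₃ =>
    have h1 : κ₁ = 0 := by
      have e := hS.inner_eq ht₁
      rw [deriv_three h ht₁, real_inner_smul_left, inner_rotGen_self] at e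
      simpa [hne] using e
    have hC := eq_zero_of_rotating hF (hS.1.sub (isSkew_rotGen.smul (l * κ₀))) (fun t ht => ?_) ht₁
      (a := l) (b := 0) (by rw [deriv_three h ht₁, zero_smul, add_zero]) hg.1
      (by rw [h.1 ht₁, flux_three, rot_sq]; simpa using hg.2)
    · exact ⟨l * κ₀, sub_eq_zero.1 hC, h1, rfl⟩
    · have e := hS.2 t ht
      rw [deriv_three h ht, h1, smul_smul] at e
      rw [sub_apply, smul_apply, mul_comm l, sub_eq_zero]
      simpa using e.symm
  | four l q₁ q₂ q₃ =>
    have h0 : 0 ≤ tS := h.2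
    have hk : κ₀ = 0 := by
      have e := hS.inner_eq ht₁
      rw [deriv_four h ht₁, inner_sub_left, real_inner_smul_left, real_inner_smul_left,
        inner_rotGen_self, mul_zero, zero_sub, mul_neg, neg_mul, neg_inj, ← mul_assoc] at e
      have e' := mul_right_cancel₀ (hin _ ht₁) e
      have : tS + 1 ≠ 0 := by linarith
      field_simp at e'
      linarith
    have hC := eq_zero_of_rotating hF (hS.1.sub (isSkew_rotGen.smul (l * κ₁))) (fun t ht => ?_) ht₁
      (a := l / (2 * (tS + 1))) (b := -(1 / (2 * (tS + 1))))
      (by rw [deriv_four h ht₁, neg_smul, sub_eq_add_neg])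
      (div_ne_zero hg.1 (by linarith)) ?_
    · exact ⟨l * κ₁, sub_eq_zero.1 hC, hk, rfl⟩
    · have e := hS.2 t ht
      have ht0 : t ≠ 0 := by linarith
      have e1 : 2 * κ₁ * t * (l / (2 * t)) = l * κ₁ := by field_simp
      have e2 : 2 * κ₁ * t * (1 / (2 * t)) = κ₁ := by field_simp
      rw [deriv_four h ht, hk, zero_add, smul_sub, smul_smul, smul_smul, e1, e2, sub_left_inj] at e
      rw [sub_apply, smul_apply, ← e, sub_self]
    · have := rot_sq (1 / 2 * l * Real.log (tS + 1)) !₂[q₁, q₂, q₃]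
      rw [h.1 ht₁, flux_four]
      simp only [PiLp.smul_apply, smul_eq_mul, mul_pow]
      rw [← mul_add, this]
      have h3 := (Real.sqrt_pos.2 (h0.trans_lt ht₁)).ne'
      exact mul_ne_zero (pow_ne_zero _ (inv_ne_zero h3)) (by simpa using hg.2)
  | five q =>
    have h1 : κ₁ = 0 := by
      have e := hS.inner_eq ht₁
      rw [deriv_five h ht₁, inner_zero_left] at e
      simpa [hne] using e
    have e := hS.2 _ ht₁
    have hval : F (tS + 1) = !₂[0, 0, q] := h.1 ht₁
    rw [h1, deriv_five h ht₁, hval] at e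
    rw [hval] at hne
    obtain ⟨θ, hθ⟩ := hS.1.eq_smul_rotGen (axis_ne_zero hne) (by simpa using e.symm)
    exact ⟨θ, hθ, h1⟩
  | six q =>
    have h0 : 0 ≤ tS := h.2
    have ht0 : tS + 1 ≠ 0 := by linarith
    have hk : κ₀ = 0 := by
      have e := hS.inner_eq ht₁
      rw [deriv_six h ht₁, real_inner_smul_left, ← mul_assoc] at e
      have e' := mul_right_cancel₀ (hin _ ht₁) e
      field_simp at e'
      linarith
    have e := hS.2 _ ht₁
    have hval : F (tS + 1) = !₂[0, 0, q / Real.sqrt (tS + 1)] := h.1 ht₁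
    have e1 : 2 * κ₁ * (tS + 1) * -(1 / (2 * (tS + 1))) = -κ₁ := by field_simp
    rw [deriv_six h ht₁, hk, zero_add, smul_smul, e1, neg_smul] at e
    have e2 : A (F (tS + 1)) = 0 := by
      rw [eq_sub_iff_add_eq, neg_add_cancel] at e
      exact e.symm
    rw [hval] at hne e2
    obtain ⟨θ, hθ⟩ := hS.1.eq_smul_rotGen (axis_ne_zero hne) e2
    exact ⟨θ, hθ, hk⟩

theorem Row.fluxSym_mpr {r : Row} (h : r.FitsOn F tS)
    {κ₀ κ₁ θ : ℝ} (hS : r.Sym κ₀ κ₁ θ) : FluxSym F tS κ₀ κ₁ (θ • rotGen) := by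
  refine ⟨isSkew_rotGen.smul θ, fun t ht => ?_⟩
  rw [smul_apply]
  cases r with
  | two q =>
    obtain ⟨rfl, rfl⟩ := hS
    rw [h.1 ht, flux, rotGen_axis]
    simp
  | three l q₁ q₂ q₃ =>
    obtain ⟨rfl, rfl⟩ := hS
    rw [deriv_three h ht]
    module
  | four l q₁ q₂ q₃ =>
    obtain ⟨rfl, rfl⟩ := hS
    have h0 : 0 ≤ tS := h.2
    have ht0 : t ≠ 0 := by linarith
    have e1 : 2 * κ₁ * t * (l / (2 * t)) = l * κ₁ := by field_simp
    have e2 : 2 * κ₁ * t * (1 / (2 * t)) = κ₁ := by field_simp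
    rw [deriv_four h ht, zero_add, smul_sub, smul_smul, smul_smul, e1, e2]
  | five q =>
    obtain rfl := hS
    rw [deriv_five h ht, h.1 ht, flux_five, rotGen_axis]
    simp
  | six q =>
    obtain rfl := hS
    have h0 : 0 ≤ tS := h.2
    have ht0 : t ≠ 0 := by linarith
    have e1 : 2 * κ₁ * t * -(1 / (2 * t)) = -κ₁ := by field_simp
    rw [deriv_six h ht, zero_add, smul_smul, e1, h.1 ht, flux_six, map_smul, rotGen_axis]
    module

theorem smul_rotGen_eq_zero {θ : ℝ} : θ • rotGen = 0 ↔ θ = 0 := by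
  constructor
  · intro h
    have := congrArg (fun L => L (!₂[0, 1, 0] : E3) 0) h
    simpa [rotGen_apply] using this
  · rintro rfl
    ext x : 1
    simp

theorem Row.invariants {r : Row} (hF : IsFlux F tS) (h : r.FitsOn F tS) (hg : r.Generic tS) :
    (HasRotation F tS ↔ r.number = 2 ∨ r.number = 5 ∨ r.number = 6) ∧
    (HasScaling F tS ↔ r.number = 4 ∨ r.number = 6) ∧
    (HasTranslation F tS ↔ r.number = 3 ∨ r.number = 5) := by
  have e1 : HasRotation F tS ↔ ∃ θ, θ ≠ 0 ∧ r.Sym 0 0 θ := by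
    constructor
    · rintro ⟨A, hA, hS⟩
      obtain ⟨θ, rfl, hθ⟩ := Row.fluxSym_mp hF h hg hS
      exact ⟨θ, fun h0 => hA (smul_rotGen_eq_zero.2 h0), hθ⟩
    · rintro ⟨θ, hθ, hS⟩
      exact ⟨_, fun h0 => hθ (smul_rotGen_eq_zero.1 h0), Row.fluxSym_mpr h hS⟩
  have e2 : HasScaling F tS ↔ ∃ κ₀ κ₁ θ, κ₁ ≠ 0 ∧ r.Sym κ₀ κ₁ θ := by
    constructor
    · rintro ⟨κ₀, κ₁, A, hκ, hS⟩
      obtain ⟨θ, rfl, hθ⟩ := Row.fluxSym_mp hF h hg hS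
      exact ⟨κ₀, κ₁, θ, hκ, hθ⟩
    · rintro ⟨κ₀, κ₁, θ, hκ, hS⟩
      exact ⟨_, _, _, hκ, Row.fluxSym_mpr h hS⟩
  have e3 : HasTranslation F tS ↔ ∃ κ₀ θ, κ₀ ≠ 0 ∧ r.Sym κ₀ 0 θ := by
    constructor
    · rintro ⟨κ₀, A, hκ, hS⟩
      obtain ⟨θ, rfl, hθ⟩ := Row.fluxSym_mp hF h hg hS
      exact ⟨κ₀, θ, hκ, hθ⟩
    · rintro ⟨κ₀, θ, hκ, hS⟩
      exact ⟨_, _, hκ, Row.fluxSym_mpr h hS⟩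
  rw [e1, e2, e3]
  cases r with
  | two q =>
    refine ⟨iff_of_true ⟨1, one_ne_zero, rfl, rfl⟩ (by simp [number]), iff_of_false ?_
      (by simp [number]), iff_of_false ?_ (by simp [number])⟩
    · rintro ⟨_, _, _, hκ, _, hS⟩; exact hκ hS
    · rintro ⟨_, _, hκ, hS, _⟩; exact hκ hS
  | three l q₁ q₂ q₃ =>
    refine ⟨iff_of_false ?_ (by simp [number]), iff_of_false ?_ (by simp [number]),
      iff_of_true ⟨1, l * 1, one_ne_zero, rfl, rfl⟩ (by simp [number])⟩
    · rintro ⟨θ, hθ, _, hS⟩; exact hθ (by rw [hS, mul_zero])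
    · rintro ⟨_, _, _, hκ, hS, _⟩; exact hκ hS
  | four l q₁ q₂ q₃ =>
    refine ⟨iff_of_false ?_ (by simp [number]),
      iff_of_true ⟨0, 1, l * 1, one_ne_zero, rfl, rfl⟩ (by simp [number]),
      iff_of_false ?_ (by simp [number])⟩
    · rintro ⟨θ, hθ, _, hS⟩; exact hθ (by rw [hS, mul_zero])
    · rintro ⟨_, _, hκ, hS, _⟩; exact hκ hS
  | five q =>
    refine ⟨iff_of_true ⟨1, one_ne_zero, rfl⟩ (by simp [number]), iff_of_false ?_
      (by simp [number]), iff_of_true ⟨1, 0, one_ne_zero, rfl⟩ (by simp [number])⟩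
    rintro ⟨_, _, _, hκ, hS⟩; exact hκ hS
  | six q =>
    refine ⟨iff_of_true ⟨1, one_ne_zero, rfl⟩ (by simp [number]),
      iff_of_true ⟨0, 1, 0, one_ne_zero, rfl⟩ (by simp [number]), iff_of_false ?_
      (by simp [number])⟩
    rintro ⟨_, _, hκ, hS⟩; exact hκ hS

/-- The values of (rotation, scaling, translation) are (1,0,0), (0,0,1), (0,1,0), (1,0,1), (1,1,0)
on rows 2 to 6, pairwise distinct. -/
theorem Row.number_eq_of_iff {r r' : Row}
    (h1 : (r.number = 2 ∨ r.number = 5 ∨ r.number = 6) ↔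
      (r'.number = 2 ∨ r'.number = 5 ∨ r'.number = 6))
    (h2 : (r.number = 4 ∨ r.number = 6) ↔ (r'.number = 4 ∨ r'.number = 6))
    (h3 : (r.number = 3 ∨ r.number = 5) ↔ (r'.number = 3 ∨ r'.number = 5)) :
    r.number = r'.number := by
  cases r <;> cases r' <;> simp [number] at *

theorem Row.dim_eq_of_number {r r' : Row} (h : r.number = r'.number) : r.dim = r'.dim := by
  cases r <;> cases r' <;> simp [number, dim] at *

end Symmetries

/-! ### Normal forms of the flux -/

section NormalForms

variable {F Q : ℝ → E3} {tS : ℝ}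

theorem hasDerivAt_rot_apply {σ : ℝ → ℝ} {x : ℝ → E3} {σ' t : ℝ} {x' : E3}
    (hσ : HasDerivAt σ σ' t) (hx : HasDerivAt x x' t) :
    HasDerivAt (fun t => rot (σ t) (x t)) (σ' • rotGen (rot (σ t) (x t)) + rot (σ t) x') t := by
  have hd : HasFDerivAt (fun q : ℝ × E3 => rot q.1 q.2)
      (fderiv ℝ (fun q : ℝ × E3 => rot q.1 q.2) (σ t, x t)) (σ t, x t) :=
    (contDiff_rot.contDiffAt.differentiableAt (by simp)).hasFDerivAt
  set D := fderiv ℝ (fun q : ℝ × E3 => rot q.1 q.2) (σ t, x t)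
  have h1 : D (1, 0) = rotGen (rot (σ t) (x t)) := by
    have e : HasDerivAt (fun τ => ((τ, x t) : ℝ × E3)) (1, 0) (σ t) :=
      (hasDerivAt_id _).prodMk (hasDerivAt_const _ _)
    exact (HasFDerivAt.comp_hasDerivAt (f := fun τ => ((τ, x t) : ℝ × E3)) (σ t) hd e).unique
      (hasDerivAt_rot (σ t) (x t))
  have h2 : D (0, x') = rot (σ t) x' := by
    have e := HasFDerivAt.comp (g := fun q : ℝ × E3 => rot q.1 q.2)
      (f := fun y => ((σ t, y) : ℝ × E3)) (x t) hd (hasFDerivAt_prodMk_right (σ t) (x t))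
    have := congrArg (fun L => L x') (e.unique (rotL (σ t)).hasFDerivAt)
    exact this
  have h3 := HasFDerivAt.comp_hasDerivAt (f := fun t => ((σ t, x t) : ℝ × E3)) t hd (hσ.prodMk hx)
  refine h3.congr_deriv ?_
  have : ((σ', x') : ℝ × E3) = σ' • ((1, 0) : ℝ × E3) + (0, x') := by simp
  rw [this, map_add, map_smul, h1, h2]

/-- In the frame that rotates back with the flux, the flux is constant. -/
theorem exists_rot_of_deriv {l : ℝ} (h : ∀ t, tS < t → HasDerivAt F (l • rotGen (F t)) t) :
    ∃ q, ∀ t, tS < t → F t = rot (l * t) q := by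
  have hd : ∀ t, tS < t → HasDerivAt (fun t => rot (-l * t) (F t)) 0 t := by
    intro t ht
    have h1 : HasDerivAt (fun t => -l * t) (-l) t := by
      simpa using (hasDerivAt_id t).const_mul (-l)
    refine (hasDerivAt_rot_apply h1 (h t ht)).congr_deriv ?_
    rw [rot_smul, rotGen_rot]
    module
  refine ⟨rot (-l * (tS + 1)) (F (tS + 1)), fun t ht => ?_⟩
  have e : rot (-l * t) (F t) = rot (-l * (tS + 1)) (F (tS + 1)) := eq_of_hasDerivAt_zero hd ht
  rw [← e, rot_rot, neg_mul, add_neg_cancel, rot_zero]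

/-- Multiplying by `√t` compensates the decay, and rotating back by the logarithmic angle
compensates the turning; the result is constant. -/
theorem exists_spiral_of_deriv {l : ℝ} (h0 : 0 ≤ tS)
    (h : ∀ t, tS < t → HasDerivAt F ((l / (2 * t)) • rotGen (F t) - (1 / (2 * t)) • F t) t) :
    ∃ q, ∀ t, tS < t → F t = (Real.sqrt t)⁻¹ • rot (1 / 2 * l * Real.log t) q := by
  have hd : ∀ t, tS < t →
      HasDerivAt (fun t => Real.sqrt t • rot (1 / 2 * -l * Real.log t) (F t)) 0 t := by
    intro t ht
    have ht0 : 0 < t := h0.trans_lt ht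
    have h1 : HasDerivAt (fun t => 1 / 2 * -l * Real.log t) (-l / (2 * t)) t := by
      refine ((Real.hasDerivAt_log ht0.ne').const_mul (1 / 2 * -l)).congr_deriv ?_
      field_simp
    refine ((Real.hasDerivAt_sqrt ht0.ne').smul
      (hasDerivAt_rot_apply h1 (h t ht))).congr_deriv ?_
    rw [sub_eq_add_neg, ← neg_smul, rot_add, rot_smul, rot_smul, rotGen_rot]
    have e : 1 / (2 * Real.sqrt t) = Real.sqrt t * (1 / (2 * t)) := by
      have h2 := Real.sq_sqrt ht0.le
      have h3 := (Real.sqrt_pos.2 ht0).ne'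
      field_simp
      exact h2.symm
    rw [e]
    module
  refine ⟨Real.sqrt (tS + 1) • rot (1 / 2 * -l * Real.log (tS + 1)) (F (tS + 1)), fun t ht => ?_⟩
  have ht0 : 0 < t := h0.trans_lt ht
  have e : Real.sqrt t • rot (1 / 2 * -l * Real.log t) (F t)
      = Real.sqrt (tS + 1) • rot (1 / 2 * -l * Real.log (tS + 1)) (F (tS + 1)) :=
    eq_of_hasDerivAt_zero hd ht
  rw [← e, rot_smul, smul_smul, inv_mul_cancel₀ (Real.sqrt_pos.2 ht0).ne', one_smul, rot_rot,
    show 1 / 2 * l * Real.log t + 1 / 2 * -l * Real.log t = 0 by ring, rot_zero]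

/-- Rotations about the line fix the flux. This serves to rule out degenerate parameters of rows 3
and 4, for which the flux would stay on a line. -/
theorem hasRotation_of_line (v : E3) (h : ∀ t, tS < t → ∃ c : ℝ, Q t = c • v) :
    HasRotation Q tS := by
  obtain ⟨M, r, hM⟩ := exists_rotation v
  have hne : rotGen ≠ 0 := by
    have := (smul_rotGen_eq_zero (θ := 1)).not.2 one_ne_zero
    intro h0
    refine this ?_
    rw [h0]
    ext x : 1
    simp
  refine ⟨_, conjBy_ne_zero hne (matIso M), isSkew_rotGen.conj _, fun t ht => ?_⟩
  obtain ⟨c, hc⟩ := h t ht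
  rw [hc, hM, conjBy_apply, map_smul, LinearIsometryEquiv.symm_apply_apply, map_smul, rotGen_axis]
  simp

/-- Up to a rotation and a translation of time, `Q` is the generic flux of the row `r`. -/
def NormalForm (Q : ℝ → E3) (tS : ℝ) (r : Row) (M : Matrix.specialOrthogonalGroup (Fin 3) ℝ)
    (t0 : ℝ) : Prop :=
  r.FitsOn (fun t => (matIso M).symm (Q (t + t0))) (tS - t0) ∧ r.Generic (tS - t0)

/-- A rotation that fixes time annihilates `Q`, so `Q` lies on its axis. The two exclusions in the
genericity of row 2 are rows 5 and 6. -/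
theorem exists_normalForm_of_hasRotation (h : HasRotation Q tS) :
    ∃ r M t0, NormalForm Q tS r M t0 := by
  obtain ⟨A, hA, hS⟩ := h
  obtain ⟨M, θ, rfl⟩ := hS.1.exists_rotation
  have hθ : θ ≠ 0 := by
    rintro rfl
    refine hA ?_
    ext x : 1
    simp [conjBy_apply]
  set q : ℝ → ℝ := fun t => (matIso M).symm (Q t) 2 with hq
  have hval : ∀ t, tS < t → (matIso M).symm (Q t) = !₂[0, 0, q t] := by
    intro t ht
    have e := hS.2 t ht
    rw [mul_zero, zero_mul, zero_add, zero_smul, zero_smul, sub_zero, conjBy_apply] at e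
    have e1 := (map_eq_zero_iff _ (matIso M).injective).1 e.symm
    rw [smul_apply] at e1
    have e2 := (smul_eq_zero.1 e1).resolve_left hθ
    rw [rotGen_apply] at e2
    have f0 := congrArg (fun z : E3 => z 0) e2
    have f1 := congrArg (fun z : E3 => z 1) e2
    simp at f0 f1
    ext i; fin_cases i
    · simpa using f1
    · simpa using f0
    · rfl
  by_cases h1 : ∃ c : ℝ, ∀ t, tS < t → q t = c
  · obtain ⟨c, hc⟩ := h1
    refine ⟨.five c, M, 0, ⟨fun t ht => ?_, trivial⟩, trivial⟩
    have ht' : tS < t + 0 := by simpa using ht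
    simp only [hval _ ht', hc _ ht', Row.flux_five]
  by_cases h2 : ∃ c s : ℝ, s ≤ tS ∧ ∀ t, tS < t → q t = c / Real.sqrt (t - s)
  · obtain ⟨c, s, hs, hc⟩ := h2
    -- The singular instant `s` is moved to the origin of time, and `s ≤ tS` becomes the condition
    -- of row 6 on the initial time.
    refine ⟨.six c, M, s, ⟨fun t ht => ?_, sub_nonneg.2 hs⟩, trivial⟩
    have ht' : tS < t + s := by linarith [show tS - s < t from ht]
    simp only [hval _ ht', hc _ ht', add_sub_cancel_right, Row.flux]
  · refine ⟨.two q, M, 0, ⟨fun t ht => ?_, trivial⟩, ?_⟩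
    · have ht' : tS < t + 0 := by simpa using ht
      simp only [add_zero] at ht' ⊢
      exact hval t ht'
    · rw [sub_zero]
      exact ⟨h1, h2⟩

theorem eta3 (x : E3) : !₂[x 0, x 1, x 2] = x := by
  ext i; fin_cases i <;> rfl

theorem eq_axis {x : E3} (h : x 0 ^ 2 + x 1 ^ 2 = 0) : x = x 2 • (!₂[0, 0, 1] : E3) := by
  have h0 : x 0 = 0 := by nlinarith [sq_nonneg (x 0), sq_nonneg (x 1)]
  have h1 : x 1 = 0 := by nlinarith [sq_nonneg (x 0), sq_nonneg (x 1)]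
  ext i; fin_cases i <;> simp [h0, h1]

section Shift

variable {M : Matrix.specialOrthogonalGroup (Fin 3) ℝ} {s : ℝ}

theorem shift_apply (t : ℝ) (_ : tS < t) :
    (fun t => (matIso M).symm (Q (t + s))) (1 * t + -s) = (matIso M).symm (Q t) := by simp

theorem sub_eq_one_mul (a b : ℝ) : a - b = 1 * a + -b := by ring

theorem IsFlux.shift (hQ : IsFlux Q tS) :
    IsFlux (fun t => (matIso M).symm (Q (t + s))) (tS - s) :=
  hQ.transport (R := (matIso M).symm) one_pos (sub_eq_one_mul tS s) shift_apply

theorem FluxSym.shift (hQ : IsFlux Q tS) {κ₀ κ₁ : ℝ} {A : E3 →L[ℝ] E3}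
    (hS : FluxSym Q tS κ₀ κ₁ A) :
    FluxSym (fun t => (matIso M).symm (Q (t + s))) (tS - s) (κ₀ + 2 * κ₁ * s) κ₁
      (conjBy (matIso M).symm A) := by
  have := hS.transport (Q' := fun t => (matIso M).symm (Q (t + s))) (R := (matIso M).symm) hQ
    one_pos (sub_eq_one_mul tS s) shift_apply
  rwa [one_mul, mul_neg, sub_neg_eq_add] at this

theorem invariants_shift (hQ : IsFlux Q tS) :
    (HasRotation Q tS ↔ HasRotation (fun t => (matIso M).symm (Q (t + s))) (tS - s)) ∧
    (HasScaling Q tS ↔ HasScaling (fun t => (matIso M).symm (Q (t + s))) (tS - s)) ∧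
    (HasTranslation Q tS ↔ HasTranslation (fun t => (matIso M).symm (Q (t + s))) (tS - s)) :=
  invariants_iff (R := (matIso M).symm) hQ one_pos (sub_eq_one_mul tS s) shift_apply

end Shift

theorem exists_normalForm (hQ : IsFlux Q tS) {κ₀ κ₁ : ℝ} {A : E3 →L[ℝ] E3}
    (hS : FluxSym Q tS κ₀ κ₁ A) (hne : ¬(κ₀ = 0 ∧ κ₁ = 0 ∧ A = 0)) :
    ∃ r M t0, NormalForm Q tS r M t0 := by
  by_cases hrot : HasRotation Q tS
  · exact exists_normalForm_of_hasRotation hrot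
  obtain ⟨M, θ, rfl⟩ := hS.1.exists_rotation
  have key : ∀ s : ℝ, IsFlux (fun t => (matIso M).symm (Q (t + s))) (tS - s) ∧
      ¬HasRotation (fun t => (matIso M).symm (Q (t + s))) (tS - s) ∧
      FluxSym (fun t => (matIso M).symm (Q (t + s))) (tS - s) (κ₀ + 2 * κ₁ * s) κ₁
        (θ • rotGen) := by
    intro s
    refine ⟨hQ.shift, fun h => hrot ((invariants_shift hQ).1.2 h), ?_⟩
    have e2 : conjBy (matIso M).symm (conjBy (matIso M) (θ • rotGen)) = θ • rotGen := by
      ext x : 1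
      simp [conjBy_apply]
    exact e2 ▸ hS.shift hQ
  by_cases hκ : κ₁ = 0
  · obtain rfl := hκ
    have hκ₀ : κ₀ ≠ 0 := by
      rintro rfl
      exact hrot ⟨_, fun h => hne ⟨rfl, rfl, h⟩, hS⟩
    obtain ⟨hF, hFrot, hFS⟩ := key 0
    set F : ℝ → E3 := fun t => (matIso M).symm (Q (t + 0)) with hFdef
    obtain ⟨q, hq⟩ := exists_rot_of_deriv (F := F) (l := θ / κ₀) (tS := tS - 0) fun t ht => by
      have e := hFS.2 t ht
      simp only [mul_zero, zero_mul, add_zero, zero_smul, sub_zero] at e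
      rw [smul_apply] at e
      refine (hF.hasDerivAt ht).congr_deriv ?_
      rw [div_eq_inv_mul, mul_smul, ← e, smul_smul, inv_mul_cancel₀ hκ₀, one_smul]
    -- If the angular velocity or the transverse part of `q` were zero, the flux would stay on a
    -- line and have a rotational symmetry, contrary to `hFrot`.
    refine ⟨.three (θ / κ₀) (q 0) (q 1) (q 2), M, 0, ⟨fun t ht => ?_, trivial⟩, fun h => ?_,
      fun h => ?_⟩
    · rw [Row.flux_three, eta3]; exact hq t ht
    · refine hFrot (hasRotation_of_line q fun t ht => ⟨1, ?_⟩)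
      rw [hq t ht, h, zero_mul, rot_zero, one_smul]
    · refine hFrot (hasRotation_of_line !₂[0, 0, 1] fun t ht => ⟨q 2, ?_⟩)
      rw [hq t ht, eq_axis h, rot_smul, rot_axis]
      simp
  · set s := -κ₀ / (2 * κ₁) with hs
    obtain ⟨hF, hFrot, hFS⟩ := key s
    set F : ℝ → E3 := fun t => (matIso M).symm (Q (t + s)) with hFdef
    have e0 : κ₀ + 2 * κ₁ * s = 0 := by rw [hs]; field_simp; ring
    rw [e0] at hFS
    -- If the zero of the time component lay in the time interval, the length equation there would
    -- give `κ₁ |F|² = 0`.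
    have hnn : 0 ≤ tS - s := by
      by_contra hlt
      have e := hFS.inner_eq (not_le.1 hlt)
      rw [mul_zero, add_zero, zero_mul, eq_comm, mul_eq_zero, neg_eq_zero] at e
      exact (hF 0 (not_le.1 hlt)).2 (inner_self_eq_zero.1 (e.resolve_left hκ))
    obtain ⟨q, hq⟩ := exists_spiral_of_deriv (F := F) (l := θ / κ₁) hnn fun t ht => by
      have ht0 : 0 < t := hnn.trans_lt ht
      have e := hFS.2 t ht
      rw [zero_add, smul_apply] at e
      refine (hF.hasDerivAt ht).congr_deriv ?_
      have e1 : deriv F t = (2 * κ₁ * t)⁻¹ • (θ • rotGen (F t) - κ₁ • F t) := by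
        rw [← e, smul_smul, inv_mul_cancel₀ (by positivity), one_smul]
      rw [e1, smul_sub, smul_smul, smul_smul]
      congr 2 <;> field_simp
    refine ⟨.four (θ / κ₁) (q 0) (q 1) (q 2), M, s, ⟨fun t ht => ?_, hnn⟩, fun h => ?_,
      fun h => ?_⟩
    · rw [Row.flux_four, eta3]; exact hq t ht
    · refine hFrot (hasRotation_of_line q fun t ht => ⟨(Real.sqrt t)⁻¹, ?_⟩)
      rw [hq t ht, h, mul_zero, zero_mul, rot_zero]
    · refine hFrot (hasRotation_of_line !₂[0, 0, 1] fun t ht => ⟨(Real.sqrt t)⁻¹ * q 2, ?_⟩)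
      rw [hq t ht, eq_axis h, rot_smul, rot_axis, smul_smul]
      simp

end NormalForms

/-! ### The groups of the table -/

/-- A linear form given by its values on the standard basis. -/
noncomputable def coordForm {N : ℕ} (r : ℝ) (i : Fin N) : (Fin N → ℝ) →L[ℝ] ℝ :=
  r • ContinuousLinearMap.proj i

@[simp] theorem coordForm_apply {N : ℕ} (r : ℝ) (i : Fin N) (a : Fin N → ℝ) :
    coordForm r i a = r * a i := rfl

/-- The three parameters of the space translations. -/
noncomputable def coordVec {N : ℕ} (i j k : Fin N) : (Fin N → ℝ) →L[ℝ] E3 :=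
  LinearMap.toContinuousLinearMap
    { toFun := fun a => !₂[a i, a j, a k]
      map_add' := fun a b => by ext n; fin_cases n <;> simp
      map_smul' := fun r a => by ext n; fin_cases n <;> simp }

@[simp] theorem coordVec_apply {N : ℕ} (i j k : Fin N) (a : Fin N → ℝ) :
    coordVec i j k a = !₂[a i, a j, a k] := rfl

/-- The inclusion of the space translations. -/
noncomputable def coordIncl {N : ℕ} (i j k : Fin N) : E3 →L[ℝ] (Fin N → ℝ) :=
  LinearMap.toContinuousLinearMap
    { toFun := fun z => Pi.single i (z 0) + Pi.single j (z 1) + Pi.single k (z 2)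
      map_add' := fun a b => by
        simp only [PiLp.add_apply, Pi.single_add]; abel
      map_smul' := fun r a => by
        simp only [PiLp.smul_apply, Pi.single_smul, RingHom.id_apply, smul_add] }

theorem coordIncl_apply {N : ℕ} (i j k : Fin N) (z : E3) :
    coordIncl i j k z = Pi.single i (z 0) + Pi.single j (z 1) + Pi.single k (z 2) := rfl

/-- The group of space translations. -/
noncomputable def translationData : SimilarityData 3 where
  c := 0
  k := 0
  θ := 0
  y := coordVec 0 1 2
  ι := coordIncl 0 1 2
  P := LinearIsometryEquiv.refl ℝ E3
  t0 := 0
  y_ι z := by ext n; fin_cases n <;> simp [coordIncl_apply]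
  c_ι z := rfl
  k_ι z := rfl
  θ_ι z := rfl
  comm a b := Or.inl rfl
  inj a _ _ _ h := by
    have h0 := congrArg (fun z : E3 => z 0) h
    have h1 := congrArg (fun z : E3 => z 1) h
    have h2 := congrArg (fun z : E3 => z 2) h
    simp at h0 h1 h2
    ext n; fin_cases n <;> assumption

/-- The four-parameter groups of the table. -/
noncomputable def fourData (c k θ : ℝ) (hck : k = 0 ∨ c = 0) (h : c ≠ 0 ∨ k ≠ 0 ∨ θ ≠ 0)
    (P : E3 ≃ₗᵢ[ℝ] E3) (t0 : ℝ) : SimilarityData 4 where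
  c := coordForm c 3
  k := coordForm k 3
  θ := coordForm θ 3
  y := coordVec 0 1 2
  ι := coordIncl 0 1 2
  P := P
  t0 := t0
  y_ι z := by ext n; fin_cases n <;> simp [coordIncl_apply]
  c_ι z := by simp [coordIncl_apply]
  k_ι z := by simp [coordIncl_apply]
  θ_ι z := by simp [coordIncl_apply]
  comm a b := by rcases hck with rfl | rfl <;> simp
  inj a e1 e2 e3 h' := by
    have h0 := congrArg (fun z : E3 => z 0) h'
    have h1 := congrArg (fun z : E3 => z 1) h'
    have h2 := congrArg (fun z : E3 => z 2) h'
    simp at h0 h1 h2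
    simp only [coordForm_apply] at e1 e2 e3
    have h3 : a 3 = 0 := by
      rcases h with h | h | h
      · exact (mul_eq_zero.1 e1).resolve_left h
      · exact (mul_eq_zero.1 e2).resolve_left h
      · exact (mul_eq_zero.1 e3).resolve_left h
    ext n; fin_cases n <;> assumption

/-- The five-parameter group with time translations. -/
noncomputable def fiveData (P : E3 ≃ₗᵢ[ℝ] E3) (t0 : ℝ) : SimilarityData 5 where
  c := coordForm 1 0
  k := 0
  θ := coordForm 1 4
  y := coordVec 1 2 3
  ι := coordIncl 1 2 3
  P := P
  t0 := t0
  y_ι z := by ext n; fin_cases n <;> simp [coordIncl_apply]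
  c_ι z := by simp [coordIncl_apply]
  k_ι z := rfl
  θ_ι z := by simp [coordIncl_apply]
  comm a b := Or.inl rfl
  inj a e1 e2 e3 h' := by
    have h0 := congrArg (fun z : E3 => z 0) h'
    have h1 := congrArg (fun z : E3 => z 1) h'
    have h2 := congrArg (fun z : E3 => z 2) h'
    simp at h0 h1 h2
    simp only [coordForm_apply, one_mul] at e1 e3
    ext n; fin_cases n <;> assumption

/-- The five-parameter group with scalings. -/
noncomputable def sixData (P : E3 ≃ₗᵢ[ℝ] E3) (t0 : ℝ) : SimilarityData 5 where
  c := 0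
  k := coordForm 1 3
  θ := coordForm 1 4
  y := coordVec 0 1 2
  ι := coordIncl 0 1 2
  P := P
  t0 := t0
  y_ι z := by ext n; fin_cases n <;> simp [coordIncl_apply]
  c_ι z := rfl
  k_ι z := by simp [coordIncl_apply]
  θ_ι z := by simp [coordIncl_apply]
  comm a b := Or.inr rfl
  inj a e1 e2 e3 h' := by
    have h0 := congrArg (fun z : E3 => z 0) h'
    have h1 := congrArg (fun z : E3 => z 1) h'
    have h2 := congrArg (fun z : E3 => z 2) h'
    simp at h0 h1 h2
    simp only [coordForm_apply, one_mul] at e2 e3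
    ext n; fin_cases n <;> assumption

/-- The group of a row, conjugated by an isometry and a translation of time. -/
noncomputable def Row.data (r : Row) (P : E3 ≃ₗᵢ[ℝ] E3) (t0 : ℝ) : SimilarityData r.dim :=
  match r with
  | two _ => fourData 0 0 1 (Or.inl rfl) (Or.inr (Or.inr one_ne_zero)) P t0
  | three l _ _ _ => fourData 1 0 l (Or.inl rfl) (Or.inl one_ne_zero) P t0
  | four l _ _ _ => fourData 0 1 l (Or.inr rfl) (Or.inr (Or.inl one_ne_zero)) P t0
  | five _ => fiveData P t0
  | six _ => sixData P t0

theorem Row.data_P (r : Row) (P : E3 ≃ₗᵢ[ℝ] E3) (t0 : ℝ) : (r.data P t0).P = P := by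
  cases r <;> rfl

theorem Row.data_t0 (r : Row) (P : E3 ≃ₗᵢ[ℝ] E3) (t0 : ℝ) : (r.data P t0).t0 = t0 := by
  cases r <;> rfl

theorem translation_sum (a b c : ℝ) (x : E3) :
    x + !₂[0, 0, c] + !₂[0, b, 0] + !₂[a, 0, 0] = x + !₂[a, b, c] := by
  ext n; fin_cases n <;> simp

theorem ofBase_congr {f f' : Base → Base} (h : ∀ b, f b = f' b) :
    PointTransformation.ofBase f = PointTransformation.ofBase f' := by
  rw [funext h]

theorem translation_comp (a b c : ℝ) (f : Base → Base) :
    (T1 a).comp ((T2 b).comp ((T3 c).comp (.ofBase f)))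
      = .ofBase fun q => ((f q).1, (f q).2 + !₂[a, b, c]) :=
  ofBase_congr fun q => Prod.ext rfl (translation_sum a b c (f q).2)

theorem family_translationData : translationData.family = trivialGroup := by
  funext ε
  refine Eq.trans (ofBase_congr fun b => ?_)
    (translation_comp (ε 0) (ε 1) (ε 2) id).symm
  simp [SimilarityData.time, SimilarityData.lin_apply, SimilarityData.orth, translationData,
    rot_zero]

theorem family_fourData (c k θ : ℝ) (hck : k = 0 ∨ c = 0) (h : c ≠ 0 ∨ k ≠ 0 ∨ θ ≠ 0)
    (ε : Fin 4 → ℝ) : (fourData c k θ hck h (LinearIsometryEquiv.refl ℝ E3) 0).family ε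
      = .ofBase fun b => (Real.exp (2 * (k * ε 3)) * b.1 + c * ε 3,
        Real.exp (k * ε 3) • rot (θ * ε 3) b.2 + !₂[ε 0, ε 1, ε 2]) := by
  refine ofBase_congr fun b => ?_
  simp [SimilarityData.time, SimilarityData.lin_apply, SimilarityData.orth, fourData]
  rfl

theorem Row.family_data (r : Row) :
    (r.data (LinearIsometryEquiv.refl ℝ E3) 0).family = r.group := by
  cases r with
  | two q =>
    change (fourData 0 0 1 (Or.inl rfl) (Or.inr (Or.inr one_ne_zero)) _ _).family = group2
    funext ε
    refine (family_fourData _ _ _ _ _ ε).trans (Eq.trans (ofBase_congr fun b => ?_)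
      (translation_comp _ _ _ _).symm)
    simp
  | three l q₁ q₂ q₃ =>
    change (fourData 1 0 l (Or.inl rfl) (Or.inl one_ne_zero) _ _).family = group3 l
    funext ε
    refine (family_fourData _ _ _ _ _ ε).trans (Eq.trans (ofBase_congr fun b => ?_)
      (translation_comp _ _ _ _).symm)
    simp
  | four l q₁ q₂ q₃ =>
    change (fourData 0 1 l (Or.inr rfl) (Or.inr (Or.inl one_ne_zero)) _ _).family = group4 l
    funext ε
    refine (family_fourData _ _ _ _ _ ε).trans (Eq.trans (ofBase_congr fun b => ?_)
      (translation_comp _ _ _ _).symm)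
    simp
  | five q =>
    change (fiveData _ _).family = group5
    funext ε
    have h : group5 ε = (T0 (ε 0)).comp (.ofBase fun q => (q.1, rot (ε 4) q.2
        + !₂[ε 1, ε 2, ε 3])) := congrArg _ (translation_comp _ _ _ _)
    rw [h]
    refine ofBase_congr fun b => ?_
    simp [SimilarityData.time, SimilarityData.lin_apply, SimilarityData.orth, fiveData]
    rfl
  | six q =>
    change (sixData _ _).family = group6
    funext ε
    refine Eq.trans (ofBase_congr fun b => ?_) (translation_comp (ε 0) (ε 1) (ε 2)
      fun q => (Real.exp (2 * ε 3) * q.1, Real.exp (ε 3) • rot (ε 4) q.2)).symm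
    simp [SimilarityData.time, SimilarityData.lin_apply, SimilarityData.orth, sixData]
    rfl

theorem Row.exists_param {r : Row} {κ₀ κ₁ θ : ℝ} (h : r.Sym κ₀ κ₁ θ) (P : E3 ≃ₗᵢ[ℝ] E3)
    (t0 : ℝ) : ∃ g, (r.data P t0).c g = κ₀ ∧ (r.data P t0).k g = κ₁ ∧ (r.data P t0).θ g = θ := by
  cases r with
  | two q =>
    obtain ⟨rfl, rfl⟩ := h
    exact ⟨![0, 0, 0, θ], zero_mul θ, zero_mul θ, one_mul θ⟩
  | three l q₁ q₂ q₃ =>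
    obtain ⟨rfl, rfl⟩ := h
    exact ⟨![0, 0, 0, κ₀], one_mul κ₀, zero_mul κ₀, rfl⟩
  | four l q₁ q₂ q₃ =>
    obtain ⟨rfl, rfl⟩ := h
    exact ⟨![0, 0, 0, κ₁], zero_mul κ₁, one_mul κ₁, rfl⟩
  | five q =>
    obtain rfl := h
    exact ⟨![κ₀, 0, 0, 0, θ], one_mul κ₀, rfl, one_mul θ⟩
  | six q =>
    obtain rfl := h
    exact ⟨![0, 0, 0, κ₁, θ], rfl, one_mul κ₁, one_mul θ⟩

/-- Equivariance of the fluxes of the table. -/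
theorem Row.equivariant {r : Row} {F : ℝ → E3} {tS : ℝ} (h : r.FitsOn F tS) (P : E3 ≃ₗᵢ[ℝ] E3)
    (t0 : ℝ) (ε : Fin r.dim → ℝ) {t t' : ℝ} (ht : tS < t) (ht' : tS < t')
    (e : t' = Real.exp (2 * (r.data P t0).k ε) * t + (r.data P t0).c ε) :
    rot ((r.data P t0).θ ε) (F t) = Real.exp ((r.data P t0).k ε) • F t' := by
  have hscale : ∀ k : ℝ, 0 ≤ tS → t' = Real.exp (2 * k) * t →
      (Real.sqrt t)⁻¹ = Real.exp k * (Real.sqrt t')⁻¹ := by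
    intro k h0 e
    have e1 : Real.exp (2 * k) = Real.exp k ^ 2 := by rw [sq, ← Real.exp_add, two_mul]
    rw [e, e1, Real.sqrt_mul (sq_nonneg _), Real.sqrt_sq (Real.exp_pos k).le, mul_inv,
      ← mul_assoc, mul_inv_cancel₀ (Real.exp_pos k).ne', one_mul]
  rw [h.1 ht, h.1 ht']
  cases r with
  | two q =>
    change t' = Real.exp (2 * (0 * ε (3 : Fin 4))) * t + 0 * ε (3 : Fin 4) at e
    change rot (1 * ε (3 : Fin 4)) !₂[0, 0, q t]
      = Real.exp (0 * ε (3 : Fin 4)) • (!₂[0, 0, q t'] : E3)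
    rw [rot_axis, e]
    simp
  | three l q₁ q₂ q₃ =>
    change t' = Real.exp (2 * (0 * ε (3 : Fin 4))) * t + 1 * ε (3 : Fin 4) at e
    change rot (l * ε (3 : Fin 4)) _ = Real.exp (0 * ε (3 : Fin 4)) • _
    rw [e, flux_three, flux_three, rot_rot, zero_mul, mul_zero, Real.exp_zero, one_smul, one_mul,
      one_mul, mul_add, add_comm (l * t)]
  | four l q₁ q₂ q₃ =>
    have h0 : 0 ≤ tS := h.2
    change t' = Real.exp (2 * (1 * ε (3 : Fin 4))) * t + 0 * ε (3 : Fin 4) at e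
    change rot (l * ε (3 : Fin 4)) _ = Real.exp (1 * ε (3 : Fin 4)) • _
    rw [zero_mul, add_zero] at e
    rw [flux_four, flux_four, rot_smul, rot_rot, smul_smul, ← hscale _ h0 e, e,
      Real.log_mul (Real.exp_pos _).ne' (h0.trans_lt ht).ne', Real.log_exp]
    congr 2; ring
  | five q =>
    change rot (1 * ε (4 : Fin 5)) _ = Real.exp 0 • _
    rw [flux_five, flux_five, rot_axis, Real.exp_zero, one_smul]
  | six q =>
    have h0 : 0 ≤ tS := h.2
    change t' = Real.exp (2 * (1 * ε (3 : Fin 5))) * t + 0 at e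
    change rot (1 * ε (4 : Fin 5)) _ = Real.exp (1 * ε (3 : Fin 5)) • _
    rw [add_zero] at e
    rw [flux_six, flux_six, rot_smul, rot_axis, smul_smul, ← hscale _ h0 e]

/-! ### Maximal groups of invariance -/

/-- `generator_form` bounds the generators of all invariance groups from above by flux symmetries
and translations; `h` says that `D` already realises every flux symmetry. -/
theorem SimilarityData.isMGI {N : ℕ} (D : SimilarityData N) {B : BVP} (hQ : D.Preserves B)
    (h : ∀ κ₀ κ₁ A, FluxSym B.Q B.tStar κ₀ κ₁ A →
      ∃ g, D.c g = κ₀ + 2 * κ₁ * D.t0 ∧ D.k g = κ₁ ∧ ∀ x, D.θ g • D.gen x = A x) :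
    B.IsMGI D.family := by
  refine ⟨D.admits hQ, fun N' W' G' hG hB i => ?_⟩
  obtain ⟨κ₀, κ₁, A, y₀, hA, hgen, hflux⟩ := generator_form hG hB i
  obtain ⟨g, h1, h2, h3⟩ := h κ₀ κ₁ A ⟨hA, hflux⟩
  -- The `ι`-term corrects the translation part without affecting `c`, `k`, `θ`.
  refine ⟨g + D.ι (y₀ - D.y g), fun p hp => ?_⟩
  rw [hgen p hp, D.sum_generator, D.inf_apply]
  simp only [map_add D.c, map_add D.k, map_add D.θ, map_add D.y, D.c_ι, D.k_ι, D.θ_ι, D.y_ι,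
    add_zero, h1, h2, h3]
  refine Prod.ext (Prod.ext ?_ ?_) rfl
  · simp only; ring
  · simp only; abel

/-- The `N` independent generators of `G` lie in the span of the `N'` generators of `G'`. -/
theorem BVP.IsMGI.le {B : BVP} {N N' : ℕ} {G : Family N} {G' : Family N'} (hG : B.Admits G)
    (hG' : B.IsMGI G') : N ≤ N' := by
  obtain ⟨⟨L, hL⟩, hB⟩ := hG
  have hli := hL.independent
  have hsub : Submodule.span ℝ (Set.range fun i => fun p : B.domain => G.generator i p)
      ≤ Submodule.span ℝ (Set.range fun i => fun p : B.domain => G'.generator i p) := by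
    rw [Submodule.span_le]
    rintro _ ⟨i, rfl⟩
    obtain ⟨c, hc⟩ := hG'.2 N _ G ⟨L, hL⟩ hB i
    have : (fun p : B.domain => G.generator i p)
        = ∑ j, c j • (fun p : B.domain => G'.generator j p) := by
      funext p
      simpa [Finset.sum_apply] using hc p p.2
    simp only [SetLike.mem_coe, this]
    exact Submodule.sum_mem _ fun j _ =>
      Submodule.smul_mem _ _ (Submodule.subset_span (Set.mem_range_self j))
  have h1 := finrank_span_eq_card hli
  have : Module.Finite ℝ (Submodule.span ℝ
      (Set.range fun i => fun p : B.domain => G'.generator i p)) :=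
    Module.Finite.span_of_finite ℝ (Set.finite_range _)
  have h2 := Submodule.finrank_mono hsub
  have h3 := finrank_range_le_card (R := ℝ) (fun i => fun p : B.domain => G'.generator i p)
  simp only [Fintype.card_fin, Set.finrank] at h1 h3
  omega

theorem BVP.IsMGI.dim_eq {B : BVP} {N N' : ℕ} {G : Family N} {G' : Family N'} (hG : B.IsMGI G)
    (hG' : B.IsMGI G') : N = N' :=
  le_antisymm (hG'.le hG.1) (hG.le hG'.1)

theorem Row.preserves {r : Row} {B : BVP} (P : E3 ≃ₗᵢ[ℝ] E3) (t0 : ℝ)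
    (h : r.FitsOn (fun t => P.symm (B.Q (t + t0))) (B.tStar - t0)) :
    (r.data P t0).Preserves B := by
  intro ε t ht ht'
  have e := Row.equivariant h P t0 ε (t := t - t0) (t' := (r.data P t0).time ε t - t0)
    (by linarith) (by linarith) (by
      rw [SimilarityData.time, Row.data_t0]; ring)
  simp only [sub_add_cancel] at e
  rw [SimilarityData.orth, Row.data_P, e, map_smul, P.apply_symm_apply]

theorem NormalForm.isMGI {B : BVP} {r : Row} {M : Matrix.specialOrthogonalGroup (Fin 3) ℝ}
    {t0 : ℝ} (h : NormalForm B.Q B.tStar r M t0) : B.IsMGI (r.data (matIso M) t0).family := by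
  refine SimilarityData.isMGI _ (Row.preserves _ _ h.1) fun κ₀ κ₁ A hS => ?_
  obtain ⟨θ, hθ, hsym⟩ := Row.fluxSym_mp B.isFlux.shift h.1 h.2 (hS.shift B.isFlux)
  obtain ⟨g, h1, h2, h3⟩ := Row.exists_param hsym (matIso M) t0
  refine ⟨g, by rw [h1, Row.data_t0], h2, fun x => ?_⟩
  have e := congrArg (fun L => matIso M (L ((matIso M).symm x))) hθ
  simp only [conjBy_apply, LinearIsometryEquiv.symm_symm, LinearIsometryEquiv.apply_symm_apply,
    smul_apply, map_smul] at e
  rw [SimilarityData.gen_apply, Row.data_P, h3, e]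

theorem matIso_one_eq : matIso 1 = LinearIsometryEquiv.refl ℝ E3 :=
  LinearIsometryEquiv.ext matIso_one

theorem admits_trivialGroup (B : BVP) : B.Admits trivialGroup := by
  rw [← family_translationData]
  refine translationData.admits fun ε t _ _ => ?_
  simp [SimilarityData.orth, SimilarityData.time, translationData, rot_zero]

theorem isMGI_trivialGroup {B : BVP} (h : ¬∃ r M t0, NormalForm B.Q B.tStar r M t0) :
    B.IsMGI trivialGroup := by
  rw [← family_translationData]
  refine translationData.isMGI (fun ε t _ _ => ?_) fun κ₀ κ₁ A hS => ?_
  · simp [SimilarityData.orth, SimilarityData.time, translationData, rot_zero]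
  · by_cases h0 : κ₀ = 0 ∧ κ₁ = 0 ∧ A = 0
    · obtain ⟨rfl, rfl, rfl⟩ := h0
      exact ⟨0, by simp⟩
    · exact absurd (exists_normalForm B.isFlux hS h0) h

theorem admits_group {r : Row} {B : BVP} (h : r.Fits B) : B.Admits r.group := by
  rw [← Row.family_data]
  refine SimilarityData.admits _ (Row.preserves _ _ ?_)
  simp only [add_zero, sub_zero]
  exact (Row.fits_iff r B).1 h

theorem isMGI_group {r : Row} {B : BVP} (h : r.Fits B) (hg : r.Generic B.tStar) :
    B.IsMGI r.group := by
  rw [← Row.family_data, ← matIso_one_eq]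
  refine NormalForm.isMGI ⟨?_, by rwa [sub_zero]⟩
  simp only [matIso_one_eq, add_zero, sub_zero]
  exact (Row.fits_iff r B).1 h

/-! ### Reduction by equivalence transformations -/

/-- A negative `α` would map the half-line to one bounded above. Equivalence thus preserves the
direction of time. -/
theorem affine_image_Ioi {α γ a b : ℝ} (hα : α ≠ 0)
    (h : (fun t => α * t + γ) '' Set.Ioi a = Set.Ioi b) : 0 < α ∧ b = α * a + γ := by
  have hpos : 0 < α := by
    by_contra hneg
    have hlt : α < 0 := lt_of_le_of_ne (not_lt.1 hneg) hα
    have hmem : max b (α * a + γ) + 1 ∈ Set.Ioi b :=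
      Set.mem_Ioi.2 (lt_of_le_of_lt (le_max_left b (α * a + γ)) (lt_add_one _))
    rw [← h] at hmem
    obtain ⟨t, ht, e⟩ := hmem
    have h1 : α * t < α * a := mul_lt_mul_of_neg_left ht hlt
    have h2 := le_max_right b (α * a + γ)
    simp only at e
    linarith
  refine ⟨hpos, ?_⟩
  have : Set.Ioi b = Set.Ioi (α * a + γ) := by
    rw [← h]
    ext x
    constructor
    · rintro ⟨t, ht, rfl⟩
      have := mul_lt_mul_of_pos_left (show a < t from ht) hpos
      simp only [Set.mem_Ioi]
      linarith
    · intro hx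
      refine ⟨(x - γ) / α, ?_, by field_simp; ring⟩
      rw [Set.mem_Ioi, lt_div_iff₀ hpos]
      have : α * a + γ < x := hx
      linarith
  exact Set.Ioi_injective this

theorem BVP.ReducesTo.invariants {B : BVP} {r : Row} (h : B.ReducesTo r) :
    (HasRotation B.Q B.tStar ↔ r.number = 2 ∨ r.number = 5 ∨ r.number = 6) ∧
    (HasScaling B.Q B.tStar ↔ r.number = 4 ∨ r.number = 6) ∧
    (HasTranslation B.Q B.tStar ↔ r.number = 3 ∨ r.number = 5) := by
  obtain ⟨B', ⟨α, β, δ₁, δ₂, γ₀, γ₄, γ₅, R, hR, hne, him, -, -, -, -, -, -, -, -, -, -, -, -, -, hQ⟩,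
    hfit, hgen⟩ := h
  have hα : α ≠ 0 := by
    rintro rfl
    simp at hne
  obtain ⟨hpos, htS⟩ := affine_image_Ioi hα him
  obtain ⟨e1, e2, e3⟩ := invariants_iff (R := matIso ⟨R, hR⟩) B.isFlux hpos htS hQ
  obtain ⟨k1, k2, k3⟩ := Row.invariants B'.isFlux ((Row.fits_iff r B').1 hfit) hgen
  exact ⟨e1.trans k1, e2.trans k2, e3.trans k3⟩

theorem NormalForm.invariants {B : BVP} {r : Row} {M : Matrix.specialOrthogonalGroup (Fin 3) ℝ}
    {t0 : ℝ} (h : NormalForm B.Q B.tStar r M t0) :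
    (HasRotation B.Q B.tStar ↔ r.number = 2 ∨ r.number = 5 ∨ r.number = 6) ∧
    (HasScaling B.Q B.tStar ↔ r.number = 4 ∨ r.number = 6) ∧
    (HasTranslation B.Q B.tStar ↔ r.number = 3 ∨ r.number = 5) := by
  obtain ⟨e1, e2, e3⟩ := invariants_shift (M := M) (s := t0) B.isFlux
  obtain ⟨k1, k2, k3⟩ := Row.invariants B.isFlux.shift h.1 h.2
  exact ⟨e1.trans k1, e2.trans k2, e3.trans k3⟩

/-- The problem with the flux `M⁻¹ Q(t + t₀)`. -/
noncomputable def BVP.shift (B : BVP) (M : Matrix.specialOrthogonalGroup (Fin 3) ℝ) (t0 : ℝ) :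
    BVP :=
  { B with
    tStar := B.tStar - t0
    Q := fun t => (matIso M).symm (B.Q (t + t0))
    smooth_Q := (matIso M).symm.contDiff.comp_contDiffOn
      (B.smooth_Q.comp (contDiff_id.add contDiff_const).contDiffOn fun t ht => by
        have : B.tStar - t0 < t := ht
        simp only [Set.mem_Ioi]
        linarith)
    Q_ne_zero := fun t ht => (map_ne_zero_iff _ (matIso M).symm.injective).2
      (B.Q_ne_zero _ (by linarith)) }

theorem BVP.equivalent_shift (B : BVP) (M : Matrix.specialOrthogonalGroup (Fin 3) ℝ) (t0 : ℝ) :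
    B.Equivalent (B.shift M t0) := by
  have hM : M.1.transpose ∈ Matrix.specialOrthogonalGroup (Fin 3) ℝ := by
    have h := Matrix.mem_specialOrthogonalGroup_iff.1 M.2
    refine Matrix.mem_specialOrthogonalGroup_iff.2 ⟨?_, by rw [Matrix.det_transpose]; exact h.2⟩
    rw [Matrix.mem_orthogonalGroup_iff]
    simpa using (Matrix.mem_orthogonalGroup_iff' (Fin 3) ℝ).1 h.1
  refine ⟨1, 1, 1, 1, -t0, 0, 0, M.1.transpose, hM, by norm_num, ?_, by simp [shift],
    by simp [shift], by simp [shift], by simp [shift], by simp [shift], by simp [shift],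
    by simp [shift], by simp [shift], by simp [shift], by simp [shift], by simp [shift],
    by simp [shift], by simp [shift], fun t _ => ?_⟩
  · simp [shift, sub_eq_add_neg]
  · simp only [shift, one_mul, neg_add_cancel_right]
    rfl

theorem NormalForm.reducesTo {B : BVP} {r : Row} {M : Matrix.specialOrthogonalGroup (Fin 3) ℝ}
    {t0 : ℝ} (h : NormalForm B.Q B.tStar r M t0) : B.ReducesTo r :=
  ⟨B.shift M t0, B.equivalent_shift M t0, (Row.fits_iff r _).2 h.1, h.2⟩

/-- A general equivalence also rescales time, whereas a normal form uses only a rotation and a time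
shift. The scaling need not be undone: the three invariants provide a nontrivial symmetry, hence
some normal form, and fix its row number. -/
theorem BVP.ReducesTo.exists_normalForm {B : BVP} {r : Row} (h : B.ReducesTo r) :
    ∃ r' M t0, NormalForm B.Q B.tStar r' M t0 ∧ r'.number = r.number := by
  obtain ⟨h1, h2, h3⟩ := h.invariants
  have hex : ∃ r' M t0, NormalForm B.Q B.tStar r' M t0 := by
    by_cases e1 : HasRotation B.Q B.tStar
    · exact exists_normalForm_of_hasRotation e1
    by_cases e2 : HasScaling B.Q B.tStar
    · obtain ⟨κ₀, κ₁, A, hκ, hS⟩ := e2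
      exact StefanBVP.exists_normalForm B.isFlux hS fun h => hκ h.2.1
    by_cases e3 : HasTranslation B.Q B.tStar
    · obtain ⟨κ₀, A, hκ, hS⟩ := e3
      exact StefanBVP.exists_normalForm B.isFlux hS fun h => hκ h.1
    rw [h1] at e1
    rw [h2] at e2
    rw [h3] at e3
    cases r <;> simp [Row.number] at e1 e2 e3
  obtain ⟨r', M, t0, hr'⟩ := hex
  obtain ⟨k1, k2, k3⟩ := hr'.invariants
  exact ⟨r', M, t0, hr', Row.number_eq_of_iff (k1.symm.trans h1) (k2.symm.trans h2)
    (k3.symm.trans h3)⟩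

theorem Row.three_lt_dim (r : Row) : 3 < r.dim := by
  cases r <;> simp [dim]

theorem not_exists_normalForm {B : BVP} (h : ¬∃ r, B.ReducesTo r) :
    ¬∃ r M t0, NormalForm B.Q B.tStar r M t0 := by
  rintro ⟨r, M, t0, hr⟩
  exact h ⟨r, hr.reducesTo⟩

/-- Whether a normal form exists, and the group attached to it, depend only on the values of the
flux on the time interval, so the group can be chosen before the problem. -/
theorem exists_group_of_flux (tStar : ℝ) (Q : ℝ → E3) : ∃ (N : ℕ) (G : Family N),
    ∀ B : BVP, B.tStar = tStar → Set.EqOn B.Q Q (Set.Ioi tStar) → B.IsMGI G := by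
  have hcongr : ∀ {B : BVP} {r : Row} {M : Matrix.specialOrthogonalGroup (Fin 3) ℝ} {t0 : ℝ},
      B.tStar = tStar → Set.EqOn B.Q Q (Set.Ioi tStar) →
      (NormalForm B.Q B.tStar r M t0 ↔ NormalForm Q tStar r M t0) := by
    intro B r M t0 ht hQ
    have he : Set.EqOn (fun t => (matIso M).symm (B.Q (t + t0)))
        (fun t => (matIso M).symm (Q (t + t0))) (Set.Ioi (tStar - t0)) := fun t h => by
      have h' : tStar - t0 < t := h
      simp only
      rw [hQ (Set.mem_Ioi.2 (by linarith))]
    rw [NormalForm, NormalForm, ht]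
    exact and_congr_left fun _ => and_congr_left fun _ => ⟨fun h => he.symm.trans h, fun h => he.trans h⟩
  by_cases h : ∃ r M t0, NormalForm Q tStar r M t0
  · obtain ⟨r, M, t0, hr⟩ := h
    exact ⟨_, _, fun B ht hQ => ((hcongr ht hQ).2 hr).isMGI⟩
  · refine ⟨_, _, fun B ht hQ => isMGI_trivialGroup ?_⟩
    rintro ⟨r, M, t0, hr⟩
    exact h ⟨r, M, t0, (hcongr ht hQ).1 hr⟩

end StefanBVP

/-! ### Assembly of the classification. -/

theorem theorem2 :
    -- every problem of the class admits the three-parameter group of translations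
    (∀ B : StefanBVP.BVP, B.Admits StefanBVP.trivialGroup) ∧
    -- the MGI is determined by the flux alone, whatever the diffusivities are
    (∀ (tStar : ℝ) (Q : ℝ → StefanBVP.E3), ∃ (N : ℕ) (G : StefanBVP.Family N),
      ∀ B : StefanBVP.BVP, B.tStar = tStar → Set.EqOn B.Q Q (Set.Ioi tStar) → B.IsMGI G) ∧
    -- the groups in the table are groups of invariance
    (∀ (r : StefanBVP.Row) (B : StefanBVP.BVP), r.Fits B → B.Admits r.group) ∧
    -- and they are the MGIs
    (∀ (r : StefanBVP.Row) (B : StefanBVP.BVP), r.Fits B → r.Generic B.tStar →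
      B.IsMGI r.group) ∧
    -- an MGI of dimension higher than three occurs exactly for the rows 2 to 6, up to equivalence
    (∀ B : StefanBVP.BVP,
      (∃ (N : ℕ) (G : StefanBVP.Family N), 3 < N ∧ B.IsMGI G) ↔
        ∃ r : StefanBVP.Row, B.ReducesTo r) ∧
    -- in all the other cases the MGI is the trivial group
    (∀ B : StefanBVP.BVP, (¬ ∃ r : StefanBVP.Row, B.ReducesTo r) →
      B.IsMGI StefanBVP.trivialGroup) ∧
    -- an MGI of higher dimension has four or five parameters
    (∀ (B : StefanBVP.BVP) (r : StefanBVP.Row) (N : ℕ) (G : StefanBVP.Family N),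
      B.ReducesTo r → B.IsMGI G → N = r.dim) ∧
    -- the five rows are mutually inequivalent
    (∀ (B : StefanBVP.BVP) (r r' : StefanBVP.Row), B.ReducesTo r → B.ReducesTo r' →
      r.number = r'.number) := by
  refine ⟨StefanBVP.admits_trivialGroup, StefanBVP.exists_group_of_flux,
    fun r B => StefanBVP.admits_group, fun r B => StefanBVP.isMGI_group, fun B => ⟨?_, ?_⟩,
    fun B h => StefanBVP.isMGI_trivialGroup (StefanBVP.not_exists_normalForm h),
    fun B r N G h hG => ?_, fun B r r' h h' => ?_⟩
  · rintro ⟨N, G, hN, hG⟩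
    by_contra h
    -- Without a reduction the three-parameter group is already maximal, which bounds `N` by 3.
    have := (StefanBVP.isMGI_trivialGroup (StefanBVP.not_exists_normalForm h)).le hG.1
    omega
  · rintro ⟨r, h⟩
    obtain ⟨r', M, t0, hr', -⟩ := h.exists_normalForm
    exact ⟨_, _, r'.three_lt_dim, hr'.isMGI⟩
  · obtain ⟨r', M, t0, hr', hnum⟩ := h.exists_normalForm
    exact (hG.dim_eq hr'.isMGI).trans (StefanBVP.Row.dim_eq_of_number hnum)
  · obtain ⟨h1, h2, h3⟩ := h.invariants
    obtain ⟨k1, k2, k3⟩ := h'.invariants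
    exact StefanBVP.Row.number_eq_of_iff (h1.symm.trans k1) (h2.symm.trans k2) (h3.symm.trans k3)
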